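/- **Setting.** Let $\Omega\subset\mathbb{C}$ be open and simply connected and $z_0\in\Omega$. Put $J=\begin{pmatrix}0&-1\\1&0\end{pmatrix}$, and let $\tau$ be the automorphism $\tau(M)=-\mathrm{diag}(-J,1)\,{}^tM\,\mathrm{diag}(J,1)$ of $\mathfrak{u}(3)^{\mathbb C}=M(3,\mathbb{C})$ and $\tau(g)=\mathrm{diag}(-J,1)\,{}^tg^{-1}\,\mathrm{diag}(J,1)$ of $GL(3,\mathbb{C})$. Let $\mathfrak{u}(3)^{\mathbb C}_a$ be the eigenspace of $\tau$ for the eigenvalue $i^a$, let $\mathfrak u(3)_0=\mathfrak u(3)^{\mathbb C}_0\cap\mathfrak u(3)$, and let $U(3)_0=\{\mathrm{diag}(g,1): g\in SU(2)\}\cong SU(2)$, a group of fixed points of $\tau$. A *family of Hamiltonian stationary conformal Lagrangian immersions* is a family of smooth maps $F_\lambda:\Omega\to U(3)$, $\lambda\in S^1$, with $\tau(F_\lambda)=F_{i\lambda}$, such that $F:=F_{\lambda=1}$ is a Legendrian framing of a Hamiltonian stationary conformal Lagrangian immersion $u:\Omega\to\mathbb{C}P^2$ (the last column $\hat u:\Omega\to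 S^5$ of $F$ is a horizontal lift of $u$, and $\det F=e^{i\beta}=\det\big(\tfrac{\hat u_x}{|\hat u_x|},\tfrac{\hat u_y}{|\hat u_y|},\hat u\big)$; Hamiltonian stationary means that the first variation of area vanishes along $J\nabla f$ for all $f\in C_c^\infty(\Omega,\mathbb R)$), and such that $A_\lambda:=F_\lambda^{-1}dF_\lambda$ equals $$A_\lambda=\lambda^{-2}A_2'+\lambda^{-1}A_{-1}+A_0+\lambda A_1+\lambda^2A_2'',$$ where $A=F^{-1}dF=\sum_aA_a$ with $A_a$ valued in $\mathfrak{u}(3)^{\mathbb C}_a$, and $A_2'$, $A_2''$ are the $dz$- and $d\bar z$-parts of $A_2$. For $n\in\mathbb N$ let $\Lambda^{n}\mathfrak{u}(3)$ be the space of loops $\xi_\lambda=\sum_{|k|\le n}\hat\xi_k\lambda^k$ with values in $\mathfrak{u}(3)$ for $\lambda\in S^1$, and $\Lambda^{n}\mathfrak{u}(3)_\tau$ the subspace of those with $\tau(\xi_\lambda)=\xi_{i\lambda}$. Let $\mathfrak b\subset\mathfrak{u}(3)_0^{\mathbb C}\cong\mathfrak{sl}(2,\mathbb C)$ be the lower triangular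 trace-free matrices with real diagonal, and $(\cdot)_{\mathfrak{su}}$ the projection of $\mathfrak{sl}(2,\mathbb C)=\mathfrak{su}(2)\oplus\mathfrak b$ onto $\mathfrak{su}(2)\cong\mathfrak u(3)_0$. For Laurent polynomial loops put $$(\xi_\lambda)_{\Lambda\mathfrak{su}}=\sum_{k<0}\hat\xi_k\lambda^k+(\hat\xi_0)_{\mathfrak{su}}-\sum_{k<0}\hat\xi_{k}^\dagger\lambda^{-k},\qquad (\xi_\lambda)_\Omega=\sum_{k<0}\big(\hat\xi_k(\lambda^k-1)-\hat\xi_k^\dagger(\lambda^{-k}-1)\big),$$ applied to loop-valued one-forms on each real tangent vector. A family $F_\lambda$ is of *finite type* if there are $p\in\mathbb{N}$ and a smooth $\xi_\lambda:\Omega\to\Lambda^{2+4p}\mathfrak{u}(3)_\tau$ with $\hat\xi_{-4p-2}=\mathrm{diag}(ia,ia,0)$ for a constant $a\in\mathbb{C}$, with $$d\xi_\lambda=[\xi_\lambda,A_\lambda]\quad(1)\qquad\text{and}\qquad(\lambda^{4p}\xi_\lambda dz)_{\Lambda\mathfrak{su}}=A_\lambda\quad(2);$$ it is of *quasi-finite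 type* if the same holds with (2) replaced by $$(\lambda^{4p}\xi_\lambda dz)_{\Lambda\mathfrak{su}}=A_\lambda+B\quad(2')$$ for some one-form $B$ on $\Omega$ with coefficients in $\mathfrak{u}(3)_0^{\mathbb C}$. The based loop map $E_\lambda:=F_\lambda F^{-1}$ is of *finite type* if, with $\Gamma_\lambda:=E_\lambda^{-1}dE_\lambda$, there are $p\in\mathbb N$ and a smooth $\eta_\lambda:\Omega\to\Lambda^{2+4p}\mathfrak{u}(3)$ with $d\eta_\lambda+[\Gamma_\lambda,\eta_\lambda]=0$ and $\Gamma_\lambda=(\lambda^{4p}\eta_\lambda dz)_\Omega$. **Theorem.** Let $F_\lambda$ be a family of Hamiltonian stationary conformal Lagrangian immersions on $\Omega$. (i) Let $p\in\mathbb{N}$ and let $\xi_\lambda:\Omega\to\Lambda^{2+4p}\mathfrak{u}(3)_\tau$ be smooth and satisfy (1) and (2') for some $B$. Then there is $G\in C^\infty(\Omega,U(3)_0)$ with $G(z_0)=\mathrm{Id}$ such that the family $F_\lambda^G:=F_\lambda G$ is of finite type. More precisely, put $A_\lambda^G:=G^{-1}A_\lambda G+G^{-1}dG$, which is $(F^G_\lambda)^{-1}dF^G_\lambda$,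 and $\xi_\lambda^G:=G^{-1}\xi_\lambda G$. Then $\xi^G_\lambda$ is a smooth map into $\Lambda^{2+4p}\mathfrak u(3)_\tau$, its coefficient of $\lambda^{-4p-2}$ is $\mathrm{diag}(ia,ia,0)$ for a constant $a\in\mathbb C$, and $$d\xi_\lambda^G+[A_\lambda^G,\xi_\lambda^G]=G^{-1}\big(d\xi_\lambda+[A_\lambda,\xi_\lambda]\big)G=0,\qquad(\lambda^{4p}\xi_\lambda^Gdz)_{\Lambda\mathfrak{su}}=A_\lambda^G .$$ (ii) The following are equivalent: $F_\lambda$ is of quasi-finite type; $F_\lambda G$ is of finite type for some $G\in C^\infty(\Omega,U(3)_0)$; $E_\lambda=F_\lambda F^{-1}$ is of finite type. -/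

import Mathlib

open scoped Matrix Matrix.Norms.Operator LaurentPolynomial ContDiff

noncomputable section

namespace HamStat

/-- `u(3)^ℂ = gl(3, ℂ)`; `u(3)` consists of the matrices with `Mᴴ = -M`.
(Smoothness and derivatives do not depend on the norm chosen on this finite-dimensional space.) -/
abbrev M3 : Type := Matrix (Fin 3) (Fin 3) ℂ

/-! ### The automorphism of order four -/

/-- The block matrix `diag(J, 1)`, `J = (0, -1; 1, 0)`. -/
def Jp : M3 := !![0, -1, 0; 1, 0, 0; 0, 0, 1]

/-- The block matrix `diag(-J, 1)`. -/
def Jm : M3 := !![0, 1, 0; -1, 0, 0; 0, 0, 1]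

/-- `τ` on the Lie algebra `u(3)^ℂ`. -/
def tau (M : M3) : M3 := -(Jm * Mᵀ * Jp)

theorem tau_eq (M : M3) : tau M =
    !![-M 1 1, M 0 1, -M 2 1; M 1 0, -M 0 0, M 2 0; -M 1 2, M 0 2, -M 2 2] := by
  ext i j
  simp only [tau, Matrix.neg_apply, Matrix.mul_apply, Fin.sum_univ_three, Matrix.transpose_apply]
  fin_cases i <;> fin_cases j <;> simp [Jm, Jp]

/-- `τ` on the group `U(3)^ℂ = GL(3, ℂ)`. -/
def tauGrp (g : M3) : M3 := Jm * (gᵀ)⁻¹ * Jp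

/-- The eigenspace `u(3)^ℂ_a` of `τ`, for the eigenvalue `i ^ a`. -/
def uC (a : ℤ) : Set M3 := {M | tau M = Complex.I ^ a • M}

/-- The component of `M` in `u(3)^ℂ_a`, i.e. the projection `(1/4) ∑ j, i ^ (-a j) τ ^ j` onto the
eigenspace. -/
def tauComp (a : ℤ) (M : M3) : M3 :=
  (1 / 4 : ℂ) • ∑ j ∈ Finset.range 4, Complex.I ^ (-a * (j : ℤ)) • tau^[j] M

/-- `U(3)_0 ≅ SU(2)`, the matrices `diag(g, 1)` with `g ∈ SU(2)`. The elements of `U(3)` fixed by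
`τ` are the `diag(g, ±1)` with `g ∈ SU(2)`; the last condition selects the copy of `SU(2)`. -/
def U30 : Set M3 := {g | g ∈ Matrix.unitaryGroup (Fin 3) ℂ ∧ tauGrp g = g ∧ g 2 2 = 1}

/-- The complex number `i` as an element of the unit circle. -/
def circleI : Circle := ⟨Complex.I, by simp [Submonoid.unitSphere]⟩

/-! ### Laurent polynomial loops -/

/-- Loops `λ ↦ ∑ ξ̂_k λ ^ k` in `u(3)^ℂ` with finitely many Fourier coefficients. -/
abbrev Loop : Type := LaurentPolynomial M3

/-- The value of a loop at `l ∈ S¹`. -/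
def Loop.evalAt (ξ : Loop) (l : Circle) : M3 := ξ.coeff.sum fun k m => (l : ℂ) ^ k • m

/-- `Λ^n u(3)`: loops in `u(3)` with Fourier modes in `[-n, n]`. -/
def LoopU (n : ℕ) : Set Loop :=
  {ξ | (∀ k : ℤ, (n : ℤ) < |k| → ξ.coeff k = 0) ∧ ∀ l, (ξ.evalAt l)ᴴ = -ξ.evalAt l}

/-- `Λ^n u(3)_τ`: the twisted loops in `Λ^n u(3)`. -/
def LoopUTau (n : ℕ) : Set Loop :=
  {ξ | ξ ∈ LoopU n ∧ ∀ l, tau (ξ.evalAt l) = ξ.evalAt (circleI * l)}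

/-- The Lie algebra `𝔟` of lower triangular `2 × 2` matrices with real diagonal and zero trace,
inside `u(3)^ℂ_0 ≅ sl(2, ℂ)`. -/
def borel : Set M3 := {M | ∃ (t : ℝ) (c : ℂ), M = !![(t : ℂ), 0, 0; c, -(t : ℂ), 0; 0, 0, 0]}

/-- The projection `u(3)^ℂ_0 → u(3)_0` along `𝔟`, for the splitting
`sl(2, ℂ) = su(2) ⊕ 𝔟`. -/
def suPart (M : M3) : M3 :=
  !![((M 0 0).im : ℂ) * Complex.I, M 0 1, 0;
    -star (M 0 1), -(((M 0 0).im : ℂ) * Complex.I), 0;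
    0, 0, 0]

theorem suPart_mem {M : M3} (h : M ∈ uC 0) :
    suPart M ∈ uC 0 ∧ (suPart M)ᴴ = -suPart M ∧ M - suPart M ∈ borel := by
  have h' : tau M = M := by simpa [uC] using h
  have e : ∀ i j, tau M i j = M i j := fun i j => by rw [h']
  simp [tau_eq, Fin.forall_fin_succ] at e
  refine ⟨?_, ?_, (M 0 0).re, M 1 0 + star (M 0 1), ?_⟩
  · suffices tau (suPart M) = suPart M by simpa [uC] using this
    ext i j
    fin_cases i <;> fin_cases j <;> simp [suPart, tau_eq]
  · ext i j
    fin_cases i <;> fin_cases j <;> simp [suPart]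
  · have r : (M 0 0) = (M 0 0).re + (M 0 0).im * Complex.I := (Complex.re_add_im _).symm
    ext i j
    fin_cases i <;> fin_cases j <;> simp [suPart] <;> grind

/-- The projection `(·)_{Λsu}` onto `Λ u(3)_τ` along the loops `∑_{k ≥ 0} ξ̂_k λ ^ k` with
`ξ̂_0 ∈ 𝔟`:
`ξ ↦ ∑_{k < 0} ξ̂_k λ ^ k + (ξ̂_0)_su - ∑_{k < 0} (ξ̂_k)† λ ^ (-k)`. -/
def Loop.projSu (ξ : Loop) : Loop :=
  LaurentPolynomial.C (suPart (ξ.coeff 0)) +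
    ∑ k ∈ ξ.coeff.support with k < 0,
      (AddMonoidAlgebra.single k (ξ.coeff k) - AddMonoidAlgebra.single (-k) (ξ.coeff k)ᴴ)

/-- The projection `(·)_Ω` onto the based loop algebra along `Λ⁺ u(3)^ℂ`:
`ξ ↦ ∑_{k < 0} (ξ̂_k (λ ^ k - 1) - (ξ̂_k)† (λ ^ (-k) - 1))`. -/
def Loop.projBased (ξ : Loop) : Loop :=
  ∑ k ∈ ξ.coeff.support with k < 0,
    ((AddMonoidAlgebra.single k (ξ.coeff k) - LaurentPolynomial.C (ξ.coeff k)) -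
      (AddMonoidAlgebra.single (-k) (ξ.coeff k)ᴴ - LaurentPolynomial.C (ξ.coeff k)ᴴ))

/-- A map from `Ω` to loops is smooth if all its Fourier coefficients are. -/
def SmoothLoop (Ω : Set ℂ) (ξ : ℂ → Loop) : Prop :=
  ∀ k : ℤ, ContDiffOn ℝ ∞ (fun z => (ξ z).coeff k) Ω

/-! ### Maurer--Cartan forms and their deformation.
One-forms are written as `θ z v`, with `z` the point and `v ∈ ℂ` the tangent vector;
`dz` is `v ↦ v`. -/

/-- The Maurer--Cartan form `f⁻¹ · df`. -/
def mc (f : ℂ → M3) (z v : ℂ) : M3 := (f z)⁻¹ * fderiv ℝ f z v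

/-- The `(1,0)`-part `θ(∂/∂z) dz` of a real-linear form. -/
def part10 (θ : ℂ → M3) (v : ℂ) : M3 := v • (1 / 2 : ℂ) • (θ 1 - Complex.I • θ Complex.I)

/-- The `(0,1)`-part `θ(∂/∂z̄) dz̄` of a real-linear form. -/
def part01 (θ : ℂ → M3) (v : ℂ) : M3 :=
  star v • (1 / 2 : ℂ) • (θ 1 + Complex.I • θ Complex.I)

/-- The deformation
`A_λ = λ⁻² A_2' + λ⁻¹ A_{-1} + A_0 + λ A_1 + λ² A_2''` of a `u(3)`-valued form `A`. -/
def deform (A : ℂ → M3) (l : Circle) (v : ℂ) : M3 :=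
  (l : ℂ) ^ (-2 : ℤ) • part10 (fun w => tauComp 2 (A w)) v
    + (l : ℂ) ^ (-1 : ℤ) • tauComp (-1) (A v)
    + tauComp 0 (A v)
    + (l : ℂ) • tauComp 1 (A v)
    + (l : ℂ) ^ 2 • part01 (fun w => tauComp 2 (A w)) v

/-! ### Hamiltonian stationary conformal Lagrangian immersions into `ℂP²`.
A Lagrangian immersion `u : Ω → ℂP²` is given through a horizontal (parallel) lift
`û : Ω → S⁵ ⊂ ℂ³`. As the Hopf map is isometric on horizontal vectors, `û` computes the
metric and the Kähler form along `u`. -/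

/-- The Hermitian product of `ℂ³`. -/
def herm (a b : Fin 3 → ℂ) : ℂ := star a ⬝ᵥ b

/-- The partial derivative `∂/∂x`. -/
def dX {E : Type*} [NormedAddCommGroup E] [NormedSpace ℝ E] (f : ℂ → E) (z : ℂ) : E :=
  fderiv ℝ f z 1

/-- The partial derivative `∂/∂y`. -/
def dY {E : Type*} [NormedAddCommGroup E] [NormedSpace ℝ E] (f : ℂ → E) (z : ℂ) : E :=
  fderiv ℝ f z Complex.I

/-- `û : Ω → S⁵` is a horizontal lift of a conformal Lagrangian immersion `u : Ω → ℂP²`. -/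
structure IsConformalLagrangianLift (Ω : Set ℂ) (u : ℂ → Fin 3 → ℂ) : Prop where
  smooth : ContDiffOn ℝ ∞ u Ω
  sphere : ∀ z ∈ Ω, herm (u z) (u z) = 1
  horizontal : ∀ z ∈ Ω, herm (u z) (dX u z) = 0 ∧ herm (u z) (dY u z) = 0
  immersion : ∀ z ∈ Ω, herm (dX u z) (dX u z) ≠ 0
  conformal : ∀ z ∈ Ω, herm (dX u z) (dX u z) = herm (dY u z) (dY u z) ∧
    (herm (dX u z) (dY u z)).re = 0
  lagrangian : ∀ z ∈ Ω, (herm (dX u z) (dY u z)).im = 0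

/-- The horizontal lift of the Hamiltonian vector field `J ∇f` along a conformal Lagrangian
immersion; the gradient is taken in the induced metric `|∂u/∂x|² (dx² + dy²)`. -/
def hamField (u : ℂ → Fin 3 → ℂ) (f : ℂ → ℝ) (z : ℂ) : Fin 3 → ℂ :=
  (Complex.I * (herm (dX u z) (dX u z))⁻¹) •
    (((dX f z : ℝ) : ℂ) • dX u z + ((dY f z : ℝ) : ℂ) • dY u z)

/-- The first variation of the area in the direction of every Hamiltonian field `J ∇f`, with `f`
smooth and compactly supported in `Ω`, vanishes. In conformal coordinates the first variation
along `V` is `∫ (⟨∂V/∂x, ∂u/∂x⟩ + ⟨∂V/∂y, ∂u/∂y⟩) dx dy`. -/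
def IsHamiltonianStationary (Ω : Set ℂ) (u : ℂ → Fin 3 → ℂ) : Prop :=
  ∀ f : ℂ → ℝ, ContDiff ℝ ∞ f → HasCompactSupport f → tsupport f ⊆ Ω →
    ∫ z in Ω, ((herm (dX (hamField u f) z) (dX u z)).re
      + (herm (dY (hamField u f) z) (dY u z)).re) = 0

/-- The value `e^{iβ} = det(e₁, e₂, û)` of the Lagrangian angle function, where `e₁, e₂` are the
normalized partial derivatives of the conformal immersion. -/
def expAngle (u : ℂ → Fin 3 → ℂ) (z : ℂ) : ℂ :=
  (herm (dX u z) (dX u z))⁻¹ *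
    Matrix.det (Matrix.of fun i j => ![dX u z i, dY u z i, u z i] j : M3)

/-- `F` is a Legendrian framing of `u` along `û`: its last column is `û`, and
`det F = e^{iβ}`. -/
structure IsLegendrianFraming (Ω : Set ℂ) (F : ℂ → M3) (u : ℂ → Fin 3 → ℂ) : Prop where
  smooth : ContDiffOn ℝ ∞ F Ω
  unitary : ∀ z ∈ Ω, F z ∈ Matrix.unitaryGroup (Fin 3) ℂ
  column : ∀ z ∈ Ω, ∀ i, F z i 2 = u z i
  det : ∀ z ∈ Ω, (F z).det = expAngle u z

/-- `F_λ : Ω → Λ U(3)_τ` is a family of Hamiltonian stationary conformal Lagrangian immersions: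
`F_{λ=1}` is a Legendrian framing of such an immersion, and the Maurer--Cartan form of `F_λ` is the
deformation of that of `F_{λ=1}`. -/
structure IsFamily (Ω : Set ℂ) (F : Circle → ℂ → M3) : Prop where
  smooth : ∀ l, ContDiffOn ℝ ∞ (F l) Ω
  unitary : ∀ l, ∀ z ∈ Ω, F l z ∈ Matrix.unitaryGroup (Fin 3) ℂ
  twisted : ∀ l, ∀ z ∈ Ω, tauGrp (F l z) = F (circleI * l) z
  framing : ∃ u, IsConformalLagrangianLift Ω u ∧ IsHamiltonianStationary Ω u ∧
    IsLegendrianFraming Ω (F 1) u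
  deformation : ∀ l, ∀ z ∈ Ω, ∀ v, mc (F l) z v = deform (mc (F 1) z) l v

/-! ### Finite type and quasi-finite type -/

/-- The Lax equation `dξ_λ = [ξ_λ, A_λ]`. -/
def Lax (Ω : Set ℂ) (ξ : ℂ → Loop) (A : Circle → ℂ → ℂ → M3) : Prop :=
  ∀ l, ∀ z ∈ Ω, ∀ v, fderiv ℝ (fun w => (ξ w).evalAt l) z v = ⁅(ξ z).evalAt l, A l z v⁆

/-- The loop `λ^{4p} ξ_λ dz`, evaluated on the tangent vector `v`. -/
def shifted (p : ℕ) (ξ : Loop) (v : ℂ) : Loop :=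
  v • (LaurentPolynomial.T (4 * (p : ℤ)) * ξ)

/-- `ξ : Ω → Λ^{2+4p} u(3)_τ` is smooth, satisfies the Lax equation for `A_λ = F_λ⁻¹ dF_λ` and
`(λ^{4p} ξ_λ dz)_{Λsu} = A_λ + B` for a one-form `B` with coefficients in `u(3)^ℂ_0`. -/
structure IsQuasiAdapted (Ω : Set ℂ) (F : Circle → ℂ → M3) (p : ℕ) (ξ : ℂ → Loop) : Prop where
  mem : ∀ z ∈ Ω, ξ z ∈ LoopUTau (2 + 4 * p)
  smooth : SmoothLoop Ω ξ
  lax : Lax Ω ξ fun l => mc (F l)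
  adapted : ∃ B : ℂ → ℂ →L[ℝ] M3, (∀ z ∈ Ω, ∀ v, B z v ∈ uC 0) ∧
    ∀ l, ∀ z ∈ Ω, ∀ v, (shifted p (ξ z) v).projSu.evalAt l = mc (F l) z v + B z v

/-- `ξ : Ω → Λ^{2+4p} u(3)_τ` is smooth, satisfies the Lax equation for `A_λ = F_λ⁻¹ dF_λ` and
`(λ^{4p} ξ_λ dz)_{Λsu} = A_λ`. -/
structure IsAdapted (Ω : Set ℂ) (F : Circle → ℂ → M3) (p : ℕ) (ξ : ℂ → Loop) : Prop where
  mem : ∀ z ∈ Ω, ξ z ∈ LoopUTau (2 + 4 * p)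
  smooth : SmoothLoop Ω ξ
  lax : Lax Ω ξ fun l => mc (F l)
  adapted : ∀ l, ∀ z ∈ Ω, ∀ v, (shifted p (ξ z) v).projSu.evalAt l = mc (F l) z v

/-- The lowest coefficient `ξ̂_{-4p-2}` is constant, of the form `diag(ia, ia, 0)`. -/
def HasConstLeading (Ω : Set ℂ) (p : ℕ) (ξ : ℂ → Loop) : Prop :=
  ∃ a : ℂ, ∀ z ∈ Ω, (ξ z).coeff (-4 * (p : ℤ) - 2) =
    Matrix.diagonal ![Complex.I * a, Complex.I * a, 0]

/-- Families of finite type. -/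
def IsFiniteType (Ω : Set ℂ) (F : Circle → ℂ → M3) : Prop :=
  IsFamily Ω F ∧ ∃ p ξ, HasConstLeading Ω p ξ ∧ IsAdapted Ω F p ξ

/-- Families of quasi-finite type. -/
def IsQuasiFiniteType (Ω : Set ℂ) (F : Circle → ℂ → M3) : Prop :=
  IsFamily Ω F ∧ ∃ p ξ, HasConstLeading Ω p ξ ∧ IsQuasiAdapted Ω F p ξ

/-- The based loop map `E_λ = F_λ · F_{λ=1}⁻¹`. -/
def based (F : Circle → ℂ → M3) (l : Circle) (z : ℂ) : M3 := F l z * (F 1 z)⁻¹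

/-- Finite type in terms of based loops: `Γ_λ = E_λ⁻¹ dE_λ` satisfies
`dη_λ + [Γ_λ, η_λ] = 0` and `Γ_λ = (λ^{4p} η_λ dz)_Ω` for some `p` and some smooth
`η : Ω → Λ^{2+4p} u(3)`. -/
def IsBasedFiniteType (Ω : Set ℂ) (E : Circle → ℂ → M3) : Prop :=
  ∃ (p : ℕ) (η : ℂ → Loop), (∀ z ∈ Ω, η z ∈ LoopU (2 + 4 * p)) ∧ SmoothLoop Ω η ∧
    (Lax Ω η fun l => mc (E l)) ∧
    ∀ l, ∀ z ∈ Ω, ∀ v, mc (E l) z v = (shifted p (η z) v).projBased.evalAt l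

/-! ### Gauge transformations -/

/-- `G ∈ C^∞(Ω, U(3)_0)`. -/
def IsGauge (Ω : Set ℂ) (G : ℂ → M3) : Prop :=
  ContDiffOn ℝ ∞ G Ω ∧ ∀ z ∈ Ω, G z ∈ U30

/-- `F_λ^G = F_λ · G`. -/
def gaugeF (F : Circle → ℂ → M3) (G : ℂ → M3) (l : Circle) (z : ℂ) : M3 := F l z * G z

/-- `A^G = G⁻¹ · A · G + G⁻¹ · dG`. -/
def gaugeA (A : Circle → ℂ → ℂ → M3) (G : ℂ → M3) (l : Circle) (z v : ℂ) : M3 :=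
  (G z)⁻¹ * A l z v * G z + (G z)⁻¹ * fderiv ℝ G z v

/-- `ξ^G = G⁻¹ · ξ · G`. -/
def gaugeLoop (ξ : ℂ → Loop) (G : ℂ → M3) (z : ℂ) : Loop :=
  LaurentPolynomial.C (G z)⁻¹ * ξ z * LaurentPolynomial.C (G z)

end HamStat

end

open HamStat

/-! Compare Fourier modes in (2'). The form `B` sits in degree 0, so the modes `λ⁻²` and `λ⁻¹` say
exactly that `A_2' = ξ̂_{-4p-2} dz` and `A_{-1} = ξ̂_{-4p-1} dz` (`MatchesLeading`). Conversely
these two equations give (2'), with `B` the mismatch in degree 0. They are covariant under gauge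
transformations in `U(3)_0`, because `G⁻¹dG` lies in degree 0. So quasi-finite type is gauge
invariant, and finite type is the choice of a gauge in which `(ξ̂_{-4p} dz)_su = A_0`.

To find this gauge, consider `θ = A_0 - ξ̂_{-4p} dz`, with values in `sl(2, ℂ)`. The degree 0 part
of `dA + A ∧ A = 0` and the `λ^{-4p}` coefficient of the Lax equation, wedged with `dz`, contain the
same term `[ξ̂_{-4p-1}, ξ̂_{-4p-1}†]`; it cancels and `θ` is flat (`zeroForm_flat`). On a simply
connected domain there is a frame `K` with `dK = -θK` and `K(z₀) = 1` (`exists_flat_frame_complex`).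
Normalizing its second column is the Gram-Schmidt (Iwasawa) factorization `K = GL` with `G` in
`SU(2)` and `L` lower triangular, and then `G⁻¹θG + G⁻¹dG = -dL L⁻¹` takes values in `𝔟`
(`exists_gauge_borel`). Since `A_0^G` is `su(2)`-valued, projecting along `𝔟` gives (2)
(`exists_gauge_isAdapted`).

The leading coefficient is constant because every bracket in its Lax equation vanishes, and its `(2,
2)` entry is zero because the lift is horizontal (`hasConstLeading`).

For based loops, `E_λ⁻¹dE_λ = F(A_λ - A)F⁻¹` loses the degree 0 part and retains the same two
leading modes, so `η = FξF⁻¹` works. In the other direction `F⁻¹ηF` need not be twisted; projecting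
each coefficient onto its eigenspace of `τ` makes it so, and respects the Lax equation since `A_λ`
is twisted (`isQuasiFiniteType_of_based`). -/

section

open Filter Topology Set Metric

/-! ### Local solutions of `dK = α K` for a flat `α`, by integration along rays. -/

section FlatFrame

variable {E 𝔸 : Type*} [NormedAddCommGroup E] [NormedSpace ℝ E]
  [NormedRing 𝔸] [NormedAlgebra ℝ 𝔸]

/-- Second order Taylor bound for a map whose derivative is Lipschitz on a convex set. -/
theorem Convex.norm_sub_sub_fderiv_le {F : Type*} [NormedAddCommGroup F] [NormedSpace ℝ F]
    {f : E → F} {f' : E → E →L[ℝ] F} {s : Set E} (hs : Convex ℝ s) {C : ℝ} (hC : 0 ≤ C)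
    (hf : ∀ x ∈ s, HasFDerivAt f (f' x) x)
    (hf' : ∀ x ∈ s, ∀ y ∈ s, ‖f' x - f' y‖ ≤ C * ‖x - y‖) {x y : E} (hx : x ∈ s) (hy : y ∈ s) :
    ‖f y - f x - f' x (y - x)‖ ≤ C * ‖y - x‖ ^ 2 := by
  have hseg : segment ℝ x y ⊆ s := hs.segment_subset hx hy
  have := (convex_segment x y).norm_image_sub_le_of_norm_hasFDerivWithin_le' (f := f) (f' := f')
    (φ := f' x) (C := C * ‖y - x‖) (fun z hz => (hf z (hseg hz)).hasFDerivWithinAt)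
    (fun z hz => (hf' z (hseg hz) x hx).trans ?_) (left_mem_segment ℝ x y)
    (right_mem_segment ℝ x y)
  · rw [sq, ← mul_assoc]; exact this
  · gcongr
    rw [segment_eq_image'] at hz
    obtain ⟨t, ht, rfl⟩ := hz
    simp only [add_sub_cancel_left, norm_smul, Real.norm_eq_abs, abs_of_nonneg ht.1]
    exact mul_le_of_le_one_left (norm_nonneg _) ht.2

/-- Solutions of `k' = α(c + t w)(w) k` along two neighbouring rays differ to first order by
`α(c + w)(h) k`, if `dK = α K` satisfies the integrability condition. -/
theorem norm_ray_solution_sub_le {α : E → E →L[ℝ] 𝔸} {dα : E → E →L[ℝ] E →L[ℝ] 𝔸} {c : E}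
    {r M N : ℝ} (hM : 0 < M)
    (hd : ∀ z ∈ ball c r, HasFDerivAt α (dα z) z)
    (hb : ∀ z ∈ ball c r, ‖α z‖ ≤ M) (hdb : ∀ z ∈ ball c r, ‖dα z‖ ≤ M)
    (hdl : ∀ x ∈ ball c r, ∀ y ∈ ball c r, ‖dα x - dα y‖ ≤ M * ‖x - y‖)
    (hflat : ∀ z ∈ ball c r, ∀ u v, dα z u v + α z v * α z u = dα z v u + α z u * α z v)
    {w h : E} (hr : r ≤ 1) (hw : w ∈ ball 0 r) (hwh : w + h ∈ ball 0 r) {k k' : ℝ → 𝔸}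
    (hk0 : k 0 = 1) (hk0' : k' 0 = 1)
    (hk : ∀ t ∈ Icc (0 : ℝ) 1, HasDerivWithinAt k (α (c + t • w) w * k t) (Icc 0 1) t)
    (hk' : ∀ t ∈ Icc (0 : ℝ) 1,
      HasDerivWithinAt k' (α (c + t • (w + h)) (w + h) * k' t) (Icc 0 1) t)
    (hkN : ∀ t ∈ Icc (0 : ℝ) 1, ‖k t‖ ≤ N) (hkN' : ∀ t ∈ Icc (0 : ℝ) 1, ‖k' t‖ ≤ N) :
    ‖k' 1 - k 1 - α (c + w) h * k 1‖ ≤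
      gronwallBound 0 (5 * M) ((2 * M * N + 2 * M * M * N) * ‖h‖ ^ 2) 1 := by
  have hwn : ‖w‖ ≤ 1 := (mem_ball_zero_iff.1 hw).le.trans hr
  have hhn : ‖h‖ ≤ 2 := by
    have h2 : ‖w + h‖ ≤ 1 := (mem_ball_zero_iff.1 hwh).le.trans hr
    calc ‖h‖ = ‖(w + h) - w‖ := by rw [add_sub_cancel_left]
      _ ≤ ‖w + h‖ + ‖w‖ := norm_sub_le _ _
      _ ≤ 2 := by linarith
  have hmem : ∀ x ∈ ball (0 : E) r, ∀ t ∈ Icc (0 : ℝ) 1, c + t • x ∈ ball c r := by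
    intro x hx t ht
    rw [mem_ball_iff_norm, add_sub_cancel_left, norm_smul, Real.norm_eq_abs, abs_of_nonneg ht.1]
    exact (mul_le_of_le_one_left (norm_nonneg _) ht.2).trans_lt (mem_ball_zero_iff.1 hx)
  -- `P` is the error of the expected first variation `t α(c + t w)(h) k(t)`. It vanishes at `t =
  -- 0`, and at `t = 1` it is the quantity to be bounded.
  set P : ℝ → 𝔸 := fun t => k' t - k t - t • (α (c + t • w) h * k t) with hP
  set P' : ℝ → 𝔸 := fun t => α (c + t • (w + h)) (w + h) * k' t - α (c + t • w) w * k t -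
    ((α (c + t • w) h * k t) + t • (dα (c + t • w) w h * k t
      + α (c + t • w) h * (α (c + t • w) w * k t))) with hP'
  have hderiv : ∀ t ∈ Icc (0 : ℝ) 1, HasDerivWithinAt P (P' t) (Icc 0 1) t := by
    intro t ht
    have hray : HasDerivAt (fun t : ℝ => c + t • w) w t := by
      simpa using ((hasDerivAt_id t).smul_const w).const_add c
    have hα : HasDerivAt (fun t : ℝ => α (c + t • w) h) (dα (c + t • w) w h) t :=
      (ContinuousLinearMap.apply ℝ 𝔸 h).hasFDerivAt.comp_hasDerivAt t
        ((hd _ (hmem w hw t ht)).comp_hasDerivAt t hray)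
    have h1 := ((hasDerivAt_id t).hasDerivWithinAt (s := Icc 0 1)).smul
      (hα.hasDerivWithinAt.mul (hk t ht))
    have h2 := ((hk' t ht).sub (hk t ht)).sub h1
    refine h2.congr_deriv ?_
    simp only [hP', id, Pi.mul_apply, one_smul]
    abel
  have hbound : ∀ t ∈ Ico (0 : ℝ) 1, ‖P' t‖ ≤
      5 * M * ‖P t‖ + (2 * M * N + 2 * M * M * N) * ‖h‖ ^ 2 := by
    intro t ht
    have ht' : t ∈ Icc (0 : ℝ) 1 := Ico_subset_Icc_self ht
    have hz := hmem w hw t ht'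
    have hz' := hmem _ hwh t ht'
    have htn : ‖t‖ ≤ 1 := by rw [Real.norm_eq_abs, abs_of_nonneg ht'.1]; exact ht'.2
    have hsub : c + t • (w + h) - (c + t • w) = t • h := by
      rw [smul_add]; abel
    have hsubn : ‖t • h‖ ≤ ‖h‖ := by
      rw [norm_smul]; exact mul_le_of_le_one_left (norm_nonneg _) htn
    generalize hzdef : c + t • w = z at *
    generalize hzdef' : c + t • (w + h) = z' at *
    have hT : ‖α z' - α z - dα z (t • h)‖ ≤ M * ‖h‖ ^ 2 := by
      have := (convex_ball c r).norm_sub_sub_fderiv_le hM.le hd hdl hz hz'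
      rw [hsub] at this
      refine this.trans ?_
      gcongr
    have hL : ‖α z' - α z‖ ≤ M * ‖h‖ := by
      have := (convex_ball c r).norm_image_sub_le_of_norm_hasFDerivWithin_le
        (fun x hx => (hd x hx).hasFDerivWithinAt) hdb hz hz'
      rw [hsub] at this
      refine this.trans ?_
      gcongr
    -- Flatness exchanges `dα(w)(h)` for `dα(h)(w)` plus a commutator. After that all terms of first
    -- order in `h` cancel, and what remains is either a multiple of `P` or quadratic in `h`.
    have hPeq : P' t = α z w * P t + ((α z' - α z - dα z (t • h)) w * k' t
        + t • (dα z h w * P t) + t • t • (dα z h w * (α z h * k t))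
        + (α z' - α z) h * k' t + α z h * P t + t • (α z h * (α z h * k t))) := by
      have hf := hflat z hz w h
      have hf' : dα z w h = dα z h w + α z w * α z h - α z h * α z w := by
        rw [← hf]; abel
      simp only [hP, hP', hzdef, hzdef']
      simp only [hf', map_add, map_smul, sub_apply, smul_apply, mul_sub, sub_mul, add_mul, smul_add,
        smul_sub,
        mul_smul_comm, smul_mul_assoc, mul_assoc]
      abel
    have hαw : ‖α z w‖ ≤ M := by
      refine ((α z).le_opNorm w).trans ?_
      calc ‖α z‖ * ‖w‖ ≤ M * 1 := by gcongr; exact hb z hz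
        _ = M := mul_one M
    have hαh : ‖α z h‖ ≤ M * ‖h‖ := ((α z).le_opNorm h).trans (by gcongr; exact hb z hz)
    have hαh2 : ‖α z h‖ ≤ 2 * M := by nlinarith
    have hdh : ‖dα z h w‖ ≤ M * ‖h‖ := by
      refine ((dα z).le_opNorm₂ h w).trans ?_
      calc ‖dα z‖ * ‖h‖ * ‖w‖ ≤ M * ‖h‖ * 1 := by gcongr; exact hdb z hz
        _ = M * ‖h‖ := mul_one _
    have hdh2 : ‖dα z h w‖ ≤ 2 * M := by nlinarith
    have hk1 := hkN t ht'
    have hk2 := hkN' t ht'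
    have e1 : ‖α z w * P t‖ ≤ M * ‖P t‖ := (norm_mul_le _ _).trans (by gcongr)
    have e2 : ‖(α z' - α z - dα z (t • h)) w * k' t‖ ≤ (M * ‖h‖ ^ 2) * N := by
      refine (norm_mul_le _ _).trans ?_
      gcongr
      refine (ContinuousLinearMap.le_opNorm _ _).trans ?_
      calc _ ≤ (M * ‖h‖ ^ 2) * 1 := by gcongr
        _ = _ := mul_one _
    have hts : ∀ x : 𝔸, ‖t • x‖ ≤ ‖x‖ := fun x => by
      rw [norm_smul]; exact mul_le_of_le_one_left (norm_nonneg _) htn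
    have e3 : ‖t • (dα z h w * P t)‖ ≤ 2 * M * ‖P t‖ :=
      (hts _).trans ((norm_mul_le _ _).trans (by gcongr))
    have e6 : ‖α z h * P t‖ ≤ 2 * M * ‖P t‖ := (norm_mul_le _ _).trans (by gcongr)
    have hαk : ‖α z h * k t‖ ≤ M * ‖h‖ * N := (norm_mul_le _ _).trans (by gcongr)
    have e4 : ‖t • t • (dα z h w * (α z h * k t))‖ ≤ (M * ‖h‖) * (M * ‖h‖ * N) :=
      (hts _).trans ((hts _).trans ((norm_mul_le _ _).trans (by gcongr)))
    have e5 : ‖(α z' - α z) h * k' t‖ ≤ (M * ‖h‖ * ‖h‖) * N := by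
      refine (norm_mul_le _ _).trans ?_
      gcongr
      exact (ContinuousLinearMap.le_opNorm _ _).trans (by gcongr)
    have e7 : ‖t • (α z h * (α z h * k t))‖ ≤ (M * ‖h‖) * (M * ‖h‖ * N) :=
      (hts _).trans ((norm_mul_le _ _).trans (by gcongr))
    -- `e1`, `e3`, `e6` add up to the factor `5 * M` of `‖P t‖`; `e2`, `e5` and `e4`, `e7` give the
    -- two quadratic terms.
    rw [hPeq]
    refine (norm_add_le_of_le e1 (norm_add_le_of_le (norm_add_le_of_le (norm_add_le_of_le
      (norm_add_le_of_le (norm_add_le_of_le e2 e3) e4) e5) e6) e7)).trans (le_of_eq ?_)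
    ring
  have hcont : ContinuousOn P (Icc 0 1) := fun t ht => (hderiv t ht).continuousWithinAt
  have := norm_le_gronwallBound_of_norm_deriv_right_le hcont
    (fun t ht => (hderiv t (Ico_subset_Icc_self ht)).mono_of_mem_nhdsWithin
      (Icc_mem_nhdsGE_of_mem ht)) (δ := 0) (by simp [hP, hk0, hk0']) hbound 1 (by simp)
  simpa [hP] using this

/-- Linear differential equations `k' = a k` with small coefficient can be solved on `[0, 1]`. -/
theorem exists_hasDerivWithinAt_mul_Icc [CompleteSpace 𝔸] {a : ℝ → 𝔸} {C : ℝ}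
    (ha : ContinuousOn a (Icc 0 1)) (haC : ∀ t ∈ Icc (0 : ℝ) 1, ‖a t‖ ≤ C)
    (hC : C * (‖(1 : 𝔸)‖ + 1) ≤ 1) :
    ∃ k : ℝ → 𝔸, k 0 = 1 ∧
      (∀ t ∈ Icc (0 : ℝ) 1, HasDerivWithinAt k (a t * k t) (Icc 0 1) t) ∧
      ∀ t ∈ Icc (0 : ℝ) 1, ‖k t‖ ≤ ‖(1 : 𝔸)‖ * Real.exp C := by
  have hC0 : 0 ≤ C := (norm_nonneg _).trans (haC 0 (by simp))
  -- On the closed unit ball around `1` the right-hand side has norm at most `C (‖1‖ + 1) ≤ 1`, so a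
  -- solution cannot leave the ball before time 1.
  have hpl : IsPicardLindelof (fun t x => a t * x) (tmin := 0) (tmax := 1) ⟨0, by simp⟩ (1 : 𝔸)
      1 0 1 C.toNNReal := by
    refine ⟨fun t ht => ?_, fun x _ => ha.mul continuousOn_const, fun t ht x hx => ?_, by simp⟩
    · refine LipschitzOnWith.of_dist_le_mul fun x _ y _ => ?_
      rw [dist_eq_norm, dist_eq_norm, ← mul_sub, Real.coe_toNNReal _ hC0]
      exact (norm_mul_le _ _).trans (by gcongr; exact haC t ht)
    · have hx' : ‖x‖ ≤ ‖(1 : 𝔸)‖ + 1 := by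
        rw [mem_closedBall, dist_eq_norm] at hx
        calc ‖x‖ = ‖1 + (x - 1)‖ := by rw [add_sub_cancel]
          _ ≤ _ := norm_add_le_of_le le_rfl (by simpa using hx)
      refine (norm_mul_le _ _).trans (le_trans ?_ hC)
      gcongr
      exact haC t ht
  obtain ⟨k, hk0, hk⟩ := hpl.exists_eq_forall_mem_Icc_hasDerivWithinAt₀
  refine ⟨k, hk0, hk, fun t ht => ?_⟩
  have := norm_le_gronwallBound_of_norm_deriv_right_le (δ := ‖(1 : 𝔸)‖) (K := C) (ε := 0)
    (fun t ht => (hk t ht).continuousWithinAt)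
    (fun t ht => (hk t (Ico_subset_Icc_self ht)).mono_of_mem_nhdsWithin (Icc_mem_nhdsGE_of_mem ht))
    (by rw [← hk0]) (fun s hs => ?_) t ht
  · rw [gronwallBound_ε0, sub_zero] at this
    refine this.trans ?_
    gcongr
    exact mul_le_of_le_one_right hC0 ht.2
  · rw [add_zero]
    exact (norm_mul_le _ _).trans (by gcongr; exact haC s (Ico_subset_Icc_self hs))

/-- Local solvability of `dK = α K` under the integrability condition. -/
theorem exists_local_flat_frame [CompleteSpace 𝔸] {α : E → E →L[ℝ] 𝔸} {U : Set E} (hU : IsOpen U)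
    (hα : ContDiffOn ℝ ∞ α U)
    (hflat : ∀ z ∈ U, ∀ u v,
      fderiv ℝ α z u v + α z v * α z u = fderiv ℝ α z v u + α z u * α z v)
    {c : E} (hc : c ∈ U) :
    ∃ V ∈ 𝓝 c, IsOpen V ∧ V ⊆ U ∧ ∃ K : E → 𝔸, ∀ z ∈ V, IsUnit (K z) ∧
      HasFDerivAt K ((ContinuousLinearMap.mul ℝ 𝔸).flip (K z) ∘L α z) z := by
  have hαc : ContDiffAt ℝ ∞ α c := hα.contDiffAt (hU.mem_nhds hc)
  have hdc : ContDiffAt ℝ 1 (fderiv ℝ α) c := hαc.fderiv_right (by norm_cast)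
  obtain ⟨L, s, hs, hL⟩ := hdc.exists_lipschitzOnWith
  obtain ⟨M, hM, hMs⟩ : ∃ M : ℝ, 0 < M ∧ ∀ᶠ z in 𝓝 c,
      ‖α z‖ ≤ M ∧ ‖fderiv ℝ α z‖ ≤ M ∧ (L : ℝ) ≤ M := by
    refine ⟨max (max (‖α c‖ + 1) (‖fderiv ℝ α c‖ + 1)) L,
      lt_max_of_lt_left (lt_max_of_lt_left (by positivity)), ?_⟩
    have hn : ContinuousAt (fun z => ‖fderiv ℝ α z‖) c :=
      ContinuousAt.norm (E := E →L[ℝ] E →L[ℝ] 𝔸) hdc.continuousAt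
    filter_upwards [hαc.continuousAt.norm.eventually (gt_mem_nhds (lt_add_one _)),
      hn.eventually (gt_mem_nhds (lt_add_one _))] with z h1 h2
    exact ⟨le_max_of_le_left (le_max_of_le_left h1.le),
      le_max_of_le_left (le_max_of_le_right h2.le), le_max_right _ _⟩
  obtain ⟨ρ, hρ, hρs⟩ := Metric.mem_nhds_iff.1 (inter_mem (inter_mem hs hMs) (hU.mem_nhds hc))
  -- The three bounds keep the ball where the estimates on `α` hold, keep the rays of length at most
  -- 1, and make the coefficient `M r` small enough for the Picard argument.
  set r : ℝ := min (min ρ 1) (1 / (M * (‖(1 : 𝔸)‖ + 1))) with hrdef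
  have hr : 0 < r := by positivity
  have hr1 : r ≤ 1 := (min_le_left _ _).trans (min_le_right _ _)
  have hrC : M * r * (‖(1 : 𝔸)‖ + 1) ≤ 1 := by
    have : r ≤ 1 / (M * (‖(1 : 𝔸)‖ + 1)) := min_le_right _ _
    rw [le_div_iff₀ (by positivity)] at this
    linarith
  have hball : ball c r ⊆ s ∩ {z | ‖α z‖ ≤ M ∧ ‖fderiv ℝ α z‖ ≤ M ∧ (L : ℝ) ≤ M} ∩ U :=
    (ball_subset_ball ((min_le_left _ _).trans (min_le_left _ _))).trans hρs
  have hd : ∀ z ∈ ball c r, HasFDerivAt α (fderiv ℝ α z) z := fun z hz =>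
    ((hα.contDiffAt (hU.mem_nhds (hball hz).2)).differentiableAt (by simp)).hasFDerivAt
  have hmem : ∀ x ∈ ball (0 : E) r, ∀ t ∈ Icc (0 : ℝ) 1, c + t • x ∈ ball c r := by
    intro x hx t ht
    rw [mem_ball_iff_norm, add_sub_cancel_left, norm_smul, Real.norm_eq_abs, abs_of_nonneg ht.1]
    exact (mul_le_of_le_one_left (norm_nonneg _) ht.2).trans_lt (mem_ball_zero_iff.1 hx)
  have hsol : ∀ w : ball (0 : E) r, ∃ k : ℝ → 𝔸, k 0 = 1 ∧
      (∀ t ∈ Icc (0 : ℝ) 1, HasDerivWithinAt k (α (c + t • (w : E)) w * k t) (Icc 0 1) t) ∧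
      ∀ t ∈ Icc (0 : ℝ) 1, ‖k t‖ ≤ ‖(1 : 𝔸)‖ * Real.exp (M * r) := by
    rintro ⟨w, hw⟩
    refine exists_hasDerivWithinAt_mul_Icc (fun t ht => ?_) (fun t ht => ?_) hrC
    · have h1 : ContinuousAt (fun t : ℝ => α (c + t • w)) t :=
        ContinuousAt.comp (f := fun t : ℝ => c + t • w) (hd _ (hmem w hw t ht)).continuousAt
          (by fun_prop)
      exact (h1.clm_apply continuousAt_const).continuousWithinAt
    · refine (ContinuousLinearMap.le_opNorm _ _).trans ?_
      gcongr
      · exact (hball (hmem w hw t ht)).1.2.1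
      · exact (mem_ball_zero_iff.1 hw).le
  choose k hk0 hk hkN using hsol
  set N : ℝ := ‖(1 : 𝔸)‖ * Real.exp (M * r) with hN
  classical
  -- `K z` is the endpoint of the solution along the ray from `c` to `z`; the value `1` off the ball
  -- plays no role.
  set K : E → 𝔸 := fun z => if hz : z - c ∈ ball (0 : E) r then k ⟨z - c, hz⟩ 1 else 1 with hK
  have hKd : ∀ z ∈ ball c r, HasFDerivAt K ((ContinuousLinearMap.mul ℝ 𝔸).flip (K z) ∘L α z) z := by
    intro z hz
    have hzc : z - c ∈ ball (0 : E) r := by rwa [mem_ball_zero_iff, ← mem_ball_iff_norm]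
    have hnear : ∀ᶠ h in 𝓝 (0 : E), (z - c) + h ∈ ball (0 : E) r := by
      have : ContinuousAt (fun h : E => (z - c) + h) 0 := by fun_prop
      exact this.eventually_mem (isOpen_ball.mem_nhds (by simpa using hzc))
    rw [hasFDerivAt_iff_isLittleO_nhds_zero]
    have hO : (fun h => K (z + h) - K z -
        ((ContinuousLinearMap.mul ℝ 𝔸).flip (K z) ∘L α z) h) =O[𝓝 0] fun h => ‖h‖ ^ 2 := by
      refine Asymptotics.IsBigO.of_bound
        -- This is the value at time 1 of the Grönwall bound `ε / κ (exp (κ t) - 1)` with `κ = 5 M`.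
        ((2 * M * N + 2 * M * M * N) / (5 * M) * (Real.exp (5 * M) - 1)) ?_
      filter_upwards [hnear] with h hh
      have hzh : z + h - c = z - c + h := by abel
      have hb := norm_ray_solution_sub_le hM hd (fun z hz => (hball hz).1.2.1)
        (fun z hz => (hball hz).1.2.2.1)
        (fun x hx y hy => ((hL.norm_sub_le (hball hx).1.1 (hball hy).1.1)).trans
          (by gcongr; exact (hball hx).1.2.2.2))
        (fun z hz => hflat z (hball hz).2) hr1 hzc hh (hk0 ⟨_, hzc⟩) (hk0 ⟨_, hh⟩)
        (hk ⟨_, hzc⟩) (hk ⟨_, hh⟩) (hkN ⟨_, hzc⟩) (hkN ⟨_, hh⟩)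
      rw [gronwallBound_of_K_ne_0 (by positivity)] at hb
      simp only [hK, hzh, dif_pos hh, dif_pos hzc]
      simp only [ContinuousLinearMap.comp_apply, ContinuousLinearMap.flip_apply,
        ContinuousLinearMap.mul_apply', norm_pow, norm_norm]
      simp only [add_sub_cancel] at hb
      refine hb.trans (le_of_eq ?_)
      simp only [zero_mul, zero_add, mul_one]
      ring
    refine hO.trans_isLittleO ?_
    simpa using (Asymptotics.isLittleO_norm_pow_id (E' := E) one_lt_two)
  have hKc : K c = 1 := by
    have h0 : c - c ∈ ball (0 : E) r := by simpa using hr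
    have hconst : ∀ t ∈ Icc (0 : ℝ) 1, k ⟨c - c, h0⟩ t = k ⟨c - c, h0⟩ 0 :=
      constant_of_has_deriv_right_zero (fun t ht => (hk ⟨c - c, h0⟩ t ht).continuousWithinAt)
        fun t ht => ((hk ⟨c - c, h0⟩ t (Ico_subset_Icc_self ht)).mono_of_mem_nhdsWithin
          (Icc_mem_nhdsGE_of_mem ht)).congr_deriv (by simp)
    simp only [hK, dif_pos h0]
    rw [hconst 1 (by simp), hk0]
  have hKcont : ContinuousOn K (ball c r) := fun z hz => (hKd z hz).continuousAt.continuousWithinAt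
  -- Units form an open set and `K c = 1`, so invertibility costs only a smaller neighbourhood.
  refine ⟨ball c r ∩ K ⁻¹' {x | IsUnit x}, ?_, hKcont.isOpen_inter_preimage isOpen_ball
    Units.isOpen, fun z hz => (hball hz.1).2, K, fun z hz => ⟨hz.2, hKd z hz.1⟩⟩
  refine inter_mem (ball_mem_nhds c hr) ((hKd c (mem_ball_self hr)).continuousAt.preimage_mem_nhds
    (Units.isOpen.mem_nhds ?_))
  simp [hKc]

end FlatFrame

/-! ### Gluing of local solutions over a simply connected space. -/

/-- A locally constant cocycle with values in a group is trivial on a simply connected space: local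
functions `φ x` near `x`, which differ by locally constant factors on the right, can be
continued to a global function. -/
theorem exists_global_of_locally_constant_cocycle {X 𝒢 : Type*} [TopologicalSpace X]
    [SimplyConnectedSpace X] [LocallyPathConnectedSpace X] [Group 𝒢] {U : X → Set X}
    (hU : ∀ x, IsOpen (U x)) (hxU : ∀ x, x ∈ U x) (φ : X → X → 𝒢)
    (hφ : ∀ i j, ∀ x ∈ U i ∩ U j, ∀ᶠ y in 𝓝 x, (φ j y)⁻¹ * φ i y = (φ j x)⁻¹ * φ i x)
    (x₀ : X) (g₀ : 𝒢) :
    ∃ s : X → 𝒢, s x₀ = g₀ ∧ ∀ x, ∀ᶠ y in 𝓝 x, s y = φ x y * ((φ x x)⁻¹ * s x) := by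
  -- With discrete fibres, the bundle having the cocycle as transition functions is a covering. The
  -- identity of the simply connected base then lifts to it, and the lift is the desired global
  -- section.
  let _ : TopologicalSpace 𝒢 := ⊥
  have : DiscreteTopology 𝒢 := ⟨rfl⟩
  let Z : FiberBundleCore X X 𝒢 :=
    { baseSet := U
      isOpen_baseSet := hU
      indexAt := id
      mem_baseSet_at := hxU
      coordChange := fun i j x v => (φ j x)⁻¹ * φ i x * v
      coordChange_self := fun i x _ v => by simp
      continuousOn_coordChange := by
        rintro i j ⟨x, v⟩ ⟨hx, -⟩
        refine ContinuousAt.continuousWithinAt (ContinuousAt.congr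
          (f := fun p : X × 𝒢 => (φ j x)⁻¹ * φ i x * p.2) ?_ ?_)
        · exact (continuous_of_discreteTopology
            (f := fun v => (φ j x)⁻¹ * φ i x * v)).continuousAt.comp continuousAt_snd
        · have := (continuousAt_fst (p := (x, v))).eventually (hφ i j x hx)
          filter_upwards [this] with p hp
          rw [hp]
      coordChange_comp := fun i j k x _ v => by group }
  have hcov : IsCoveringMap (Bundle.TotalSpace.proj : Z.TotalSpace → X) :=
    FiberBundle.isCoveringMap
  obtain ⟨S, ⟨hS₀, hS⟩, -⟩ := hcov.existsUnique_continuousMap_lifts (ContinuousMap.id X) x₀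
    (⟨x₀, (φ x₀ x₀)⁻¹ * g₀⟩ : Z.TotalSpace) rfl
  have hproj : ∀ x, (S x).proj = x := fun x => congrFun hS x
  let f : X → 𝒢 := fun x => (S x).2
  -- `f x` is the coordinate of the section in the chart indexed by `x` itself, so the factor `φ x
  -- x` converts it into a value of the solution.
  refine ⟨fun x => φ x x * f x, ?_, fun x => ?_⟩
  · have : f x₀ = (φ x₀ x₀)⁻¹ * g₀ := by
      simp only [f]; rw [hS₀]
    simp [this]
  · have hcont : ContinuousAt (fun y => (Z.localTriv x (S y)).2) x := by
      refine continuousAt_snd.comp (ContinuousAt.comp (g := Z.localTriv x) ?_ S.continuous.continuousAt)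
      refine (Z.localTriv x).continuousOn.continuousAt ((Z.localTriv x).open_source.mem_nhds ?_)
      rw [(Z.localTriv x).mem_source]
      change (S x).proj ∈ U x
      rw [hproj]; exact hxU x
    have hval : ∀ y, (Z.localTriv x (S y)).2 = (φ x y)⁻¹ * φ y y * f y := by
      intro y
      change (φ x (S y).proj)⁻¹ * φ (S y).proj (S y).proj * f y = _
      rw [hproj]
    have hloc := hcont.eventually ((isOpen_discrete {(Z.localTriv x (S x)).2}).mem_nhds rfl)
    filter_upwards [hloc] with y hy
    replace hy : (Z.localTriv x (S y)).2 = (Z.localTriv x (S x)).2 := hy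
    rw [hval, hval] at hy
    have : φ y y * f y = φ x y * ((φ x x)⁻¹ * φ x x * f x) := by rw [← hy]; group
    rw [this]; group

/-! ### Global solutions of `dK = α K` and their smoothness. -/

section FlatFrame

variable {E 𝔸 : Type*} [NormedAddCommGroup E] [NormedSpace ℝ E]
  [NormedRing 𝔸] [NormedAlgebra ℝ 𝔸]

/-- Two local solutions of `dK = α K` differ by a locally constant factor. -/
theorem eventually_inverse_mul_eq [CompleteSpace 𝔸] {α : E → E →L[ℝ] 𝔸} {K K' : E → 𝔸} {V : Set E}
    (hV : IsOpen V) (hK : ∀ z ∈ V, IsUnit (K z) ∧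
      HasFDerivAt K ((ContinuousLinearMap.mul ℝ 𝔸).flip (K z) ∘L α z) z)
    (hK' : ∀ z ∈ V, HasFDerivAt K' ((ContinuousLinearMap.mul ℝ 𝔸).flip (K' z) ∘L α z) z)
    {c : E} (hc : c ∈ V) :
    ∀ᶠ z in 𝓝 c, Ring.inverse (K z) * K' z = Ring.inverse (K c) * K' c := by
  -- The derivative of `K⁻¹` contributes `-K⁻¹ α K'` and that of `K'` contributes `K⁻¹ α K'`.
  have hd : ∀ z ∈ V, HasFDerivAt (fun z => Ring.inverse (K z) * K' z) (0 : E →L[ℝ] 𝔸) z := by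
    intro z hz
    obtain ⟨⟨u, hu⟩, hKz⟩ := hK z hz
    have hinv : HasFDerivAt Ring.inverse (-ContinuousLinearMap.mulLeftRight ℝ 𝔸 ↑u⁻¹ ↑u⁻¹) (K z) := by
      rw [← hu]; exact hasFDerivAt_ringInverse (𝕜 := ℝ) u
    refine ((hinv.comp z hKz).mul' (hK' z hz)).congr_fderiv ?_
    ext v
    simp [← hu, mul_assoc]
  obtain ⟨ρ, hρ, hρV⟩ := Metric.isOpen_iff.1 hV c hc
  filter_upwards [ball_mem_nhds c hρ] with z hz
  exact (convex_ball c ρ).is_const_of_fderivWithin_eq_zero (𝕜 := ℝ)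
    (f := fun z => Ring.inverse (K z) * K' z)
    (fun x hx => (hd x (hρV hx)).differentiableAt.differentiableWithinAt)
    (fun x hx => ((hd x (hρV hx)).hasFDerivWithinAt.fderivWithin
      (isOpen_ball.uniqueDiffWithinAt hx))) hz (mem_ball_self hρ)

/-- On a simply connected open set the equation `dK = α K` has an invertible solution if it
satisfies the integrability condition. -/
theorem exists_flat_frame [CompleteSpace 𝔸] {α : E → E →L[ℝ] 𝔸} {U : Set E} (hU : IsOpen U)
    (hsc : IsSimplyConnected U) (hα : ContDiffOn ℝ ∞ α U)
    (hflat : ∀ z ∈ U, ∀ u v,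
      fderiv ℝ α z u v + α z v * α z u = fderiv ℝ α z v u + α z u * α z v)
    {c : E} (hc : c ∈ U) :
    ∃ K : E → 𝔸, K c = 1 ∧ ContDiffOn ℝ ∞ K U ∧ ∀ z ∈ U, IsUnit (K z) ∧
      HasFDerivAt K ((ContinuousLinearMap.mul ℝ 𝔸).flip (K z) ∘L α z) z := by
  classical
  have := hsc.simplyConnectedSpace
  have := hU.locallyPathConnectedSpace
  have hloc := fun x : U => exists_local_flat_frame hU hα hflat x.2
  choose V hVn hVo hVU k hk using hloc
  -- Only the values on `V i`, where `k i` is invertible, are ever used.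
  let φ : U → U → 𝔸ˣ := fun i x => if h : IsUnit (k i x) then h.unit else 1
  have hφ : ∀ i : U, ∀ x : U, (x : E) ∈ V i → ((φ i x : 𝔸ˣ) : 𝔸) = k i x := by
    intro i x hx
    simp [φ, dif_pos (hk i x hx).1]
  obtain ⟨s, hs0, hs⟩ := exists_global_of_locally_constant_cocycle
    (U := fun i : U => ((↑) : U → E) ⁻¹' V i) (fun i => (hVo i).preimage continuous_subtype_val)
    (fun i => mem_preimage.2 (mem_of_mem_nhds (hVn i))) φ (by
      rintro i j x ⟨hxi, hxj⟩
      have hev := eventually_inverse_mul_eq ((hVo i).inter (hVo j)) (fun z hz => hk j z hz.2)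
        (fun z hz => (hk i z hz.1).2) ⟨hxi, hxj⟩
      have hmem := ((hVo i).inter (hVo j)).mem_nhds ⟨hxi, hxj⟩
      have hev' := (continuous_subtype_val.continuousAt (x := x)).eventually (hev.and hmem)
      filter_upwards [hev'] with y hy
      have h1 := hy.1
      rw [← hφ i y hy.2.1, ← hφ j y hy.2.2, ← hφ i x hxi, ← hφ j x hxj, Ring.inverse_unit,
        Ring.inverse_unit] at h1
      exact_mod_cast h1) ⟨c, hc⟩ 1
  let K : E → 𝔸 := fun z => if h : z ∈ U then (s ⟨z, h⟩ : 𝔸) else 1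
  have hKs : ∀ x : U, K x = s x := fun x => by simp [K]
  have hKd : ∀ z ∈ U, HasFDerivAt K ((ContinuousLinearMap.mul ℝ 𝔸).flip (K z) ∘L α z) z := by
    intro z hz
    have hev : ∀ᶠ y in 𝓝 z, K y = k ⟨z, hz⟩ y * (((φ ⟨z, hz⟩ ⟨z, hz⟩)⁻¹ * s ⟨z, hz⟩ : 𝔸ˣ) : 𝔸) := by
      have h1 := hs ⟨z, hz⟩
      rw [nhds_subtype_eq_comap, eventually_comap] at h1
      filter_upwards [h1, hVn ⟨z, hz⟩] with y hy hyV
      have hyU := hVU _ hyV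
      rw [hKs ⟨y, hyU⟩, hy ⟨y, hyU⟩ rfl, Units.val_mul, hφ _ ⟨y, hyU⟩ hyV]
    have hd := ((hk ⟨z, hz⟩ z (mem_of_mem_nhds (hVn ⟨z, hz⟩))).2.mul_const'
      (((φ ⟨z, hz⟩ ⟨z, hz⟩)⁻¹ * s ⟨z, hz⟩ : 𝔸ˣ) : 𝔸)).congr_of_eventuallyEq hev
    refine hd.congr_fderiv ?_
    ext v
    simp [hev.self_of_nhds, mul_assoc]
  refine ⟨K, by rw [hKs ⟨c, hc⟩, hs0]; simp, ?_, fun z hz => ⟨?_, hKd z hz⟩⟩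
  -- Bootstrap: if `K` is of class `C^n`, so is `dK = α K`, hence `K` is of class `C^(n+1)`.
  · rw [contDiffOn_infty]
    intro n
    induction n with
    | zero => exact contDiffOn_zero.2 fun z hz => (hKd z hz).continuousAt.continuousWithinAt
    | succ n ih =>
      rw [Nat.cast_add, Nat.cast_one, contDiffOn_succ_iff_fderiv_of_isOpen hU]
      refine ⟨fun z hz => (hKd z hz).differentiableAt.differentiableWithinAt, by simp, ?_⟩
      refine ContDiffOn.congr ?_ fun z hz => (hKd z hz).fderiv
      exact (((ContinuousLinearMap.mul ℝ 𝔸).flip.contDiff.comp_contDiffOn ih).clm_comp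
        (hα.of_le (by exact_mod_cast le_top)))
  · rw [hKs ⟨z, hz⟩]; exact (s ⟨z, hz⟩).isUnit

/-- The equation `∂K/∂x = a K`, `∂K/∂y = b K` on a simply connected planar domain. -/
theorem exists_flat_frame_complex [CompleteSpace 𝔸] {a b : ℂ → 𝔸} {U : Set ℂ} (hU : IsOpen U)
    (hsc : IsSimplyConnected U) (ha : ContDiffOn ℝ ∞ a U) (hb : ContDiffOn ℝ ∞ b U)
    (hflat : ∀ z ∈ U,
      fderiv ℝ b z 1 + b z * a z = fderiv ℝ a z Complex.I + a z * b z)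
    {c : ℂ} (hc : c ∈ U) :
    ∃ K : ℂ → 𝔸, K c = 1 ∧ ContDiffOn ℝ ∞ K U ∧ ∀ z ∈ U, IsUnit (K z) ∧
      ∀ v, fderiv ℝ K z v = (v.re • a z + v.im • b z) * K z := by
  let α : ℂ → ℂ →L[ℝ] 𝔸 := fun z => Complex.reCLM.smulRight (a z) + Complex.imCLM.smulRight (b z)
  have hα : ContDiffOn ℝ ∞ α U := by
    have h1 := (ContinuousLinearMap.smulRightL ℝ ℂ 𝔸 Complex.reCLM).contDiff.comp_contDiffOn ha
    have h2 := (ContinuousLinearMap.smulRightL ℝ ℂ 𝔸 Complex.imCLM).contDiff.comp_contDiffOn hb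
    exact h1.add h2
  have hαv : ∀ z v, α z v = v.re • a z + v.im • b z := fun z v => by simp [α]
  -- Integrability is an alternating condition in `u`, `v`, so in the plane the pair `(1, i)`
  -- decides it.
  suffices hfl : ∀ z ∈ U, ∀ u v,
      fderiv ℝ α z u v + α z v * α z u = fderiv ℝ α z v u + α z u * α z v by
    obtain ⟨K, hK1, hK2, hK3⟩ := exists_flat_frame hU hsc hα hfl hc
    exact ⟨K, hK1, hK2, fun z hz => ⟨(hK3 z hz).1, fun v => by
      rw [(hK3 z hz).2.fderiv]; simp [hαv, add_mul]⟩⟩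
  intro z hz u v
  have hnhds := hU.mem_nhds hz
  have hda := (ha.contDiffAt hnhds).differentiableAt (by simp)
  have hdb := (hb.contDiffAt hnhds).differentiableAt (by simp)
  have hdα := (hα.contDiffAt hnhds).differentiableAt (by simp)
  have hd : ∀ u v, fderiv ℝ α z u v = v.re • fderiv ℝ a z u + v.im • fderiv ℝ b z u := by
    intro u v
    have h1 : fderiv ℝ (fun w => α w v) z u = fderiv ℝ α z u v := by
      rw [fderiv_clm_apply hdα (differentiableAt_const v)]
      simp
    have h2 : (fun w => α w v) = fun w => v.re • a w + v.im • b w := funext fun w => hαv w v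
    rw [← h1, h2]
    have h3 := (hda.hasFDerivAt.const_smul v.re).add (hdb.hasFDerivAt.const_smul v.im)
    exact congrArg (fun T : ℂ →L[ℝ] 𝔸 => T u) h3.fderiv
  have hlin : ∀ (f : ℂ → 𝔸) (u : ℂ), fderiv ℝ f z u =
      u.re • fderiv ℝ f z 1 + u.im • fderiv ℝ f z Complex.I := by
    intro f u
    rw [← map_smul, ← map_smul, ← map_add]
    congr 1
    apply Complex.ext <;> simp
  have hf : fderiv ℝ b z 1 = fderiv ℝ a z Complex.I + a z * b z - b z * a z := by
    rw [← hflat z hz]; abel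
  rw [hd, hd, hlin a u, hlin a v, hlin b u, hlin b v, hαv, hαv, hf]
  simp only [mul_add, add_mul, smul_add, smul_sub, smul_mul_smul_comm, smul_smul]
  rw [mul_comm v.re u.re, mul_comm v.im u.im, mul_comm v.re u.im, mul_comm v.im u.re]
  abel

end FlatFrame

end

noncomputable section

open Filter Topology Set

namespace HamStat

section

/-! ### The automorphism and its eigenspaces -/

theorem Jm_mul_Jp : Jm * Jp = 1 := by
  ext i j
  fin_cases i <;> fin_cases j <;> simp [Jm, Jp, Matrix.mul_apply, Fin.sum_univ_three]

theorem Jp_mul_Jm : Jp * Jm = 1 := mul_eq_one_comm.1 Jm_mul_Jp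

/-- `τ` as a linear map. -/
def tauLin : M3 →ₗ[ℂ] M3 where
  toFun := tau
  map_add' M N := by simp only [tau, Matrix.transpose_add, mul_add, add_mul, neg_add]
  map_smul' c M := by simp [tau]

theorem tauLin_apply (M : M3) : tauLin M = tau M := rfl

theorem tau_add (M N : M3) : tau (M + N) = tau M + tau N := tauLin.map_add M N

theorem tau_smul (c : ℂ) (M : M3) : tau (c • M) = c • tau M := tauLin.map_smul c M

theorem tau_neg (M : M3) : tau (-M) = -tau M := tauLin.map_neg M

theorem tau_tau_tau_tau (M : M3) : tau (tau (tau (tau M))) = M := by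
  ext i j
  fin_cases i <;> fin_cases j <;> simp [tau_eq]

theorem tau_conjTranspose (M : M3) : tau Mᴴ = (tau M)ᴴ := by
  ext i j
  fin_cases i <;> fin_cases j <;> simp [tau_eq]

theorem tau_mul (M N : M3) : tau (M * N) = -(tau N * tau M) := by
  simp only [tau, Matrix.transpose_mul, neg_mul, mul_neg, neg_neg]
  calc -(Jm * (Nᵀ * Mᵀ) * Jp) = -(Jm * Nᵀ * (1 * Mᵀ * Jp)) := by simp [mul_assoc]
    _ = -(Jm * Nᵀ * Jp * (Jm * Mᵀ * Jp)) := by rw [← Jp_mul_Jm]; simp only [mul_assoc]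

theorem tau_lie (M N : M3) : tau ⁅M, N⁆ = ⁅tau M, tau N⁆ := by
  rw [Ring.lie_def, Ring.lie_def, sub_eq_add_neg, tau_add, tau_neg, tau_mul, tau_mul]
  abel

theorem tauComp_eq (a : ℤ) (M : M3) : tauComp a M = (1 / 4 : ℂ) •
    (M + Complex.I ^ (-a) • tau M + Complex.I ^ (-(2 * a)) • tau (tau M)
      + Complex.I ^ (-(3 * a)) • tau (tau (tau M))) := by
  simp [tauComp, Finset.sum_range_succ, mul_comm]

/-- The projection onto an eigenspace of `τ` as a linear map. -/
def tauCompLin (a : ℤ) : M3 →ₗ[ℂ] M3 where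
  toFun := tauComp a
  map_add' M N := by simp only [tauComp_eq, tau_add, smul_add]; abel
  map_smul' c M := by
    simp only [tauComp_eq, tau_smul, smul_add, RingHom.id_apply, smul_comm c]

theorem tauCompLin_apply (a : ℤ) (M : M3) : tauCompLin a M = tauComp a M := rfl

theorem tauComp_add (a : ℤ) (M N : M3) : tauComp a (M + N) = tauComp a M + tauComp a N :=
  (tauCompLin a).map_add M N

theorem tauComp_sub (a : ℤ) (M N : M3) : tauComp a (M - N) = tauComp a M - tauComp a N :=
  (tauCompLin a).map_sub M N

theorem tauComp_neg (a : ℤ) (M : M3) : tauComp a (-M) = -tauComp a M :=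
  (tauCompLin a).map_neg M

theorem tauComp_smul (a : ℤ) (c : ℂ) (M : M3) : tauComp a (c • M) = c • tauComp a M :=
  (tauCompLin a).map_smul c M

theorem I_zpow_four_mul (a : ℤ) : Complex.I ^ (4 * a) = 1 := by
  rw [zpow_mul]
  have : Complex.I ^ (4 : ℤ) = 1 := by exact_mod_cast Complex.I_pow_four
  rw [this, one_zpow]

theorem uC_congr {a b : ℤ} (k : ℤ) (h : b = a + 4 * k) : uC b = uC a := by
  subst h
  simp only [uC]
  rw [zpow_add₀ Complex.I_ne_zero, I_zpow_four_mul, mul_one]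

theorem tauComp_congr {a b : ℤ} (k : ℤ) (h : b = a + 4 * k) (M : M3) :
    tauComp b M = tauComp a M := by
  subst h
  have e1 : -(a + 4 * k) = -a + 4 * (-k) := by ring
  have e2 : -(2 * (a + 4 * k)) = -(2 * a) + 4 * (-(2 * k)) := by ring
  have e3 : -(3 * (a + 4 * k)) = -(3 * a) + 4 * (-(3 * k)) := by ring
  simp only [tauComp_eq, e1, e2, e3, zpow_add₀ Complex.I_ne_zero, I_zpow_four_mul, mul_one]

theorem tauComp_mem (a : ℤ) (M : M3) : tauComp a M ∈ uC a := by
  change tau _ = _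
  rw [tauComp_eq, tau_smul, smul_comm (Complex.I ^ a)]
  congr 1
  simp only [tau_add, tau_smul, tau_tau_tau_tau, smul_add, smul_smul,
    ← zpow_add₀ Complex.I_ne_zero]
  have e1 : a + -a = 0 := by ring
  have e2 : a + -(2 * a) = -a := by ring
  have e3 : a + -(3 * a) = -(2 * a) := by ring
  have e4 : Complex.I ^ (-(3 * a)) = Complex.I ^ a := by
    rw [show -(3 * a) = a + 4 * (-a) by ring, zpow_add₀ Complex.I_ne_zero, I_zpow_four_mul, mul_one]
  rw [e1, e2, e3, e4, zpow_zero, one_smul]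
  abel

/-- On an eigenvector the average becomes a geometric sum in the fourth root of unity `i ^ (b - a)`,
which is 4 or 0. -/
theorem tauComp_of_mem_aux {a b : ℤ} {M : M3} (h : M ∈ uC b) : tauComp a M =
    ((1 / 4 : ℂ) * (1 + Complex.I ^ (b - a) + (Complex.I ^ (b - a)) ^ 2
      + (Complex.I ^ (b - a)) ^ 3)) • M := by
  have h : tau M = Complex.I ^ b • M := h
  have e1 : Complex.I ^ (b - a) = Complex.I ^ b * Complex.I ^ (-a) := by
    rw [← zpow_add₀ Complex.I_ne_zero, sub_eq_add_neg]
  have e2 : Complex.I ^ (-(2 * a)) = (Complex.I ^ (-a)) ^ 2 := by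
    rw [← zpow_natCast, ← zpow_mul]; congr 1; push_cast; ring
  have e3 : Complex.I ^ (-(3 * a)) = (Complex.I ^ (-a)) ^ 3 := by
    rw [← zpow_natCast, ← zpow_mul]; congr 1; push_cast; ring
  simp only [tauComp_eq, h, tau_smul, e1, e2, e3]
  module

theorem tauComp_of_mem {a : ℤ} {M : M3} (h : M ∈ uC a) : tauComp a M = M := by
  rw [tauComp_of_mem_aux h]; simp; norm_num

theorem tauComp_of_mem_of_ne {a b : ℤ} {M : M3} (h : M ∈ uC b) (hab : ¬ (4 : ℤ) ∣ b - a) :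
    tauComp a M = 0 := by
  rw [tauComp_of_mem_aux h]
  set x := Complex.I ^ (b - a) with hx
  have h4 : x ^ 4 = 1 := by
    rw [hx, ← zpow_natCast, ← zpow_mul, mul_comm]; exact I_zpow_four_mul _
  have h1 : x ≠ 1 := by
    intro h1
    have := Int.emod_add_mul_ediv (b - a) 4
    rw [hx, ← this, zpow_add₀ Complex.I_ne_zero, I_zpow_four_mul, mul_one] at h1
    have hr : (b - a) % 4 = 1 ∨ (b - a) % 4 = 2 ∨ (b - a) % 4 = 3 := by omega
    rcases hr with hr | hr | hr <;> rw [hr] at h1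
    · simp [Complex.ext_iff] at h1
    · have : Complex.I ^ (2 : ℤ) = -1 := by exact_mod_cast Complex.I_sq
      rw [this] at h1; norm_num at h1
    · have : Complex.I ^ (3 : ℤ) = -Complex.I := by exact_mod_cast Complex.I_pow_three
      rw [this] at h1; simp [Complex.ext_iff] at h1
  have : 1 + x + x ^ 2 + x ^ 3 = 0 := by
    have : (x - 1) * (1 + x + x ^ 2 + x ^ 3) = 0 := by linear_combination h4
    exact (mul_eq_zero.1 this).resolve_left (sub_ne_zero.2 h1)
  rw [this]; simp

theorem conjTranspose_mem_uC {a : ℤ} {M : M3} (h : M ∈ uC a) : Mᴴ ∈ uC (-a) := by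
  have h : tau M = Complex.I ^ a • M := h
  change tau _ = _
  rw [tau_conjTranspose, h, Matrix.conjTranspose_smul]
  congr 1
  rw [zpow_neg, star_zpow₀, ← inv_zpow]
  simp

theorem tauComp_conjTranspose (a : ℤ) (M : M3) : (tauComp a M)ᴴ = tauComp (-a) Mᴴ := by
  have hI : ∀ k : ℤ, star (Complex.I ^ k) = Complex.I ^ (-k) := fun k => by
    rw [zpow_neg, star_zpow₀, ← inv_zpow]; simp
  simp only [tauComp_eq, Matrix.conjTranspose_smul, Matrix.conjTranspose_add, hI,
    tau_conjTranspose]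
  simp

theorem lie_mem_uC {a b : ℤ} {M N : M3} (hM : M ∈ uC a) (hN : N ∈ uC b) : ⁅M, N⁆ ∈ uC (a + b) := by
  have hM : tau M = Complex.I ^ a • M := hM
  have hN : tau N = Complex.I ^ b • N := hN
  change tau _ = _
  rw [tau_lie, hM, hN, Ring.lie_def, Ring.lie_def, smul_mul_smul_comm, smul_mul_smul_comm,
    mul_comm (Complex.I ^ b), ← smul_sub, zpow_add₀ Complex.I_ne_zero]

theorem smul_mem_uC {a : ℤ} {M : M3} (c : ℂ) (hM : M ∈ uC a) : c • M ∈ uC a := by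
  have hM : tau M = Complex.I ^ a • M := hM
  change tau _ = _
  rw [tau_smul, hM, smul_comm]

theorem add_mem_uC {a : ℤ} {M N : M3} (hM : M ∈ uC a) (hN : N ∈ uC a) : M + N ∈ uC a := by
  have hM : tau M = Complex.I ^ a • M := hM
  have hN : tau N = Complex.I ^ a • N := hN
  change tau _ = _
  rw [tau_add, hM, hN, smul_add]

theorem sub_mem_uC {a : ℤ} {M N : M3} (hM : M ∈ uC a) (hN : N ∈ uC a) : M - N ∈ uC a := by
  rw [sub_eq_add_neg, ← neg_one_smul ℂ N]
  exact add_mem_uC hM (smul_mem_uC _ hN)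

theorem tauComp_sum (M : M3) :
    tauComp 2 M + tauComp (-1) M + tauComp 0 M + tauComp 1 M = M := by
  have h2 : Complex.I ^ (-2 : ℤ) = -1 := by
    rw [zpow_neg]; norm_cast; rw [Complex.I_sq]; norm_num
  have h3 : Complex.I ^ (3 : ℤ) = -Complex.I := by exact_mod_cast Complex.I_pow_three
  have h3' : Complex.I ^ (-3 : ℤ) = Complex.I := by rw [zpow_neg, h3]; simp
  have h4 : Complex.I ^ (-4 : ℤ) = 1 := by simp
  have h6 : Complex.I ^ (-6 : ℤ) = -1 := by
    rw [show (-6 : ℤ) = -2 + 4 * (-1) by norm_num, zpow_add₀ Complex.I_ne_zero, I_zpow_four_mul, h2,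
      mul_one]
  have h2' : Complex.I ^ (2 : ℤ) = -1 := by exact_mod_cast Complex.I_sq
  simp only [tauComp_eq]
  norm_num [h2, h3, h4, h6, h2', h3']
  module

/-! Matrix form of the eigenspaces that commute with each other. -/

theorem eq_of_mem_uC_zero {M : M3} (h : M ∈ uC 0) :
    M = !![M 0 0, M 0 1, 0; M 1 0, -M 0 0, 0; 0, 0, 0] := by
  have h' : tau M = M := by simpa [uC] using h
  have e : ∀ i j, tau M i j = M i j := fun i j => by rw [h']
  simp [tau_eq, Fin.forall_fin_succ] at e
  ext i j
  fin_cases i <;> fin_cases j <;> simp <;> grind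

theorem eq_of_mem_uC_two {M : M3} (h : M ∈ uC 2) : M = Matrix.diagonal ![M 0 0, M 0 0, M 2 2] := by
  have h2' : Complex.I ^ (2 : ℤ) = -1 := by exact_mod_cast Complex.I_sq
  have h' : tau M = -M := by simpa [uC, h2'] using h
  have e : ∀ i j, tau M i j = -M i j := fun i j => by rw [h']; rfl
  simp [tau_eq, Fin.forall_fin_succ] at e
  ext i j
  fin_cases i <;> fin_cases j <;> simp <;> grind

/-- `τ` changes the sign of the `(2, 2)` entry, and `-1` differs from the eigenvalues `±i`. -/
theorem apply_two_two_of_mem_uC_odd {a : ℤ} {M : M3} (h : M ∈ uC a) (ha : a = 1 ∨ a = -1) :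
    M 2 2 = 0 := by
  have h : tau M = Complex.I ^ a • M := h
  have e : tau M 2 2 = (Complex.I ^ a • M) 2 2 := by rw [h]
  rcases ha with rfl | rfl <;> simp [tau_eq] at e
  · have : (1 + Complex.I) * M 2 2 = 0 := by linear_combination -e
    refine (mul_eq_zero.1 this).resolve_left ?_
    simp [Complex.ext_iff]
  · have : (1 - Complex.I) * M 2 2 = 0 := by linear_combination e
    refine (mul_eq_zero.1 this).resolve_left ?_
    simp [Complex.ext_iff]

/-- Degree 2 matrices `diag(s, s, t)` are scalar on the upper block, which is the only place where
degree 0 matrices live. -/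
theorem lie_uC_zero_two {M N : M3} (hM : M ∈ uC 0) (hN : N ∈ uC 2) : ⁅M, N⁆ = 0 := by
  rw [eq_of_mem_uC_zero hM, eq_of_mem_uC_two hN, Ring.lie_def]
  ext i j
  rw [Matrix.sub_apply, Matrix.mul_diagonal, Matrix.diagonal_mul]
  fin_cases i <;> fin_cases j <;> simp [mul_comm]

theorem lie_uC_two_two {M N : M3} (hM : M ∈ uC 2) (hN : N ∈ uC 2) : ⁅M, N⁆ = 0 := by
  rw [eq_of_mem_uC_two hM, eq_of_mem_uC_two hN, Ring.lie_def, Matrix.diagonal_mul_diagonal,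
    Matrix.diagonal_mul_diagonal]
  simp only [mul_comm, sub_self]

/-! ### The group `U(3)_0` -/

/-- The element of `U(3)_0` with second column `(p, q, 0)`. -/
def suMat (p q : ℂ) : M3 := !![star q, p, 0; -star p, q, 0; 0, 0, 1]

theorem suMat_conjTranspose_mul {p q : ℂ} (h : star p * p + star q * q = 1) :
    (suMat p q)ᴴ * suMat p q = 1 := by
  ext i j
  fin_cases i <;> fin_cases j <;>
    simp [suMat, Matrix.mul_apply, Fin.sum_univ_three] at h ⊢ <;> grind

theorem suMat_mem {p q : ℂ} (h : star p * p + star q * q = 1) : suMat p q ∈ U30 := by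
  have h1 := suMat_conjTranspose_mul h
  refine ⟨Matrix.mem_unitaryGroup_iff'.2 h1, ?_, by simp [suMat]⟩
  have h2 : (suMat p q)ᵀ * ((suMat p q)ᴴ)ᵀ = 1 := by
    rw [← Matrix.transpose_mul, h1, Matrix.transpose_one]
  rw [tauGrp, Matrix.inv_eq_right_inv h2, ← neg_neg (_ * _ * Jp)]
  change -tau _ = _
  ext i j
  fin_cases i <;> fin_cases j <;> simp [suMat, tau_eq]

theorem eq_suMat_of_mem {g : M3} (h : g ∈ U30) :
    g = suMat (g 0 1) (g 1 1) ∧ star (g 0 1) * g 0 1 + star (g 1 1) * g 1 1 = 1 := by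
  obtain ⟨hu, ht, h22⟩ := h
  have h1 : gᴴ * g = 1 := Matrix.mem_unitaryGroup_iff'.1 hu
  have h2 : gᵀ * (gᴴ)ᵀ = 1 := by rw [← Matrix.transpose_mul, h1, Matrix.transpose_one]
  rw [tauGrp, Matrix.inv_eq_right_inv h2, ← neg_neg (_ * _ * Jp)] at ht
  have e : ∀ i j, (-tau gᴴ) i j = g i j := fun i j => congrFun (congrFun ht i) j
  simp [Fin.forall_fin_succ, tau_eq] at e
  obtain ⟨⟨e00, e01, e02⟩, ⟨e10, e11, e12⟩, e20, e21, e22⟩ := e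
  -- The fixed point equation expresses `g 0 2` by `g 1 2` and conversely; composing the two
  -- relations gives `g 0 2 = -g 0 2`.
  have z02 : g 0 2 = 0 := by
    have := congrArg star e12
    simp at this
    grind
  have z12 : g 1 2 = 0 := by rw [← e12, z02]; simp
  have z20 : g 2 0 = 0 := by
    have := congrArg star e21
    simp at this
    grind
  have z21 : g 2 1 = 0 := by rw [← e21, z20]; simp
  have hs : g = suMat (g 0 1) (g 1 1) := by
    ext i j
    fin_cases i <;> fin_cases j <;> simp [suMat, z02, z12, z20, z21, h22, ← e00, ← e10]
  refine ⟨hs, ?_⟩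
  have := congrFun (congrFun h1 1) 1
  simpa [Matrix.mul_apply, Fin.sum_univ_three, z21] using this

theorem U30_conjTranspose_mul {g : M3} (h : g ∈ U30) : gᴴ * g = 1 :=
  Matrix.mem_unitaryGroup_iff'.1 h.1

theorem U30_mul_conjTranspose {g : M3} (h : g ∈ U30) : g * gᴴ = 1 :=
  Matrix.mem_unitaryGroup_iff.1 h.1

theorem U30_inv {g : M3} (h : g ∈ U30) : g⁻¹ = gᴴ := Matrix.inv_eq_left_inv (U30_conjTranspose_mul h)

theorem U30_isUnit_det {g : M3} (h : g ∈ U30) : IsUnit g.det :=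
  Matrix.isUnit_det_of_left_inverse (U30_conjTranspose_mul h)

theorem U30_det {g : M3} (h : g ∈ U30) : g.det = 1 := by
  obtain ⟨h1, h2⟩ := eq_suMat_of_mem h
  rw [h1, suMat, Matrix.det_fin_three]
  simp at h2 ⊢
  grind

theorem U30_apply_two {g : M3} (h : g ∈ U30) (i : Fin 3) : g i 2 = (1 : M3) i 2 := by
  obtain ⟨h1, h2⟩ := eq_suMat_of_mem h
  rw [h1, suMat]
  fin_cases i <;> simp [Matrix.one_apply]

theorem U30_conjTranspose_mem {g : M3} (h : g ∈ U30) : gᴴ ∈ U30 := by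
  obtain ⟨h1, h2⟩ := eq_suMat_of_mem h
  have : gᴴ = suMat (-g 0 1) (star (g 1 1)) := by
    conv_lhs => rw [h1]
    ext i j
    fin_cases i <;> fin_cases j <;> simp [suMat]
  rw [this]
  apply suMat_mem
  simp at h2 ⊢
  linear_combination h2

/-- This is the fixed point equation of `τ` without the inverse: `g` preserves the bilinear form
`Jp`. In this form it is easily differentiated. -/
theorem U30_transpose_mul {g : M3} (h : g ∈ U30) : gᵀ * Jp * g = Jp := by
  have ht : Jm * (gᵀ)⁻¹ * Jp = g := h.2.1
  have hd : IsUnit gᵀ.det := by rw [Matrix.det_transpose]; exact U30_isUnit_det h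
  calc gᵀ * Jp * g = gᵀ * Jp * (Jm * (gᵀ)⁻¹ * Jp) := by rw [ht]
    _ = gᵀ * (Jp * Jm) * (gᵀ)⁻¹ * Jp := by simp only [mul_assoc]
    _ = Jp := by rw [Jp_mul_Jm, mul_one, Matrix.mul_nonsing_inv _ hd, one_mul]

/-- Conjugation by a fixed point of the group automorphism commutes with `τ`. Therefore gauge
transformations preserve degrees. -/
theorem tau_conj {g : M3} (h : g ∈ U30) (M : M3) : tau (g⁻¹ * M * g) = g⁻¹ * tau M * g := by
  have hd := U30_isUnit_det h
  have h1 := U30_transpose_mul h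
  have h2 : Jm * gᵀ = g⁻¹ * Jm := by
    have : Jm * gᵀ * Jp * g = 1 := by
      rw [mul_assoc Jm, mul_assoc Jm, h1, Jm_mul_Jp]
    calc Jm * gᵀ = Jm * gᵀ * Jp * g * (g⁻¹ * Jm) := by
          rw [mul_assoc _ g, ← mul_assoc g, Matrix.mul_nonsing_inv _ hd, one_mul, mul_assoc _ Jp,
            Jp_mul_Jm, mul_one]
      _ = g⁻¹ * Jm := by rw [this, one_mul]
  have h3 : (g⁻¹)ᵀ * Jp = Jp * g := by
    calc (g⁻¹)ᵀ * Jp = (g⁻¹)ᵀ * gᵀ * Jp * g := by rw [mul_assoc _ gᵀ, mul_assoc, h1]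
      _ = Jp * g := by
        rw [← Matrix.transpose_mul, Matrix.mul_nonsing_inv _ hd, Matrix.transpose_one, one_mul]
  simp only [tau, Matrix.transpose_mul, mul_neg, neg_mul]
  rw [← mul_assoc Jm, h2]
  simp only [mul_assoc]
  rw [h3]

theorem tauComp_conj {g : M3} (h : g ∈ U30) (a : ℤ) (M : M3) :
    tauComp a (g⁻¹ * M * g) = g⁻¹ * tauComp a M * g := by
  simp only [tauComp_eq, tau_conj h, mul_add, add_mul, Matrix.mul_smul, Matrix.smul_mul]

theorem conj_mem_uC {g : M3} (h : g ∈ U30) {a : ℤ} {M : M3} (hM : M ∈ uC a) :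
    g⁻¹ * M * g ∈ uC a := by
  have hM : tau M = Complex.I ^ a • M := hM
  change tau _ = _
  rw [tau_conj h, hM, Matrix.mul_smul, Matrix.smul_mul]

theorem tauGrp_mul (g h : M3) : tauGrp (g * h) = tauGrp g * tauGrp h := by
  simp only [tauGrp, Matrix.transpose_mul, Matrix.mul_inv_rev]
  calc Jm * ((gᵀ)⁻¹ * (hᵀ)⁻¹) * Jp = Jm * (gᵀ)⁻¹ * 1 * (hᵀ)⁻¹ * Jp := by
        simp only [mul_assoc, one_mul]
    _ = _ := by rw [← Jp_mul_Jm]; simp only [mul_assoc]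

/-- The projection onto `u(3)_0` as a real linear map. -/
def suPartLin : M3 →ₗ[ℝ] M3 where
  toFun := suPart
  map_add' M N := by
    ext i j
    fin_cases i <;> fin_cases j <;> simp [suPart] <;> ring
  map_smul' c M := by
    ext i j
    fin_cases i <;> fin_cases j <;> simp [suPart] <;> ring

theorem suPartLin_apply (M : M3) : suPartLin M = suPart M := rfl

theorem suPart_of_su {M : M3} (h : M ∈ uC 0) (hM : Mᴴ = -M) : suPart M = M := by
  have e := eq_of_mem_uC_zero h
  have h00 := congrFun (congrFun hM 0) 0
  have h01 := congrFun (congrFun hM 1) 0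
  simp at h00 h01
  have hre : (M 0 0).re = 0 := by
    have := congrArg Complex.re h00
    simp at this; linarith
  conv_rhs => rw [e]
  ext i j
  have r : M 0 0 = (M 0 0).im * Complex.I := by
    apply Complex.ext <;> simp [hre]
  fin_cases i <;> fin_cases j <;> simp [suPart] <;> first | exact r.symm | grind

theorem suPart_of_borel {M : M3} (h : M ∈ borel) : suPart M = 0 := by
  obtain ⟨t, c, rfl⟩ := h
  ext i j
  fin_cases i <;> fin_cases j <;> simp [suPart]

end

section

/-! ### Evaluation of loops -/

/-- The value of a loop at a point of the circle as a ring homomorphism. -/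
def Loop.evalRingHom (l : Circle) : Loop →+* M3 :=
  AddMonoidAlgebra.liftNCRingHom (RingHom.id M3)
    { toFun := fun k => algebraMap ℂ M3 ((l : ℂ) ^ (Multiplicative.toAdd k))
      map_one' := by simp
      map_mul' := fun a b => by
        rw [toAdd_mul, zpow_add₀ (Circle.coe_ne_zero l), map_mul] }
    fun x y => (Algebra.commutes (R := ℂ) ((l : ℂ) ^ (Multiplicative.toAdd y)) x).symm

theorem Loop.evalRingHom_apply (l : Circle) (ξ : Loop) : Loop.evalRingHom l ξ = ξ.evalAt l := by
  change ξ.coeff.sum _ = ξ.coeff.sum _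
  refine Finsupp.sum_congr fun k _ => ?_
  change ξ.coeff k * algebraMap ℂ M3 ((l : ℂ) ^ k) = _
  rw [← Algebra.commutes, Algebra.smul_def]

namespace Loop

variable (ξ ζ : Loop) (l : Circle)

theorem evalAt_add : (ξ + ζ).evalAt l = ξ.evalAt l + ζ.evalAt l := by
  simp only [← evalRingHom_apply, map_add]

theorem evalAt_sub : (ξ - ζ).evalAt l = ξ.evalAt l - ζ.evalAt l := by
  simp only [← evalRingHom_apply, map_sub]

theorem evalAt_mul : (ξ * ζ).evalAt l = ξ.evalAt l * ζ.evalAt l := by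
  simp only [← evalRingHom_apply, map_mul]

theorem evalAt_sum {ι : Type*} (s : Finset ι) (f : ι → Loop) :
    (∑ i ∈ s, f i).evalAt l = ∑ i ∈ s, (f i).evalAt l := by
  simp only [← evalRingHom_apply, map_sum]

theorem evalAt_single (k : ℤ) (M : M3) :
    Loop.evalAt (AddMonoidAlgebra.single k M) l = (l : ℂ) ^ k • M := by
  exact Finsupp.sum_single_index (h := fun k m => (l : ℂ) ^ k • m) (smul_zero _)

theorem evalAt_C (M : M3) : Loop.evalAt (LaurentPolynomial.C M) l = M := by
  rw [← LaurentPolynomial.single_eq_C, evalAt_single]; simp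

theorem evalAt_lie : Loop.evalAt ⁅ξ, ζ⁆ l = ⁅ξ.evalAt l, ζ.evalAt l⁆ := by
  simp only [Ring.lie_def, evalAt_sub, evalAt_mul]

variable {ξ}

theorem evalAt_eq_sum {s : Finset ℤ} (hs : ∀ k, k ∉ s → ξ.coeff k = 0) :
    ξ.evalAt l = ∑ k ∈ s, (l : ℂ) ^ k • ξ.coeff k := by
  refine Finsupp.sum_of_support_subset _ (fun k hk => ?_) _ (by simp)
  by_contra h
  exact (Finsupp.mem_support_iff.1 hk) (hs k h)

end Loop

/-- The characters `l ↦ l ^ k` of the circle are linearly independent. -/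
theorem eq_zero_of_sum_zpow_smul_eq_zero {s : Finset ℤ} {c : ℤ → M3}
    (h : ∀ l : Circle, ∑ k ∈ s, (l : ℂ) ^ k • c k = 0) : ∀ k ∈ s, c k = 0 := by
  let χ : ℤ → (Circle →* ℂ) := fun k =>
    { toFun := fun l => (l : ℂ) ^ k
      map_one' := by simp
      map_mul' := fun a b => by rw [Circle.coe_mul, mul_zpow] }
  have hχ : Function.Injective χ := by
    intro a b hab
    by_contra hne
    have hne' : ((a - b : ℤ) : ℝ) ≠ 0 := by exact_mod_cast sub_ne_zero.2 hne
    -- At this point of the circle the `(a - b)`-th power is `-1`, so the two characters differ;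
    -- distinct characters are independent by Dedekind's theorem.
    have h1 : ((Circle.exp (Real.pi / ((a - b : ℤ) : ℝ)) : Circle) : ℂ) ^ a
        = (Circle.exp (Real.pi / ((a - b : ℤ) : ℝ)) : ℂ) ^ b := DFunLike.congr_fun hab _
    have h2 : ((Circle.exp (Real.pi / ((a - b : ℤ) : ℝ)) : Circle) : ℂ) ^ (a - b) = 1 := by
      rw [zpow_sub₀ (Circle.coe_ne_zero _), h1, div_self (zpow_ne_zero _ (Circle.coe_ne_zero _))]
    rw [Circle.coe_exp, ← Complex.exp_int_mul] at h2
    have h3 : ((a - b : ℤ) : ℂ) * (((Real.pi / ((a - b : ℤ) : ℝ) : ℝ) : ℂ) * Complex.I)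
        = Real.pi * Complex.I := by
      have : ((a - b : ℤ) : ℂ) ≠ 0 := by exact_mod_cast sub_ne_zero.2 hne
      push_cast at this ⊢
      field_simp
    rw [h3, Complex.exp_pi_mul_I] at h2
    norm_num at h2
  have hli := (linearIndependent_monoidHom Circle ℂ).comp χ hχ
  rw [linearIndependent_iff'] at hli
  intro k hk
  ext i j
  refine hli s (fun k => c k i j) ?_ k hk
  ext l
  have := congrFun (congrFun (h l) i) j
  simpa [Matrix.sum_apply, mul_comm, χ] using this

theorem Loop.coeff_eq_of_evalAt_eq {ξ ζ : Loop} (h : ∀ l, ξ.evalAt l = ζ.evalAt l) (k : ℤ) :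
    ξ.coeff k = ζ.coeff k := by
  have := eq_zero_of_sum_zpow_smul_eq_zero (s := insert k ((ξ - ζ).coeff.support))
    (c := fun k => (ξ - ζ).coeff k) (fun l => ?_) k (by simp)
  · simpa [sub_eq_zero] using this
  · rw [← Loop.evalAt_eq_sum, Loop.evalAt_sub, h, sub_self]
    intro k hk
    by_contra h0
    exact hk (Finset.mem_insert_of_mem (Finsupp.mem_support_iff.2 h0))

/-! ### Coefficients of loops -/

theorem notMem_Icc_iff_lt_abs {n k : ℤ} : k ∉ Finset.Icc (-n) n ↔ n < |k| := by
  rw [Finset.mem_Icc, ← abs_le, not_le]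

theorem star_circle_zpow (l : Circle) (k : ℤ) : star ((l : ℂ) ^ k) = (l : ℂ) ^ (-k) := by
  rw [star_zpow₀, zpow_neg, ← inv_zpow, ← Circle.coe_inv, Circle.coe_inv_eq_conj]
  rfl

/-- On the circle `star (l ^ k) = l ^ (-k)`, so by uniqueness of Fourier coefficients reality
relates the modes `k` and `-k`. -/
theorem mem_LoopU_iff {n : ℕ} {ξ : Loop} : ξ ∈ LoopU n ↔
    (∀ k : ℤ, (n : ℤ) < |k| → ξ.coeff k = 0) ∧ ∀ k, ξ.coeff (-k) = -(ξ.coeff k)ᴴ := by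
  refine and_congr_right fun hn => ?_
  have hs : ∀ k, k ∉ Finset.Icc (-(n : ℤ)) n → ξ.coeff k = 0 := fun k hk =>
    hn k (notMem_Icc_iff_lt_abs.1 hk)
  have hstar : ∀ l : Circle, (ξ.evalAt l)ᴴ = ∑ k ∈ Finset.Icc (-(n : ℤ)) n,
      (l : ℂ) ^ k • (ξ.coeff (-k))ᴴ := by
    intro l
    rw [Loop.evalAt_eq_sum l hs, Matrix.conjTranspose_sum]
    refine Finset.sum_bij' (fun k _ => -k) (fun k _ => -k) ?_ ?_ ?_ ?_ ?_
    · intro k hk; simp at hk ⊢; omega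
    · intro k hk; simp at hk ⊢; omega
    · simp
    · simp
    · intro k _
      rw [Matrix.conjTranspose_smul, neg_neg, star_circle_zpow]
  constructor
  · intro h k
    by_cases hk : k ∈ Finset.Icc (-(n : ℤ)) n
    · have := eq_zero_of_sum_zpow_smul_eq_zero (s := Finset.Icc (-(n : ℤ)) n)
        (c := fun k => (ξ.coeff (-k))ᴴ + ξ.coeff k) (fun l => ?_) (-k)
        (by simp at hk ⊢; omega)
      · simp only [neg_neg] at this
        exact eq_neg_of_add_eq_zero_right this
      · simp only [smul_add, Finset.sum_add_distrib]
        rw [← hstar, ← Loop.evalAt_eq_sum l hs, h l, neg_add_cancel]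
    · rw [hs k hk, hs (-k)]
      · simp
      · simp at hk ⊢; omega
  · intro h l
    rw [hstar, Loop.evalAt_eq_sum l hs, ← Finset.sum_neg_distrib]
    refine Finset.sum_congr rfl fun k _ => ?_
    rw [h k, Matrix.conjTranspose_neg, Matrix.conjTranspose_conjTranspose, smul_neg]

/-- Replacing `λ` by `iλ` multiplies the `k`-th mode by `i ^ k`, so twisting can be tested on each
coefficient. -/
theorem mem_LoopUTau_iff {n : ℕ} {ξ : Loop} : ξ ∈ LoopUTau n ↔
    ξ ∈ LoopU n ∧ ∀ k, ξ.coeff k ∈ uC k := by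
  refine and_congr_right fun hn => ?_
  have hs : ∀ k, k ∉ Finset.Icc (-(n : ℤ)) n → ξ.coeff k = 0 := fun k hk =>
    hn.1 k (notMem_Icc_iff_lt_abs.1 hk)
  have htau : ∀ l : Circle, tau (ξ.evalAt l) = ∑ k ∈ Finset.Icc (-(n : ℤ)) n,
      (l : ℂ) ^ k • tau (ξ.coeff k) := by
    intro l
    rw [Loop.evalAt_eq_sum l hs, ← tauLin_apply, map_sum]
    simp only [map_smul, tauLin_apply]
  have hI : ∀ l : Circle, ξ.evalAt (circleI * l) = ∑ k ∈ Finset.Icc (-(n : ℤ)) n,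
      (l : ℂ) ^ k • (Complex.I ^ k • ξ.coeff k) := by
    intro l
    rw [Loop.evalAt_eq_sum _ hs]
    refine Finset.sum_congr rfl fun k _ => ?_
    rw [Circle.coe_mul, mul_zpow, smul_smul, mul_comm]
    rfl
  constructor
  · intro h k
    by_cases hk : k ∈ Finset.Icc (-(n : ℤ)) n
    · have := eq_zero_of_sum_zpow_smul_eq_zero (s := Finset.Icc (-(n : ℤ)) n)
        (c := fun k => tau (ξ.coeff k) - Complex.I ^ k • ξ.coeff k) (fun l => ?_) k hk
      · exact sub_eq_zero.1 this
      · simp only [smul_sub, Finset.sum_sub_distrib]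
        rw [← htau, ← hI, h l, sub_self]
    · rw [hs k hk]
      change tau _ = _
      rw [smul_zero]
      exact tauLin.map_zero
  · intro h l
    rw [htau, hI]
    exact Finset.sum_congr rfl fun k _ => by rw [show tau _ = _ from h k]

theorem coeff_conj (a b : M3) (ξ : Loop) (k : ℤ) :
    (LaurentPolynomial.C a * ξ * LaurentPolynomial.C b).coeff k = a * ξ.coeff k * b := by
  rw [← LaurentPolynomial.single_eq_C, ← LaurentPolynomial.single_eq_C,
    AddMonoidAlgebra.coeff_mul_single_zero, AddMonoidAlgebra.coeff_single_zero_mul]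

theorem evalAt_conj (a b : M3) (ξ : Loop) (l : Circle) :
    Loop.evalAt (LaurentPolynomial.C a * ξ * LaurentPolynomial.C b) l = a * ξ.evalAt l * b := by
  rw [Loop.evalAt_mul, Loop.evalAt_mul, Loop.evalAt_C, Loop.evalAt_C]

/-- Conjugation by a unitary matrix preserves `Λ^n u(3)`. -/
theorem conj_mem_LoopU {n : ℕ} {ξ : Loop} (h : ξ ∈ LoopU n) (g : M3) :
    LaurentPolynomial.C gᴴ * ξ * LaurentPolynomial.C g ∈ LoopU n := by
  refine ⟨fun k hk => by rw [coeff_conj, h.1 k hk]; simp, fun l => ?_⟩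
  rw [evalAt_conj, Matrix.conjTranspose_mul, Matrix.conjTranspose_mul, h.2,
    Matrix.conjTranspose_conjTranspose]
  simp [mul_assoc]

theorem conj_mem_LoopUTau {n : ℕ} {ξ : Loop} (h : ξ ∈ LoopUTau n) {g : M3} (hg : g ∈ U30) :
    LaurentPolynomial.C g⁻¹ * ξ * LaurentPolynomial.C g ∈ LoopUTau n := by
  rw [mem_LoopUTau_iff] at h ⊢
  refine ⟨?_, fun k => ?_⟩
  · rw [U30_inv hg]; exact conj_mem_LoopU h.1 g
  · rw [coeff_conj]; exact conj_mem_uC hg (h.2 k)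

theorem coeff_shifted (p : ℕ) (ξ : Loop) (v : ℂ) (k : ℤ) :
    (shifted p ξ v).coeff k = v • ξ.coeff (k - 4 * p) := by
  rw [shifted, LaurentPolynomial.T_mul, AddMonoidAlgebra.coeff_smul_apply]
  have := AddMonoidAlgebra.coeff_mul_single_add ξ (1 : M3) (4 * (p : ℤ)) (k - 4 * p)
  rw [sub_add_cancel, mul_one] at this
  rw [← this]
  rfl

/-- Multiplication by `λ^{4p}` leaves only `-2` and `-1` as possible negative modes; this frees both
projections from the dependence on the support. -/
theorem sum_support_neg {X : Loop} (h : ∀ k, k < -2 → X.coeff k = 0) {A : Type*} [AddCommMonoid A]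
    (f : ℤ → A) (hf : ∀ k, X.coeff k = 0 → f k = 0) :
    ∑ k ∈ X.coeff.support with k < 0, f k = f (-2) + f (-1) := by
  rw [← Finset.sum_pair (show (-2 : ℤ) ≠ -1 by norm_num)]
  refine Finset.sum_subset (fun k hk => ?_) fun k hk hk' => ?_
  · simp only [Finset.mem_filter, Finsupp.mem_support_iff] at hk
    have : ¬ k < -2 := fun h' => hk.1 (h k h')
    simp only [Finset.mem_insert, Finset.mem_singleton]
    omega
  · apply hf
    by_contra h0
    refine hk' (Finset.mem_filter.2 ⟨Finsupp.mem_support_iff.2 h0, ?_⟩)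
    simp only [Finset.mem_insert, Finset.mem_singleton] at hk
    omega

theorem evalAt_projSu {X : Loop} (h : ∀ k, k < -2 → X.coeff k = 0) (l : Circle) :
    X.projSu.evalAt l = (l : ℂ) ^ (-2 : ℤ) • X.coeff (-2) + (l : ℂ) ^ (-1 : ℤ) • X.coeff (-1)
      + suPart (X.coeff 0) - (l : ℂ) • (X.coeff (-1))ᴴ - (l : ℂ) ^ 2 • (X.coeff (-2))ᴴ := by
  rw [Loop.projSu, sum_support_neg h _ (fun k hk => by simp [hk])]
  simp only [Loop.evalAt_add, Loop.evalAt_sub, Loop.evalAt_C, Loop.evalAt_single, neg_neg]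
  norm_cast
  simp only [pow_one]
  abel

theorem evalAt_projBased {X : Loop} (h : ∀ k, k < -2 → X.coeff k = 0) (l : Circle) :
    X.projBased.evalAt l = (l : ℂ) ^ (-2 : ℤ) • X.coeff (-2) + (l : ℂ) ^ (-1 : ℤ) • X.coeff (-1)
      - (l : ℂ) • (X.coeff (-1))ᴴ - (l : ℂ) ^ 2 • (X.coeff (-2))ᴴ
      - (X.coeff (-2) + X.coeff (-1) - (X.coeff (-1))ᴴ - (X.coeff (-2))ᴴ) := by
  rw [Loop.projBased, sum_support_neg h _ (fun k hk => by simp [hk])]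
  simp only [Loop.evalAt_add, Loop.evalAt_sub, Loop.evalAt_C, Loop.evalAt_single, neg_neg]
  norm_cast
  simp only [pow_one]
  abel

theorem coeff_shifted_eq_zero {p : ℕ} {ξ : Loop} (h : ξ ∈ LoopU (2 + 4 * p)) (v : ℂ) :
    ∀ k, k < -2 → (shifted p ξ v).coeff k = 0 := by
  intro k hk
  rw [coeff_shifted, h.1, smul_zero]
  rw [lt_abs]
  right
  push_cast
  omega

end

section

/-! ### Derivatives of matrix valued maps -/

theorem hasFDerivAt_matrix_mul {X Y : ℂ → M3} {X' Y' : ℂ →L[ℝ] M3} {z : ℂ}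
    (hX : HasFDerivAt X X' z) (hY : HasFDerivAt Y Y' z) :
    HasFDerivAt (fun w => X w * Y w) (X z • Y' + MulOpposite.op (Y z) • X') z :=
  hX.mul' hY

theorem fderiv_matrix_mul {X Y : ℂ → M3} {z : ℂ} (hX : DifferentiableAt ℝ X z)
    (hY : DifferentiableAt ℝ Y z) (v : ℂ) :
    fderiv ℝ (fun w => X w * Y w) z v = X z * fderiv ℝ Y z v + fderiv ℝ X z v * Y z := by
  rw [(hasFDerivAt_matrix_mul hX.hasFDerivAt hY.hasFDerivAt).fderiv]
  simp

theorem hasFDerivAt_matrix_inv {X : ℂ → M3} {z : ℂ} (hX : DifferentiableAt ℝ X z)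
    (hu : IsUnit (X z).det) :
    DifferentiableAt ℝ (fun w => (X w)⁻¹) z ∧
      ∀ v, fderiv ℝ (fun w => (X w)⁻¹) z v = -((X z)⁻¹ * fderiv ℝ X z v * (X z)⁻¹) := by
  obtain ⟨u, hu'⟩ := (Matrix.isUnit_iff_isUnit_det _).2 hu
  have hinv : HasFDerivAt Ring.inverse (-ContinuousLinearMap.mulLeftRight ℝ M3 ↑u⁻¹ ↑u⁻¹) (X z) := by
    rw [← hu']; exact hasFDerivAt_ringInverse (𝕜 := ℝ) u
  have h : HasFDerivAt (Ring.inverse ∘ X)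
      ((-ContinuousLinearMap.mulLeftRight ℝ M3 ↑u⁻¹ ↑u⁻¹ : M3 →L[ℝ] M3) ∘L fderiv ℝ X z) z :=
    hinv.comp z hX.hasFDerivAt
  have hfun : (fun w => (X w)⁻¹) = Ring.inverse ∘ X := by
    ext1 w; simp [Matrix.nonsing_inv_eq_ringInverse]
  have huinv : ((u⁻¹ : M3ˣ) : M3) = (X z)⁻¹ := by
    rw [Matrix.nonsing_inv_eq_ringInverse, ← hu', Ring.inverse_unit]
  rw [hfun]
  refine ⟨h.differentiableAt, fun v => ?_⟩
  rw [h.fderiv, huinv]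
  rfl

theorem contDiffOn_matrix_inv {Ω : Set ℂ} {X : ℂ → M3} (hX : ContDiffOn ℝ ∞ X Ω)
    (hu : ∀ z ∈ Ω, IsUnit (X z).det) : ContDiffOn ℝ ∞ (fun w => (X w)⁻¹) Ω := by
  have hfun : (fun w => (X w)⁻¹) = Ring.inverse ∘ X := by
    ext1 w; simp [Matrix.nonsing_inv_eq_ringInverse]
  rw [hfun]
  intro z hz
  obtain ⟨u, hu'⟩ := (Matrix.isUnit_iff_isUnit_det _).2 (hu z hz)
  refine ContDiffAt.comp_contDiffWithinAt z ?_ (hX z hz)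
  rw [← hu']
  exact contDiffAt_ringInverse ℝ u

theorem fderiv_linear_comp (L : M3 →ₗ[ℝ] M3) {X : ℂ → M3} {z : ℂ} (hX : DifferentiableAt ℝ X z)
    (v : ℂ) : fderiv ℝ (fun w => L (X w)) z v = L (fderiv ℝ X z v) := by
  have := (LinearMap.toContinuousLinearMap L).hasFDerivAt.comp z hX.hasFDerivAt
  exact congrArg (fun T : ℂ →L[ℝ] M3 => T v) this.fderiv

theorem contDiffOn_linear_comp (L : M3 →ₗ[ℝ] M3) {X : ℂ → M3} {Ω : Set ℂ}
    (hX : ContDiffOn ℝ ∞ X Ω) : ContDiffOn ℝ ∞ (fun w => L (X w)) Ω :=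
  (LinearMap.toContinuousLinearMap L).contDiff.comp_contDiffOn hX

/-- The conjugate transpose as a real linear map. -/
def conjTransposeLin : M3 →ₗ[ℝ] M3 where
  toFun := Matrix.conjTranspose
  map_add' := Matrix.conjTranspose_add
  map_smul' c M := by simp [Matrix.conjTranspose_smul]

/-- The transpose as a real linear map. -/
def transposeLin : M3 →ₗ[ℝ] M3 where
  toFun := Matrix.transpose
  map_add' := Matrix.transpose_add
  map_smul' c M := Matrix.transpose_smul c M

/-- An entry of a matrix as a real linear map. -/
def entryLin (i j : Fin 3) : M3 →ₗ[ℝ] ℂ where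
  toFun M := M i j
  map_add' _ _ := rfl
  map_smul' _ _ := rfl

variable {Ω : Set ℂ}

theorem differentiableAt_of_smooth {E : Type*} [NormedAddCommGroup E] [NormedSpace ℝ E]
    {X : ℂ → E} (hΩ : IsOpen Ω) (hX : ContDiffOn ℝ ∞ X Ω) {z : ℂ} (hz : z ∈ Ω) :
    DifferentiableAt ℝ X z :=
  (hX.contDiffAt (hΩ.mem_nhds hz)).differentiableAt (by simp)

theorem contDiffOn_fderiv_apply {E : Type*} [NormedAddCommGroup E] [NormedSpace ℝ E]
    {X : ℂ → E} (hΩ : IsOpen Ω) (hX : ContDiffOn ℝ ∞ X Ω) (v : ℂ) :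
    ContDiffOn ℝ ∞ (fun w => fderiv ℝ X w v) Ω :=
  ((contDiffOn_infty_iff_fderiv_of_isOpen hΩ).1 hX).2.clm_apply contDiffOn_const

theorem fderiv_fderiv_apply_comm {E : Type*} [NormedAddCommGroup E] [NormedSpace ℝ E]
    {X : ℂ → E} (hΩ : IsOpen Ω) (hX : ContDiffOn ℝ ∞ X Ω) {z : ℂ} (hz : z ∈ Ω) (u v : ℂ) :
    fderiv ℝ (fun w => fderiv ℝ X w v) z u = fderiv ℝ (fun w => fderiv ℝ X w u) z v := by
  have hd2 : DifferentiableAt ℝ (fderiv ℝ X) z := differentiableAt_of_smooth hΩ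
    ((contDiffOn_infty_iff_fderiv_of_isOpen hΩ).1 hX).2 hz
  have hdv' : ∀ u v, fderiv ℝ (fun w => fderiv ℝ X w v) z u = fderiv ℝ (fderiv ℝ X) z u v := by
    intro u v
    rw [fderiv_clm_apply hd2 (differentiableAt_const v)]
    simp
  rw [hdv', hdv']
  exact ((hX.contDiffAt (hΩ.mem_nhds hz)).isSymmSndFDerivAt
    (by simpa using (by norm_cast : (2 : WithTop ℕ∞) ≤ ∞))) u v

theorem unitary_inv {g : M3} (h : g ∈ Matrix.unitaryGroup (Fin 3) ℂ) : g⁻¹ = gᴴ :=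
  Matrix.inv_eq_left_inv (Matrix.mem_unitaryGroup_iff'.1 h)

theorem unitary_isUnit_det {g : M3} (h : g ∈ Matrix.unitaryGroup (Fin 3) ℂ) : IsUnit g.det :=
  Matrix.isUnit_det_of_left_inverse (Matrix.mem_unitaryGroup_iff'.1 h)

/-! ### Maurer-Cartan forms -/

theorem mc_congr {f g : ℂ → M3} (hΩ : IsOpen Ω) (h : ∀ z ∈ Ω, f z = g z) {z : ℂ} (hz : z ∈ Ω)
    (v : ℂ) : mc f z v = mc g z v := by
  have : f =ᶠ[𝓝 z] g := by filter_upwards [hΩ.mem_nhds hz] with w hw using h w hw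
  rw [mc, mc, this.fderiv_eq, h z hz]

theorem mc_mul {X G : ℂ → M3} {z : ℂ} (hX : DifferentiableAt ℝ X z) (hG : DifferentiableAt ℝ G z)
    (hu : IsUnit (X z).det) (v : ℂ) :
    mc (fun w => X w * G w) z v = (G z)⁻¹ * mc X z v * G z + (G z)⁻¹ * fderiv ℝ G z v := by
  simp only [mc]
  rw [fderiv_matrix_mul hX hG, Matrix.mul_inv_rev, mul_add, add_comm]
  congr 1
  · simp only [mul_assoc]
  · rw [mul_assoc, ← mul_assoc _ (X z), Matrix.nonsing_inv_mul _ hu, one_mul]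

theorem mc_gaugeF {F : Circle → ℂ → M3} {G : ℂ → M3} {l : Circle} {z : ℂ}
    (hX : DifferentiableAt ℝ (F l) z) (hG : DifferentiableAt ℝ G z)
    (hu : IsUnit (F l z).det) (v : ℂ) :
    mc (gaugeF F G l) z v = gaugeA (fun m => mc (F m)) G l z v :=
  mc_mul hX hG hu v

theorem fderiv_conj {X G : ℂ → M3} {z : ℂ} (hX : DifferentiableAt ℝ X z)
    (hG : DifferentiableAt ℝ G z) (hu : IsUnit (G z).det) (v : ℂ) :
    fderiv ℝ (fun w => (G w)⁻¹ * X w * G w) z v =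
      (G z)⁻¹ * fderiv ℝ X z v * G z + ⁅(G z)⁻¹ * X z * G z, (G z)⁻¹ * fderiv ℝ G z v⁆ := by
  obtain ⟨h1, h2⟩ := hasFDerivAt_matrix_inv hG hu
  have h3 : DifferentiableAt ℝ (fun w => (G w)⁻¹ * X w) z := h1.mul hX
  rw [fderiv_matrix_mul h3 hG, fderiv_matrix_mul h1 hX, h2, Ring.lie_def]
  have e : (G z)⁻¹ * X z * G z * ((G z)⁻¹ * fderiv ℝ G z v) = (G z)⁻¹ * X z * fderiv ℝ G z v := by
    rw [mul_assoc _ (G z), ← mul_assoc (G z), Matrix.mul_nonsing_inv _ hu, one_mul]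
  rw [e]
  simp only [add_mul, neg_mul, mul_assoc]
  abel

/-- The structure equation `dA + A ∧ A = 0` of a Maurer-Cartan form. -/
theorem mc_structure {f : ℂ → M3} (hΩ : IsOpen Ω) (hf : ContDiffOn ℝ ∞ f Ω)
    (hu : ∀ z ∈ Ω, IsUnit (f z).det) {z : ℂ} (hz : z ∈ Ω) (u v : ℂ) :
    fderiv ℝ (fun w => mc f w v) z u - fderiv ℝ (fun w => mc f w u) z v
      + ⁅mc f z u, mc f z v⁆ = 0 := by
  have hfz := differentiableAt_of_smooth hΩ hf hz
  have hdv : ∀ v, DifferentiableAt ℝ (fun w => fderiv ℝ f w v) z := fun v =>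
    differentiableAt_of_smooth hΩ (contDiffOn_fderiv_apply hΩ hf v) hz
  have hsymm : fderiv ℝ (fun w => fderiv ℝ f w v) z u = fderiv ℝ (fun w => fderiv ℝ f w u) z v :=
    fderiv_fderiv_apply_comm hΩ hf hz u v
  obtain ⟨h1, h2⟩ := hasFDerivAt_matrix_inv hfz (hu z hz)
  simp only [mc]
  rw [fderiv_matrix_mul h1 (hdv v), fderiv_matrix_mul h1 (hdv u), h2, h2, hsymm,
    Ring.lie_def]
  simp only [neg_mul, mul_assoc]
  abel

theorem contDiffOn_mc {f : ℂ → M3} (hΩ : IsOpen Ω) (hf : ContDiffOn ℝ ∞ f Ω)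
    (hu : ∀ z ∈ Ω, IsUnit (f z).det) (v : ℂ) : ContDiffOn ℝ ∞ (fun w => mc f w v) Ω := by
  exact (contDiffOn_matrix_inv hf hu).mul (contDiffOn_fderiv_apply hΩ hf v)

theorem mc_conjTranspose {f : ℂ → M3} (hΩ : IsOpen Ω) (hf : ContDiffOn ℝ ∞ f Ω)
    (hu : ∀ z ∈ Ω, f z ∈ Matrix.unitaryGroup (Fin 3) ℂ) {z : ℂ} (hz : z ∈ Ω) (v : ℂ) :
    (mc f z v)ᴴ = -mc f z v := by
  have hfz := differentiableAt_of_smooth hΩ hf hz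
  have hfh : DifferentiableAt ℝ (fun w => (f w)ᴴ) z :=
    differentiableAt_of_smooth hΩ (contDiffOn_linear_comp conjTransposeLin hf) hz
  have h1 : (fun w => (f w)ᴴ * f w) =ᶠ[𝓝 z] fun _ => 1 := by
    filter_upwards [hΩ.mem_nhds hz] with w hw
    exact Matrix.mem_unitaryGroup_iff'.1 (hu w hw)
  have h2 := congrArg (fun T : ℂ →L[ℝ] M3 => T v) h1.fderiv_eq
  simp only [fderiv_matrix_mul hfh hfz, fderiv_fun_const, Pi.zero_apply, zero_apply] at h2
  have h3 : fderiv ℝ (fun w => (f w)ᴴ) z v = (fderiv ℝ f z v)ᴴ :=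
    fderiv_linear_comp conjTransposeLin hfz v
  rw [h3] at h2
  rw [mc, unitary_inv (hu z hz), Matrix.conjTranspose_mul, Matrix.conjTranspose_conjTranspose]
  exact eq_neg_of_add_eq_zero_right h2

/-- Differentiate the relation `Gᵀ Jp G = Jp`. -/
theorem mc_gauge_mem {G : ℂ → M3} (hΩ : IsOpen Ω) (hG : IsGauge Ω G) {z : ℂ} (hz : z ∈ Ω) (v : ℂ) :
    (G z)⁻¹ * fderiv ℝ G z v ∈ uC 0 := by
  have hfz := differentiableAt_of_smooth hΩ hG.1 hz
  have hft : DifferentiableAt ℝ (fun w => (G w)ᵀ) z :=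
    differentiableAt_of_smooth hΩ (contDiffOn_linear_comp transposeLin hG.1) hz
  have h1 : (fun w => (G w)ᵀ * Jp * G w) =ᶠ[𝓝 z] fun _ => Jp := by
    filter_upwards [hΩ.mem_nhds hz] with w hw
    exact U30_transpose_mul (hG.2 w hw)
  have h2 := congrArg (fun T : ℂ →L[ℝ] M3 => T v) h1.fderiv_eq
  have hc : DifferentiableAt ℝ (fun _ : ℂ => Jp) z := differentiableAt_const _
  have hftc : DifferentiableAt ℝ (fun w => (G w)ᵀ * Jp) z := hft.mul hc
  simp only [fderiv_matrix_mul hftc hfz, fderiv_matrix_mul hft hc, fderiv_fun_const,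
    Pi.zero_apply, zero_apply, mul_zero, zero_add] at h2
  have h3 : fderiv ℝ (fun w => (G w)ᵀ) z v = (fderiv ℝ G z v)ᵀ :=
    fderiv_linear_comp transposeLin hfz v
  rw [h3] at h2
  have hu := U30_isUnit_det (hG.2 z hz)
  set M := (G z)⁻¹ * fderiv ℝ G z v with hM
  have hdG : fderiv ℝ G z v = G z * M := by
    rw [hM, ← mul_assoc, Matrix.mul_nonsing_inv _ hu, one_mul]
  rw [hdG, Matrix.transpose_mul, mul_assoc, mul_assoc, ← mul_assoc Jp, ← mul_assoc (G z)ᵀ,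
    ← mul_assoc (G z)ᵀ, mul_assoc Mᵀ, ← mul_assoc (G z)ᵀ, U30_transpose_mul (hG.2 z hz)] at h2
  change tau M = _
  rw [zpow_zero, one_smul, tau, mul_assoc, ← mul_neg, ← eq_neg_of_add_eq_zero_left h2, ← mul_assoc,
    Jm_mul_Jp, one_mul]

end

section

variable {Ω : Set ℂ}

/-! ### The commutator bracket of a ring -/

theorem ring_add_lie {R : Type*} [Ring R] (x y z : R) : ⁅x + y, z⁆ = ⁅x, z⁆ + ⁅y, z⁆ := by
  simp only [Ring.lie_def]; noncomm_ring

theorem ring_lie_add {R : Type*} [Ring R] (x y z : R) : ⁅x, y + z⁆ = ⁅x, y⁆ + ⁅x, z⁆ := by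
  simp only [Ring.lie_def]; noncomm_ring

theorem ring_lie_skew {R : Type*} [Ring R] (x y : R) : -⁅y, x⁆ = ⁅x, y⁆ := by
  simp only [Ring.lie_def]; noncomm_ring

/-! ### Loop valued maps -/

theorem evalAt_eq_sum_of_mem {n : ℕ} {ξ : Loop} (h : ξ ∈ LoopU n) (l : Circle) :
    ξ.evalAt l = ∑ k ∈ Finset.Icc (-(n : ℤ)) n, (l : ℂ) ^ k • ξ.coeff k :=
  Loop.evalAt_eq_sum l fun k hk => h.1 k (notMem_Icc_iff_lt_abs.1 hk)

theorem hasFDerivAt_evalAt {n : ℕ} {ξ : ℂ → Loop} (hΩ : IsOpen Ω) (hξ : ∀ z ∈ Ω, ξ z ∈ LoopU n)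
    (hs : SmoothLoop Ω ξ) {z : ℂ} (hz : z ∈ Ω) (l : Circle) :
    HasFDerivAt (fun w => (ξ w).evalAt l) (∑ k ∈ Finset.Icc (-(n : ℤ)) n,
      (l : ℂ) ^ k • fderiv ℝ (fun w => (ξ w).coeff k) z) z := by
  have h1 : HasFDerivAt (fun w => ∑ k ∈ Finset.Icc (-(n : ℤ)) n, (l : ℂ) ^ k • (ξ w).coeff k)
      (∑ k ∈ Finset.Icc (-(n : ℤ)) n, (l : ℂ) ^ k • fderiv ℝ (fun w => (ξ w).coeff k) z) z :=
    HasFDerivAt.fun_sum fun k _ =>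
      (differentiableAt_of_smooth hΩ (hs k) hz).hasFDerivAt.const_smul ((l : ℂ) ^ k)
  refine h1.congr_of_eventuallyEq ?_
  filter_upwards [hΩ.mem_nhds hz] with w hw using evalAt_eq_sum_of_mem (hξ w hw) l

/-- An equation `dξ_λ = [ξ_λ, A_λ]` on the circle is an equation between Fourier coefficients. -/
theorem fderiv_coeff_eq_of_lax {n : ℕ} {ξ : ℂ → Loop} (hΩ : IsOpen Ω) (hξ : ∀ z ∈ Ω, ξ z ∈ LoopU n)
    (hs : SmoothLoop Ω ξ) {z : ℂ} (hz : z ∈ Ω) {v : ℂ} {A : Loop}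
    (h : ∀ l, fderiv ℝ (fun w => (ξ w).evalAt l) z v = ⁅(ξ z).evalAt l, A.evalAt l⁆) (k : ℤ) :
    fderiv ℝ (fun w => (ξ w).coeff k) z v = (⁅ξ z, A⁆ : Loop).coeff k := by
  -- `D` collects the derivatives of the coefficients into a single loop, to be compared with the
  -- bracket at every point of the circle.
  let D : Loop := ∑ k ∈ Finset.Icc (-(n : ℤ)) n,
    AddMonoidAlgebra.single k (fderiv ℝ (fun w => (ξ w).coeff k) z v)
  have hD : ∀ l, D.evalAt l = (⁅ξ z, A⁆ : Loop).evalAt l := by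
    intro l
    rw [Loop.evalAt_lie, ← h l, (hasFDerivAt_evalAt hΩ hξ hs hz l).fderiv, Loop.evalAt_sum]
    simp only [Loop.evalAt_single]
    simp
  rw [← Loop.coeff_eq_of_evalAt_eq hD k]
  simp only [D, AddMonoidAlgebra.coeff_sum, Finsupp.finsetSum_apply,
    AddMonoidAlgebra.coeff_single, Finsupp.single_apply]
  rw [Finset.sum_ite_eq']
  split_ifs with hk
  · rfl
  · have : (fun w => (ξ w).coeff k) =ᶠ[𝓝 z] fun _ => 0 := by
      filter_upwards [hΩ.mem_nhds hz] with w hw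
      exact (hξ w hw).1 k (notMem_Icc_iff_lt_abs.1 hk)
    rw [this.fderiv_eq]
    simp

theorem smoothLoop_gaugeLoop {ξ : ℂ → Loop} {G : ℂ → M3} (hs : SmoothLoop Ω ξ)
    (hG : ContDiffOn ℝ ∞ G Ω) (hu : ∀ z ∈ Ω, IsUnit (G z).det) :
    SmoothLoop Ω (gaugeLoop ξ G) := by
  intro k
  simp only [gaugeLoop, coeff_conj]
  exact ((contDiffOn_matrix_inv hG hu).mul (hs k)).mul hG

theorem evalAt_gaugeLoop (ξ : ℂ → Loop) (G : ℂ → M3) (z : ℂ) (l : Circle) :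
    (gaugeLoop ξ G z).evalAt l = (G z)⁻¹ * (ξ z).evalAt l * G z := evalAt_conj _ _ _ _

theorem coeff_gaugeLoop (ξ : ℂ → Loop) (G : ℂ → M3) (z : ℂ) (k : ℤ) :
    (gaugeLoop ξ G z).coeff k = (G z)⁻¹ * (ξ z).coeff k * G z := coeff_conj _ _ _ _

theorem conj_lie {g : M3} (hu : IsUnit g.det) (X Y : M3) :
    g⁻¹ * ⁅X, Y⁆ * g = ⁅g⁻¹ * X * g, g⁻¹ * Y * g⁆ := by
  have e : ∀ X Y : M3, g⁻¹ * X * g * (g⁻¹ * Y * g) = g⁻¹ * (X * Y) * g := fun X Y => by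
    rw [mul_assoc _ g, ← mul_assoc g, ← mul_assoc g, Matrix.mul_nonsing_inv _ hu, one_mul]
    simp only [mul_assoc]
  rw [Ring.lie_def, Ring.lie_def, e, e, mul_sub, sub_mul]

/-- Gauge covariance of the Lax operator. -/
theorem lax_gauge {n : ℕ} {ξ : ℂ → Loop} {G : ℂ → M3} {A : Circle → ℂ → ℂ → M3} (hΩ : IsOpen Ω)
    (hξ : ∀ z ∈ Ω, ξ z ∈ LoopU n) (hs : SmoothLoop Ω ξ) (hG : ContDiffOn ℝ ∞ G Ω)
    (hu : ∀ z ∈ Ω, IsUnit (G z).det) (l : Circle) {z : ℂ} (hz : z ∈ Ω) (v : ℂ) :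
    fderiv ℝ (fun w => (gaugeLoop ξ G w).evalAt l) z v
        + ⁅gaugeA A G l z v, (gaugeLoop ξ G z).evalAt l⁆
      = (G z)⁻¹ * (fderiv ℝ (fun w => (ξ w).evalAt l) z v + ⁅A l z v, (ξ z).evalAt l⁆) * G z := by
  simp only [evalAt_gaugeLoop, gaugeA]
  rw [fderiv_conj (hasFDerivAt_evalAt hΩ hξ hs hz l).differentiableAt
    (differentiableAt_of_smooth hΩ hG hz) (hu z hz), mul_add, add_mul, conj_lie (hu z hz), ring_add_lie,
    ← ring_lie_skew ((G z)⁻¹ * (ξ z).evalAt l * G z)]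
  abel

theorem lax_gauge_of_lax {n : ℕ} {ξ : ℂ → Loop} {G : ℂ → M3} {A : Circle → ℂ → ℂ → M3}
    (hΩ : IsOpen Ω) (hξ : ∀ z ∈ Ω, ξ z ∈ LoopU n) (hs : SmoothLoop Ω ξ)
    (hG : ContDiffOn ℝ ∞ G Ω) (hu : ∀ z ∈ Ω, IsUnit (G z).det) (h : Lax Ω ξ A) :
    Lax Ω (gaugeLoop ξ G) (gaugeA A G) := by
  intro l z hz v
  have h1 := lax_gauge (A := A) hΩ hξ hs hG hu l hz v
  rw [h l z hz v, ← ring_lie_skew ((ξ z).evalAt l), neg_add_cancel, mul_zero, zero_mul] at h1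
  rw [eq_neg_of_add_eq_zero_left h1, ring_lie_skew]

/-! ### Families and their gauge transforms -/

/-- The deformed Maurer-Cartan form as a loop. -/
def deformLoop (A : ℂ → M3) (v : ℂ) : Loop :=
  AddMonoidAlgebra.single (-2) (part10 (fun w => tauComp 2 (A w)) v)
    + AddMonoidAlgebra.single (-1) (tauComp (-1) (A v))
    + AddMonoidAlgebra.single 0 (tauComp 0 (A v))
    + AddMonoidAlgebra.single 1 (tauComp 1 (A v))
    + AddMonoidAlgebra.single 2 (part01 (fun w => tauComp 2 (A w)) v)

theorem evalAt_deformLoop (A : ℂ → M3) (l : Circle) (v : ℂ) :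
    (deformLoop A v).evalAt l = deform A l v := by
  simp only [deformLoop, Loop.evalAt_add, Loop.evalAt_single, deform, zpow_zero, one_smul, zpow_one]
  norm_cast

theorem coeff_lie_deformLoop (ξ : Loop) (A : ℂ → M3) (v : ℂ) (k : ℤ) :
    (⁅ξ, deformLoop A v⁆ : Loop).coeff k =
      ⁅ξ.coeff (k + 2), part10 (fun w => tauComp 2 (A w)) v⁆
      + ⁅ξ.coeff (k + 1), tauComp (-1) (A v)⁆ + ⁅ξ.coeff k, tauComp 0 (A v)⁆
      + ⁅ξ.coeff (k - 1), tauComp 1 (A v)⁆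
      + ⁅ξ.coeff (k - 2), part01 (fun w => tauComp 2 (A w)) v⁆ := by
  have e : ∀ (j : ℤ) (M : M3), (⁅ξ, (AddMonoidAlgebra.single j M : Loop)⁆ : Loop).coeff k
      = ⁅ξ.coeff (k - j), M⁆ := by
    intro j M
    have h1 := AddMonoidAlgebra.coeff_mul_single_add ξ M j (k - j)
    have h2 := AddMonoidAlgebra.coeff_single_mul_add ξ M j (k - j)
    rw [sub_add_cancel] at h1
    rw [add_sub_cancel] at h2
    rw [Ring.lie_def, Ring.lie_def, ← h1, ← h2]
    simp
  simp only [deformLoop, ring_lie_add, AddMonoidAlgebra.coeff_add, Finsupp.add_apply, e]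
  simp only [sub_neg_eq_add, sub_zero]

theorem IsFamily.isUnit_det {F : Circle → ℂ → M3} (hF : IsFamily Ω F) (l : Circle) {z : ℂ}
    (hz : z ∈ Ω) : IsUnit (F l z).det := unitary_isUnit_det (hF.unitary l z hz)

theorem IsGauge.isUnit_det {G : ℂ → M3} (hG : IsGauge Ω G) : ∀ z ∈ Ω, IsUnit (G z).det :=
  fun z hz => U30_isUnit_det (hG.2 z hz)

theorem IsFamily.mc_gaugeF {F : Circle → ℂ → M3} (hF : IsFamily Ω F) (hΩ : IsOpen Ω) {G : ℂ → M3}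
    (hG : ContDiffOn ℝ ∞ G Ω) (l : Circle) {z : ℂ} (hz : z ∈ Ω) (v : ℂ) :
    mc (gaugeF F G l) z v = gaugeA (fun m => mc (F m)) G l z v :=
  HamStat.mc_gaugeF (differentiableAt_of_smooth hΩ (hF.smooth l) hz)
    (differentiableAt_of_smooth hΩ hG hz) (hF.isUnit_det l hz) v

/-- `B` meets only the mode `λ⁰`, and conjugation respects the degrees, so deforming commutes with
gauging. -/
theorem deform_gauge {g : M3} (hg : g ∈ U30) (A B : ℂ → M3) (hB : ∀ v, B v ∈ uC 0) (l : Circle)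
    (v : ℂ) : deform (fun v => g⁻¹ * A v * g + B v) l v = g⁻¹ * deform A l v * g + B v := by
  have h0 : ∀ w, tauComp 0 (B w) = B w := fun w => tauComp_of_mem (hB w)
  have h1 : ∀ w, tauComp 1 (B w) = 0 := fun w => tauComp_of_mem_of_ne (hB w) (by norm_num)
  have h2 : ∀ w, tauComp 2 (B w) = 0 := fun w => tauComp_of_mem_of_ne (hB w) (by norm_num)
  have h3 : ∀ w, tauComp (-1) (B w) = 0 := fun w => tauComp_of_mem_of_ne (hB w) (by norm_num)
  simp only [deform, part10, part01, tauComp_add, tauComp_conj hg, h0, h1, h2, h3, add_zero,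
    mul_add, add_mul, mul_sub, sub_mul, Matrix.mul_smul, Matrix.smul_mul]
  abel

/-- Elements `diag(g, 1)` with `det g = 1` change neither the last column nor the determinant, so
the immersion and its lift stay the same. -/
theorem IsFamily.gauge {F : Circle → ℂ → M3} (hF : IsFamily Ω F) (hΩ : IsOpen Ω) {G : ℂ → M3}
    (hG : IsGauge Ω G) : IsFamily Ω (gaugeF F G) where
  smooth l := (hF.smooth l).mul hG.1
  unitary l z hz := mul_mem (hF.unitary l z hz) (hG.2 z hz).1
  twisted l z hz := by
    rw [gaugeF, tauGrp_mul, hF.twisted l z hz, (hG.2 z hz).2.1]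
    rfl
  framing := by
    obtain ⟨u, h1, h2, h3⟩ := hF.framing
    refine ⟨u, h1, h2, ⟨h3.smooth.mul hG.1, fun z hz => mul_mem (h3.unitary z hz) (hG.2 z hz).1,
      fun z hz i => ?_, fun z hz => ?_⟩⟩
    · rw [← h3.column z hz i, gaugeF, Matrix.mul_apply]
      simp only [U30_apply_two (hG.2 z hz)]
      rw [← Matrix.mul_apply, mul_one]
    · rw [gaugeF, Matrix.det_mul, U30_det (hG.2 z hz), mul_one, h3.det z hz]
  deformation l z hz v := by
    have h : ∀ l, mc (gaugeF F G l) z = gaugeA (fun m => mc (F m)) G l z := fun l =>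
      funext fun w => hF.mc_gaugeF hΩ hG.1 l hz w
    rw [h, h]
    have e : gaugeA (fun m => mc (F m)) G 1 z =
        fun v => (G z)⁻¹ * mc (F 1) z v * G z + (G z)⁻¹ * fderiv ℝ G z v := rfl
    rw [e, deform_gauge (hG.2 z hz) _ _ (fun v => mc_gauge_mem hΩ hG hz v), ← hF.deformation l z hz]
    rfl

end

section

variable {Ω : Set ℂ} {F : Circle → ℂ → M3}

/-! ### Loops with modes between `-2` and `2` -/

/-- The loop `λ⁻² a + λ⁻¹ b + c - λ b† - λ² a†`. -/
def shortLoop (a b c : M3) (l : Circle) : M3 :=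
  (l : ℂ) ^ (-2 : ℤ) • a + (l : ℂ) ^ (-1 : ℤ) • b + c - (l : ℂ) • bᴴ - (l : ℂ) ^ 2 • aᴴ

theorem shortLoop_inj {a b c a' b' c' : M3}
    (h : ∀ l, shortLoop a b c l = shortLoop a' b' c' l) : a = a' ∧ b = b' ∧ c = c' := by
  -- These are the Fourier coefficients of the difference of the two loops; the order is reversed in
  -- degrees 1 and 2 because those modes enter with a minus sign.
  let f : ℤ → M3 := fun k => if k = -2 then a - a' else if k = -1 then b - b' else
    if k = 0 then c - c' else if k = 1 then b'ᴴ - bᴴ else a'ᴴ - aᴴ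
  have hf := eq_zero_of_sum_zpow_smul_eq_zero (s := {-2, -1, 0, 1, 2}) (c := f) fun l => by
    have := sub_eq_zero.2 (h l)
    rw [← this, Finset.sum_insert (by simp), Finset.sum_insert (by simp),
      Finset.sum_insert (by simp), Finset.sum_insert (by simp), Finset.sum_singleton]
    simp only [f, shortLoop]
    norm_num
    simp only [smul_sub]
    norm_cast
    abel
  have h1 := hf (-2) (by simp)
  have h2 := hf (-1) (by simp)
  have h3 := hf 0 (by simp)
  simp only [f] at h1 h2 h3
  norm_num at h1 h2 h3
  exact ⟨sub_eq_zero.1 h1, sub_eq_zero.1 h2, sub_eq_zero.1 h3⟩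

/-- Normalizing at `λ = 1` erases the degree 0 mode: based loops do not see `A_0`. -/
theorem shortLoop_zero_sub (a b c : M3) (l : Circle) :
    shortLoop a b c l - shortLoop a b c 1 = shortLoop a b 0 l - shortLoop a b 0 1 := by
  simp only [shortLoop]; abel

/-- The base point correction is moved into the degree 0 slot, so that `shortLoop_inj` applies to
based loops. -/
theorem shortLoop_one_sub (a b c : M3) (l : Circle) :
    shortLoop a b (c - shortLoop a b 0 1) l = shortLoop a b c l - shortLoop a b 0 1 := by
  simp only [shortLoop]; abel

theorem shortLoop_conj (a b c g : M3) (l : Circle) :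
    shortLoop (gᴴ * a * g) (gᴴ * b * g) (gᴴ * c * g) l = gᴴ * shortLoop a b c l * g := by
  simp only [shortLoop, Matrix.conjTranspose_mul, Matrix.conjTranspose_conjTranspose, mul_add,
    add_mul, mul_sub, sub_mul, Matrix.mul_smul, Matrix.smul_mul, mul_assoc]

theorem evalAt_projSu_shifted {p : ℕ} {ξ : Loop} (h : ξ ∈ LoopU (2 + 4 * p)) (v : ℂ) (l : Circle) :
    (shifted p ξ v).projSu.evalAt l = shortLoop (v • ξ.coeff (-4 * (p : ℤ) - 2))
      (v • ξ.coeff (-4 * (p : ℤ) - 1)) (suPart (v • ξ.coeff (-4 * (p : ℤ)))) l := by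
  rw [evalAt_projSu (coeff_shifted_eq_zero h v)]
  simp only [coeff_shifted, shortLoop]
  rw [show (-2 : ℤ) - 4 * p = -4 * (p : ℤ) - 2 by ring,
    show (-1 : ℤ) - 4 * p = -4 * (p : ℤ) - 1 by ring, show (0 : ℤ) - 4 * p = -4 * (p : ℤ) by ring]

theorem evalAt_projBased_shifted {p : ℕ} {ξ : Loop} (h : ξ ∈ LoopU (2 + 4 * p)) (v : ℂ)
    (l : Circle) :
    (shifted p ξ v).projBased.evalAt l = shortLoop (v • ξ.coeff (-4 * (p : ℤ) - 2))
        (v • ξ.coeff (-4 * (p : ℤ) - 1)) 0 l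
      - shortLoop (v • ξ.coeff (-4 * (p : ℤ) - 2)) (v • ξ.coeff (-4 * (p : ℤ) - 1)) 0 1 := by
  rw [evalAt_projBased (coeff_shifted_eq_zero h v)]
  simp only [coeff_shifted, shortLoop]
  rw [show (-2 : ℤ) - 4 * p = -4 * (p : ℤ) - 2 by ring,
    show (-1 : ℤ) - 4 * p = -4 * (p : ℤ) - 1 by ring]
  simp

/-- As `-2 ≡ 2` modulo 4, the component `A_2` is itself skew-Hermitian, so its `dz̄`-part is
determined by its `dz`-part. -/
theorem part01_eq {A : ℂ → M3} (hA : ∀ v, (A v)ᴴ = -A v) (v : ℂ) :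
    part01 (fun w => tauComp 2 (A w)) v = -(part10 (fun w => tauComp 2 (A w)) v)ᴴ := by
  have h2 : ∀ w, (tauComp 2 (A w))ᴴ = -tauComp 2 (A w) := fun w => by
    rw [tauComp_conjTranspose, hA, tauComp_neg, tauComp_congr (a := 2) (-1) (by norm_num)]
  simp only [part01, part10, Matrix.conjTranspose_smul, Matrix.conjTranspose_sub, h2]
  simp
  module

theorem tauComp_one_eq {A : ℂ → M3} (hA : ∀ v, (A v)ᴴ = -A v) (v : ℂ) :
    tauComp 1 (A v) = -(tauComp (-1) (A v))ᴴ := by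
  rw [tauComp_conjTranspose, hA, tauComp_neg, neg_neg, neg_neg]

theorem deform_eq_shortLoop {A : ℂ → M3} (hA : ∀ v, (A v)ᴴ = -A v) (l : Circle) (v : ℂ) :
    deform A l v = shortLoop (part10 (fun w => tauComp 2 (A w)) v) (tauComp (-1) (A v))
      (tauComp 0 (A v)) l := by
  rw [deform, shortLoop, part01_eq hA, tauComp_one_eq hA]
  simp only [smul_neg]
  abel

theorem IsFamily.mc_conjTranspose (hF : IsFamily Ω F) (hΩ : IsOpen Ω) (l : Circle) {z : ℂ}
    (hz : z ∈ Ω) (v : ℂ) : (mc (F l) z v)ᴴ = -mc (F l) z v :=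
  HamStat.mc_conjTranspose hΩ (hF.smooth l) (hF.unitary l) hz v

theorem IsFamily.mc_eq_shortLoop (hF : IsFamily Ω F) (hΩ : IsOpen Ω) (l : Circle) {z : ℂ}
    (hz : z ∈ Ω) (v : ℂ) : mc (F l) z v =
      shortLoop (part10 (fun w => tauComp 2 (mc (F 1) z w)) v) (tauComp (-1) (mc (F 1) z v))
        (tauComp 0 (mc (F 1) z v)) l := by
  rw [hF.deformation l z hz v, deform_eq_shortLoop (fun v => hF.mc_conjTranspose hΩ 1 hz v)]

/-- The two lowest coefficients of `λ^{4p} ξ_λ dz` are those of the Maurer-Cartan form. -/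
def MatchesLeading (Ω : Set ℂ) (F : Circle → ℂ → M3) (p : ℕ) (ξ : ℂ → Loop) : Prop :=
  ∀ z ∈ Ω, ∀ v, part10 (fun w => tauComp 2 (mc (F 1) z w)) v = v • (ξ z).coeff (-4 * (p : ℤ) - 2) ∧
    tauComp (-1) (mc (F 1) z v) = v • (ξ z).coeff (-4 * (p : ℤ) - 1)

/-- The form `B` is independent of `λ`, so the modes `λ⁻²` and `λ⁻¹` can be compared without it. -/
theorem IsQuasiAdapted.matchesLeading (hF : IsFamily Ω F) (hΩ : IsOpen Ω) {p : ℕ} {ξ : ℂ → Loop}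
    (h : IsQuasiAdapted Ω F p ξ) : MatchesLeading Ω F p ξ := by
  intro z hz v
  obtain ⟨B, -, hB⟩ := h.adapted
  have := shortLoop_inj (a := v • (ξ z).coeff (-4 * (p : ℤ) - 2))
    (b := v • (ξ z).coeff (-4 * (p : ℤ) - 1)) (c := suPart (v • (ξ z).coeff (-4 * (p : ℤ))))
    (a' := part10 (fun w => tauComp 2 (mc (F 1) z w)) v) (b' := tauComp (-1) (mc (F 1) z v))
    (c' := tauComp 0 (mc (F 1) z v) + B z v) fun l => by
      rw [← evalAt_projSu_shifted (h.mem z hz).1, hB l z hz v, hF.mc_eq_shortLoop hΩ l hz v]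
      simp only [shortLoop]; abel
  exact ⟨this.1.symm, this.2.1.symm⟩

/-- `θ ↦ (λ^{4p} ξ dz)_su - A_0` as a continuous linear form. -/
def discrepancy (F : Circle → ℂ → M3) (p : ℕ) (ξ : ℂ → Loop) (z : ℂ) : ℂ →L[ℝ] M3 :=
  LinearMap.toContinuousLinearMap
    (suPartLin ∘ₗ (LinearMap.toSpanSingleton ℂ M3 ((ξ z).coeff (-4 * (p : ℤ)))).restrictScalars ℝ
      - (tauCompLin 0).restrictScalars ℝ ∘ₗ (LinearMap.mulLeft ℝ ((F 1 z)⁻¹))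
        ∘ₗ (fderiv ℝ (F 1) z).toLinearMap)

theorem discrepancy_apply (F : Circle → ℂ → M3) (p : ℕ) (ξ : ℂ → Loop) (z v : ℂ) :
    discrepancy F p ξ z v =
      suPart (v • (ξ z).coeff (-4 * (p : ℤ))) - tauComp 0 (mc (F 1) z v) := rfl

/-- The positive modes follow from the negative ones by reality, and the degree 0 mismatch is taken
as `B`. -/
theorem MatchesLeading.isQuasiAdapted (hF : IsFamily Ω F) (hΩ : IsOpen Ω) {p : ℕ} {ξ : ℂ → Loop}
    (hmem : ∀ z ∈ Ω, ξ z ∈ LoopUTau (2 + 4 * p)) (hs : SmoothLoop Ω ξ)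
    (hlax : Lax Ω ξ fun l => mc (F l)) (h : MatchesLeading Ω F p ξ) : IsQuasiAdapted Ω F p ξ := by
  refine ⟨hmem, hs, hlax, discrepancy F p ξ, fun z hz v => ?_, fun l z hz v => ?_⟩
  · rw [discrepancy_apply]
    refine sub_mem_uC (suPart_mem (smul_mem_uC v ?_)).1 (tauComp_mem 0 _)
    have := (mem_LoopUTau_iff.1 (hmem z hz)).2 (-4 * (p : ℤ))
    rwa [uC_congr (a := 0) (-(p : ℤ)) (by ring)] at this
  · rw [evalAt_projSu_shifted (hmem z hz).1, discrepancy_apply, hF.mc_eq_shortLoop hΩ l hz v,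
      (h z hz v).1, (h z hz v).2]
    simp only [shortLoop]; abel

/-- The inhomogeneous term `G⁻¹dG` has degree 0 and is invisible to the components of degree 2 and
`-1`. -/
theorem MatchesLeading.gauge (hF : IsFamily Ω F) (hΩ : IsOpen Ω) {p : ℕ} {ξ : ℂ → Loop}
    (h : MatchesLeading Ω F p ξ) {G : ℂ → M3} (hG : IsGauge Ω G) :
    MatchesLeading Ω (gaugeF F G) p (gaugeLoop ξ G) := by
  intro z hz v
  have hc : ∀ a : ℤ, ¬ (4 : ℤ) ∣ 0 - a → ∀ w, tauComp a (mc (gaugeF F G 1) z w) =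
      (G z)⁻¹ * tauComp a (mc (F 1) z w) * G z := by
    intro a ha w
    rw [hF.mc_gaugeF hΩ hG.1 1 hz w, gaugeA, tauComp_add, tauComp_conj (hG.2 z hz),
      tauComp_of_mem_of_ne (mc_gauge_mem hΩ hG hz w) ha, add_zero]
  simp only [hc 2 (by norm_num), hc (-1) (by norm_num), coeff_gaugeLoop]
  constructor
  · rw [← Matrix.smul_mul, ← Matrix.mul_smul, ← (h z hz v).1]
    simp only [part10, mul_sub, sub_mul, Matrix.mul_smul, Matrix.smul_mul]
  · rw [(h z hz v).2, Matrix.mul_smul, Matrix.smul_mul]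

theorem MatchesLeading.isAdapted (hF : IsFamily Ω F) (hΩ : IsOpen Ω) {p : ℕ} {ξ : ℂ → Loop}
    (hmem : ∀ z ∈ Ω, ξ z ∈ LoopUTau (2 + 4 * p)) (hs : SmoothLoop Ω ξ)
    (hlax : Lax Ω ξ fun l => mc (F l)) (h : MatchesLeading Ω F p ξ)
    (h0 : ∀ z ∈ Ω, ∀ v, suPart (v • (ξ z).coeff (-4 * (p : ℤ))) = tauComp 0 (mc (F 1) z v)) :
    IsAdapted Ω F p ξ := by
  refine ⟨hmem, hs, hlax, fun l z hz v => ?_⟩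
  rw [evalAt_projSu_shifted (hmem z hz).1, hF.mc_eq_shortLoop hΩ l hz v, (h z hz v).1, (h z hz v).2,
    h0 z hz v]

end

section

variable {Ω : Set ℂ} {F : Circle → ℂ → M3} {p : ℕ} {ξ : ℂ → Loop}

/-! ### Consequences of the Lax equation -/

theorem mem_uC_two_of_mem (h : ∀ z ∈ Ω, ξ z ∈ LoopUTau (2 + 4 * p)) {z : ℂ} (hz : z ∈ Ω) :
    (ξ z).coeff (-4 * (p : ℤ) - 2) ∈ uC 2 := by
  have := (mem_LoopUTau_iff.1 (h z hz)).2 (-4 * (p : ℤ) - 2)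
  rwa [uC_congr (a := 2) (-(p : ℤ) - 1) (by ring)] at this

theorem mem_uC_zero_of_mem (h : ∀ z ∈ Ω, ξ z ∈ LoopUTau (2 + 4 * p)) {z : ℂ} (hz : z ∈ Ω) :
    (ξ z).coeff (-4 * (p : ℤ)) ∈ uC 0 := by
  have := (mem_LoopUTau_iff.1 (h z hz)).2 (-4 * (p : ℤ))
  rwa [uC_congr (a := 0) (-(p : ℤ)) (by ring)] at this

theorem fderiv_coeff_eq (hF : IsFamily Ω F) (hΩ : IsOpen Ω)
    (hmem : ∀ z ∈ Ω, ξ z ∈ LoopUTau (2 + 4 * p)) (hs : SmoothLoop Ω ξ)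
    (hlax : Lax Ω ξ fun l => mc (F l)) {z : ℂ} (hz : z ∈ Ω) (v : ℂ) (k : ℤ) :
    fderiv ℝ (fun w => (ξ w).coeff k) z v =
      (⁅ξ z, deformLoop (mc (F 1) z) v⁆ : Loop).coeff k :=
  fderiv_coeff_eq_of_lax hΩ (fun z hz => (hmem z hz).1) hs hz (fun l => by
    rw [evalAt_deformLoop, ← hF.deformation l z hz v]; exact hlax l z hz v) k

theorem lie_smul_self (v : ℂ) (M : M3) : ⁅M, v • M⁆ = 0 := by
  rw [Ring.lie_def, Matrix.mul_smul, Matrix.smul_mul, sub_self]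

/-- Three brackets survive at the lowest mode. Those with `A_2'` and `A_0` pair degree 0 with degree
2; the one with `A_{-1} = ξ̂_{-4p-1} dz` brackets a matrix with a multiple of itself. -/
theorem fderiv_leading_eq_zero (hF : IsFamily Ω F) (hΩ : IsOpen Ω)
    (hmem : ∀ z ∈ Ω, ξ z ∈ LoopUTau (2 + 4 * p)) (hs : SmoothLoop Ω ξ)
    (hlax : Lax Ω ξ fun l => mc (F l)) (hl : MatchesLeading Ω F p ξ) {z : ℂ} (hz : z ∈ Ω) (v : ℂ) :
    fderiv ℝ (fun w => (ξ w).coeff (-4 * (p : ℤ) - 2)) z v = 0 := by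
  have hzero : ∀ k : ℤ, k < -4 * (p : ℤ) - 2 → (ξ z).coeff k = 0 := fun k hk =>
    (hmem z hz).1.1 k (by rw [lt_abs]; right; push_cast; omega)
  rw [fderiv_coeff_eq hF hΩ hmem hs hlax hz, coeff_lie_deformLoop, (hl z hz v).1, (hl z hz v).2,
    hzero (-4 * (p : ℤ) - 2 - 1) (by omega), hzero (-4 * (p : ℤ) - 2 - 2) (by omega),
    show -4 * (p : ℤ) - 2 + 2 = -4 * (p : ℤ) by ring,
    show -4 * (p : ℤ) - 2 + 1 = -4 * (p : ℤ) - 1 by ring,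
    lie_uC_zero_two (mem_uC_zero_of_mem hmem hz) (smul_mem_uC v (mem_uC_two_of_mem hmem hz)),
    lie_smul_self, ← ring_lie_skew,
    lie_uC_zero_two (tauComp_mem 0 _) (mem_uC_two_of_mem hmem hz)]
  simp [Ring.lie_def]

theorem hasFDerivAt_entry {X : ℂ → M3} {z : ℂ} (h : DifferentiableAt ℝ X z) (i j : Fin 3) :
    HasFDerivAt (fun w => X w i j)
      ((LinearMap.toContinuousLinearMap (entryLin i j)).comp (fderiv ℝ X z)) z :=
  (LinearMap.toContinuousLinearMap (entryLin i j)).hasFDerivAt.comp z h.hasFDerivAt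

theorem fderiv_entry {X : ℂ → M3} {z : ℂ} (h : DifferentiableAt ℝ X z) (i j : Fin 3) (v : ℂ) :
    fderiv ℝ (fun w => X w i j) z v = fderiv ℝ X z v i j :=
  congrArg (fun T : ℂ →L[ℝ] ℂ => T v) (hasFDerivAt_entry h i j).fderiv

/-- Horizontality of the lift: the `(2, 2)` entry of the Maurer-Cartan form vanishes. -/
theorem mc_apply_two_two (hF : IsFamily Ω F) (hΩ : IsOpen Ω) {z : ℂ} (hz : z ∈ Ω) {v : ℂ}
    (hv : v = 1 ∨ v = Complex.I) : mc (F 1) z v 2 2 = 0 := by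
  obtain ⟨u, h1, -, h3⟩ := hF.framing
  have hd : ∀ i, fderiv ℝ (F 1) z v i 2 = fderiv ℝ u z v i := by
    intro i
    have e1 : fderiv ℝ (fun w => F 1 w i 2) z v = fderiv ℝ (F 1) z v i 2 :=
      fderiv_entry (differentiableAt_of_smooth hΩ h3.smooth hz) i 2 v
    have e2 : fderiv ℝ (fun w => u w i) z v = fderiv ℝ u z v i := by
      have := (ContinuousLinearMap.proj (R := ℝ) (φ := fun _ : Fin 3 => ℂ) i).hasFDerivAt.comp z
        (differentiableAt_of_smooth hΩ h1.smooth hz).hasFDerivAt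
      exact congrArg (fun T : ℂ →L[ℝ] ℂ => T v) this.fderiv
    have e3 : (fun w => F 1 w i 2) =ᶠ[𝓝 z] fun w => u w i := by
      filter_upwards [hΩ.mem_nhds hz] with w hw using h3.column w hw i
    rw [← e1, ← e2, e3.fderiv_eq]
  have hh : herm (u z) (fderiv ℝ u z v) = 0 := by
    rcases hv with rfl | rfl
    · exact (h1.horizontal z hz).1
    · exact (h1.horizontal z hz).2
  rw [mc, unitary_inv (h3.unitary z hz), Matrix.mul_apply, ← hh]
  unfold herm dotProduct
  refine Finset.sum_congr rfl fun i _ => ?_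
  rw [Matrix.conjTranspose_apply, h3.column z hz, hd]
  rfl

theorem part10_add_part01 {A : ℂ → M3} (h : ∀ v, A v = v.re • A 1 + v.im • A Complex.I) (v : ℂ) :
    part10 A v + part01 A v = A v := by
  rw [h v, part10, part01]
  have hc : ∀ (r : ℝ) (M : M3), r • M = (r : ℂ) • M := fun r M => (Complex.coe_smul r M).symm
  rw [hc, hc]
  have hI := Complex.I_sq
  have e1 : (1 / 2 : ℂ) * (v + star v) = v.re := by
    apply Complex.ext <;> simp; ring
  have e2 : (1 / 2 : ℂ) * (-v * Complex.I + star v * Complex.I) = v.im := by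
    apply Complex.ext <;> simp; ring
  rw [← e1, ← e2]
  module

theorem mc_real_linear (f : ℂ → M3) (z v : ℂ) :
    mc f z v = v.re • mc f z 1 + v.im • mc f z Complex.I := by
  simp only [mc]
  rw [← Matrix.mul_smul, ← Matrix.mul_smul, ← mul_add, ← map_smul, ← map_smul, ← map_add]
  congr 2
  apply Complex.ext <;> simp

theorem tauComp_mc_real_linear (a : ℤ) (f : ℂ → M3) (z v : ℂ) :
    tauComp a (mc f z v) = v.re • tauComp a (mc f z 1) + v.im • tauComp a (mc f z Complex.I) := by
  have hc : ∀ (r : ℝ) (M : M3), r • M = (r : ℂ) • M := fun r M => (Complex.coe_smul r M).symm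
  rw [mc_real_linear, tauComp_add, hc, hc, tauComp_smul, tauComp_smul, hc, hc]

/-- Only `A_2` contributes to the `(2, 2)` entry of `A`. If `x` is the entry of the leading
coefficient, horizontality says that `v x` is real for `v = 1` and for `v = i`. -/
theorem leading_apply_two_two (hF : IsFamily Ω F) (hΩ : IsOpen Ω)
    (hl : MatchesLeading Ω F p ξ) {z : ℂ} (hz : z ∈ Ω) :
    (ξ z).coeff (-4 * (p : ℤ) - 2) 2 2 = 0 := by
  have key : ∀ v, v = 1 ∨ v = Complex.I → (v • (ξ z).coeff (-4 * (p : ℤ) - 2)) 2 2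
      - star ((v • (ξ z).coeff (-4 * (p : ℤ) - 2)) 2 2) = 0 := by
    intro v hv
    have h1 := mc_apply_two_two hF hΩ hz hv
    have hA := fun v => hF.mc_conjTranspose hΩ 1 hz v
    rw [← tauComp_sum (mc (F 1) z v), ← part10_add_part01 (tauComp_mc_real_linear 2 (F 1) z) v,
      part01_eq hA, (hl z hz v).1] at h1
    simp only [Matrix.add_apply, Matrix.neg_apply, Matrix.conjTranspose_apply,
      apply_two_two_of_mem_uC_odd (tauComp_mem 1 _) (Or.inl rfl),
      apply_two_two_of_mem_uC_odd (tauComp_mem (-1) _) (Or.inr rfl)] at h1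
    have h0 : tauComp 0 (mc (F 1) z v) 2 2 = 0 := by
      rw [eq_of_mem_uC_zero (tauComp_mem 0 (mc (F 1) z v))]; simp
    rw [h0] at h1
    simpa [sub_eq_add_neg] using h1
  have h1 := key 1 (Or.inl rfl)
  have h2 := key Complex.I (Or.inr rfl)
  simp [Complex.ext_iff] at h1 h2
  apply Complex.ext
  · simp; linarith
  · simp; linarith

theorem hasConstLeading (hF : IsFamily Ω F) (hΩ : IsOpen Ω) (hsc : IsSimplyConnected Ω)
    (hmem : ∀ z ∈ Ω, ξ z ∈ LoopUTau (2 + 4 * p)) (hs : SmoothLoop Ω ξ)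
    (hlax : Lax Ω ξ fun l => mc (F l)) (hl : MatchesLeading Ω F p ξ) :
    HasConstLeading Ω p ξ := by
  obtain ⟨z₀, hz₀⟩ := hsc.nonempty
  have hpre : IsPreconnected Ω := hsc.isPathConnected.isConnected.isPreconnected
  have hconst : ∀ z ∈ Ω, (ξ z).coeff (-4 * (p : ℤ) - 2) = (ξ z₀).coeff (-4 * (p : ℤ) - 2) := by
    intro z hz
    refine hΩ.is_const_of_fderiv_eq_zero (𝕜 := ℝ) hpre
      (f := fun w => (ξ w).coeff (-4 * (p : ℤ) - 2))
      (fun w hw => (differentiableAt_of_smooth hΩ (hs _) hw).differentiableWithinAt)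
      (fun w hw => ?_) hz hz₀
    ext1 v
    exact fderiv_leading_eq_zero hF hΩ hmem hs hlax hl hw v
  -- The factor `-i` is there so that `i a` is the `(0, 0)` entry.
  refine ⟨-Complex.I * (ξ z₀).coeff (-4 * (p : ℤ) - 2) 0 0, fun z hz => ?_⟩
  have e : Complex.I * (-Complex.I * (ξ z₀).coeff (-4 * (p : ℤ) - 2) 0 0) =
      (ξ z₀).coeff (-4 * (p : ℤ) - 2) 0 0 := by
    rw [← mul_assoc, mul_neg, Complex.I_mul_I, neg_neg, one_mul]
  rw [e, hconst z hz, eq_of_mem_uC_two (mem_uC_two_of_mem hmem hz₀),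
    leading_apply_two_two hF hΩ hl hz₀]
  simp

/-! ### The flat connection `A_0 - ξ̂_{-4p} dz` -/

/-- The degrees must add up to 0 modulo 4. The pair `(2, 2)` also does, but degree 2 is abelian. -/
theorem tauComp_zero_lie (M N : M3) : tauComp 0 ⁅M, N⁆ = ⁅tauComp 0 M, tauComp 0 N⁆
    + ⁅tauComp (-1) M, tauComp 1 N⁆ + ⁅tauComp 1 M, tauComp (-1) N⁆ := by
  have hz : ∀ a b : ℤ, ¬ (4 : ℤ) ∣ a + b - 0 → tauComp 0 ⁅tauComp a M, tauComp b N⁆ = 0 :=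
    fun a b h => tauComp_of_mem_of_ne (lie_mem_uC (tauComp_mem a M) (tauComp_mem b N)) h
  have ho : ∀ a b : ℤ, a + b = 0 → tauComp 0 ⁅tauComp a M, tauComp b N⁆
      = ⁅tauComp a M, tauComp b N⁆ :=
    fun a b h => tauComp_of_mem (h ▸ lie_mem_uC (tauComp_mem a M) (tauComp_mem b N))
  conv_lhs => rw [← tauComp_sum M, ← tauComp_sum N]
  simp only [ring_add_lie, ring_lie_add, tauComp_add]
  rw [lie_uC_two_two (tauComp_mem 2 M) (tauComp_mem 2 N)]
  rw [hz 2 (-1) (by norm_num), hz 2 0 (by norm_num), hz 2 1 (by norm_num), hz (-1) 2 (by norm_num),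
    hz (-1) (-1) (by norm_num), hz (-1) 0 (by norm_num), hz 0 2 (by norm_num),
    hz 0 (-1) (by norm_num), hz 0 1 (by norm_num), hz 1 2 (by norm_num), hz 1 0 (by norm_num),
    hz 1 1 (by norm_num), ho (-1) 1 (by norm_num), ho 0 0 (by norm_num), ho 1 (-1) (by norm_num),
    ← tauCompLin_apply, map_zero]
  abel

/-- This is the degree 0 part of `dA + A ∧ A = 0` on the pair `(1, i)`. With `A_{-1}(v) = v b` and
`A_1(v) = -v̄ b†`, the brackets of degrees `±1` add up to `2i [b, b†]`. -/
theorem structure_eq_zero_part (hF : IsFamily Ω F) (hΩ : IsOpen Ω)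
    (hl : MatchesLeading Ω F p ξ) {z : ℂ} (hz : z ∈ Ω) :
    fderiv ℝ (fun w => tauComp 0 (mc (F 1) w Complex.I)) z 1
      - fderiv ℝ (fun w => tauComp 0 (mc (F 1) w 1)) z Complex.I
      + ⁅tauComp 0 (mc (F 1) z 1), tauComp 0 (mc (F 1) z Complex.I)⁆
      + (2 * Complex.I) • ⁅(ξ z).coeff (-4 * (p : ℤ) - 1), ((ξ z).coeff (-4 * (p : ℤ) - 1))ᴴ⁆ = 0 := by
  have hd : ∀ v, DifferentiableAt ℝ (fun w => mc (F 1) w v) z := fun v =>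
    differentiableAt_of_smooth hΩ (contDiffOn_mc hΩ (hF.smooth 1) (fun z hz => hF.isUnit_det 1 hz) v)
      hz
  have hdt : ∀ u v, fderiv ℝ (fun w => tauComp 0 (mc (F 1) w v)) z u =
      tauComp 0 (fderiv ℝ (fun w => mc (F 1) w v) z u) := fun u v =>
    fderiv_linear_comp ((tauCompLin 0).restrictScalars ℝ) (hd v) u
  have h := congrArg (tauComp 0)
    (mc_structure hΩ (hF.smooth 1) (fun z hz => hF.isUnit_det 1 hz) hz 1 Complex.I)
  rw [tauComp_add, tauComp_sub, tauComp_zero_lie, ← hdt, ← hdt, ← tauCompLin_apply 0 0, map_zero] at h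
  have hA := fun v => hF.mc_conjTranspose hΩ 1 hz v
  rw [tauComp_one_eq hA, tauComp_one_eq hA, (hl z hz 1).2, (hl z hz Complex.I).2] at h
  rw [← h]
  simp only [Ring.lie_def, Matrix.conjTranspose_smul, one_smul, Complex.star_def,
    Complex.conj_I, Matrix.smul_mul, Matrix.mul_smul, neg_mul, mul_neg, neg_smul]
  module

/-- The left side is `d(ξ̂_{-4p} dz)` on the pair `(1, i)`. Wedging with `dz` removes the brackets
with `A_2'` and `A_{-1}`, which are multiples of `dz`, and the bracket with `A_2''` vanishes inside
degree 2. Thus the unknown higher coefficients of `ξ` drop out. -/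
theorem fderiv_coeff_zero (hF : IsFamily Ω F) (hΩ : IsOpen Ω)
    (hmem : ∀ z ∈ Ω, ξ z ∈ LoopUTau (2 + 4 * p)) (hs : SmoothLoop Ω ξ)
    (hlax : Lax Ω ξ fun l => mc (F l)) (hl : MatchesLeading Ω F p ξ) {z : ℂ} (hz : z ∈ Ω) :
    Complex.I • fderiv ℝ (fun w => (ξ w).coeff (-4 * (p : ℤ))) z 1
      - fderiv ℝ (fun w => (ξ w).coeff (-4 * (p : ℤ))) z Complex.I =
    ⁅(ξ z).coeff (-4 * (p : ℤ)),
        Complex.I • tauComp 0 (mc (F 1) z 1) - tauComp 0 (mc (F 1) z Complex.I)⁆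
      - (2 * Complex.I) • ⁅(ξ z).coeff (-4 * (p : ℤ) - 1), ((ξ z).coeff (-4 * (p : ℤ) - 1))ᴴ⁆ := by
  have hA := fun v => hF.mc_conjTranspose hΩ 1 hz v
  have hcomm : ∀ v : ℂ, (⁅(ξ z).coeff (-4 * (p : ℤ) - 2),
      -(v • (ξ z).coeff (-4 * (p : ℤ) - 2))ᴴ⁆ : M3) = 0 := by
    intro v
    refine lie_uC_two_two (mem_uC_two_of_mem hmem hz) ?_
    have := conjTranspose_mem_uC (smul_mem_uC v (mem_uC_two_of_mem hmem hz))
    rw [uC_congr (a := 2) (-1) (by norm_num)] at this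
    rw [← neg_one_smul ℂ]
    exact smul_mem_uC _ this
  rw [fderiv_coeff_eq hF hΩ hmem hs hlax hz, fderiv_coeff_eq hF hΩ hmem hs hlax hz,
    coeff_lie_deformLoop, coeff_lie_deformLoop, part01_eq hA, part01_eq hA, tauComp_one_eq hA,
    tauComp_one_eq hA, (hl z hz 1).1, (hl z hz 1).2, (hl z hz Complex.I).1, (hl z hz Complex.I).2,
    hcomm, hcomm]
  simp only [Ring.lie_def, Matrix.conjTranspose_smul, one_smul, Complex.star_def,
    Complex.conj_I, Matrix.smul_mul, Matrix.mul_smul, neg_mul, mul_neg, neg_smul, mul_sub, sub_mul]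
  module

end

section

variable {Ω : Set ℂ} {F : Circle → ℂ → M3} {p : ℕ} {ξ : ℂ → Loop}

/-! ### Gauging a flat connection into the Borel subalgebra -/

/-- `suMat` as a function of a matrix whose column of index `1` is `(p, q, 0)`, up to a constant. -/
def suMatLin : M3 →ₗ[ℝ] M3 where
  toFun X := !![star (X 1 1), X 0 1, 0; -star (X 0 1), X 1 1, 0; 0, 0, 0]
  map_add' X Y := by ext i j; fin_cases i <;> fin_cases j <;> simp [add_comm]
  map_smul' r X := by ext i j; fin_cases i <;> fin_cases j <;> simp

theorem suMat_eq_add (X : M3) :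
    suMat (X 0 1) (X 1 1) = suMatLin X + !![0, 0, 0; 0, 0, 0; 0, 0, 1] := by
  ext i j
  fin_cases i <;> fin_cases j <;> simp [suMat, suMatLin]

/-- The norm of the upper part of the column of index `1`. -/
def colNorm (X : M3) : ℝ := √(Complex.normSq (X 0 1) + Complex.normSq (X 1 1))

theorem colNorm_pos {X : M3} (hX : IsUnit X) (h : X 2 1 = 0) : 0 < colNorm X := by
  refine Real.sqrt_pos.2 ?_
  by_contra hn
  have h0 := Complex.normSq_nonneg (X 0 1)
  have h1 := Complex.normSq_nonneg (X 1 1)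
  have e0 : X 0 1 = 0 := Complex.normSq_eq_zero.1 (by linarith)
  have e1 : X 1 1 = 0 := Complex.normSq_eq_zero.1 (by linarith)
  refine ((Matrix.isUnit_iff_isUnit_det _).1 hX).ne_zero (Matrix.det_eq_zero_of_column_eq_zero 1 ?_)
  intro i
  fin_cases i
  exacts [e0, e1, h]

theorem contDiffOn_colNorm {K : ℂ → M3} (hK : ContDiffOn ℝ ∞ K Ω) (hp : ∀ z ∈ Ω, 0 < colNorm (K z)) :
    ContDiffOn ℝ ∞ (fun z => (colNorm (K z))⁻¹) Ω := by
  have hent : ∀ i, ContDiffOn ℝ ∞ (fun z => Complex.normSq (K z i 1)) Ω := by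
    intro i
    have he : ContDiffOn ℝ ∞ (fun z => K z i 1) Ω :=
      (LinearMap.toContinuousLinearMap (entryLin i 1)).contDiff.comp_contDiffOn hK
    have hre := Complex.reCLM.contDiff.comp_contDiffOn he
    have him := Complex.imCLM.contDiff.comp_contDiffOn he
    exact ((hre.mul hre).add (him.mul him)).congr fun z _ => by simp [Complex.normSq_apply]
  refine ContDiffOn.inv (ContDiffOn.sqrt ((hent 0).add (hent 1)) fun z hz => ?_) fun z hz =>
    (hp z hz).ne'
  exact (Real.sqrt_pos.1 (hp z hz)).ne'

theorem suMat_normalized_mem {X : M3} (h : 0 < colNorm X) :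
    suMat (((colNorm X)⁻¹ • X) 0 1) (((colNorm X)⁻¹ • X) 1 1) ∈ U30 := by
  apply suMat_mem
  have hs : colNorm X ^ 2 = Complex.normSq (X 0 1) + Complex.normSq (X 1 1) :=
    Real.sq_sqrt (Real.sqrt_pos.1 h).le
  have hc : ((colNorm X : ℝ) : ℂ) ≠ 0 := by exact_mod_cast h.ne'
  have hsq : (colNorm X : ℂ) ^ 2 = star (X 0 1) * X 0 1 + star (X 1 1) * X 1 1 := by
    rw [Complex.star_def, ← Complex.normSq_eq_conj_mul_self, ← Complex.normSq_eq_conj_mul_self]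
    exact_mod_cast hs
  simp only [Matrix.smul_apply, Complex.real_smul, star_mul', Complex.star_def, Complex.conj_ofReal]
  rw [Complex.star_def] at hsq
  push_cast
  field_simp
  linear_combination -hsq

/-- The last row of a parallel frame of a `u(3)^ℂ_0`-valued connection is constant. -/
theorem frame_apply_two_one {K : ℂ → M3} {θ : ℂ → ℂ → M3} (hΩ : IsOpen Ω) (hpre : IsPreconnected Ω)
    (hK : ContDiffOn ℝ ∞ K Ω) (hθ : ∀ z ∈ Ω, ∀ v, θ z v ∈ uC 0)
    (hd : ∀ z ∈ Ω, ∀ v, fderiv ℝ K z v = -(θ z v * K z)) {z₀ : ℂ} (hz₀ : z₀ ∈ Ω) (h1 : K z₀ = 1)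
    {z : ℂ} (hz : z ∈ Ω) : K z 2 1 = 0 := by
  have := hΩ.is_const_of_fderiv_eq_zero (𝕜 := ℝ) hpre (f := fun w => K w 2 1)
    (fun w hw => (hasFDerivAt_entry (differentiableAt_of_smooth hΩ hK hw) 2
      1).differentiableAt.differentiableWithinAt)
    (fun w hw => by
      ext1 v
      rw [fderiv_entry (differentiableAt_of_smooth hΩ hK hw), hd w hw v,
        eq_of_mem_uC_zero (hθ w hw v)]
      rw [Matrix.neg_apply, Matrix.mul_apply, Fin.sum_univ_three]
      simp) hz hz₀
  simpa [h1] using this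

/-- Only the second column of a parallel frame `K` is needed: `G` has this column, rescaled by a
real function `r`, as its own second column. Then the gauged form maps the second basis vector to a
real multiple of itself, which in degree 0 already means membership in `𝔟`. -/
theorem exists_gauge_borel {θ : ℂ → ℂ → M3} (hΩ : IsOpen Ω) (hsc : IsSimplyConnected Ω) {z₀ : ℂ}
    (hz₀ : z₀ ∈ Ω) (hθ : ∀ z ∈ Ω, ∀ v, θ z v ∈ uC 0)
    (hlin : ∀ z ∈ Ω, ∀ v, θ z v = v.re • θ z 1 + v.im • θ z Complex.I)
    (hs : ∀ v, ContDiffOn ℝ ∞ (fun z => θ z v) Ω)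
    (hflat : ∀ z ∈ Ω, fderiv ℝ (fun w => θ w Complex.I) z 1 - fderiv ℝ (fun w => θ w 1) z Complex.I
      + ⁅θ z 1, θ z Complex.I⁆ = 0) :
    ∃ G, IsGauge Ω G ∧ G z₀ = 1 ∧
      ∀ z ∈ Ω, ∀ v, (G z)⁻¹ * θ z v * G z + (G z)⁻¹ * fderiv ℝ G z v ∈ borel := by
  have hpre : IsPreconnected Ω := hsc.isPathConnected.isConnected.isPreconnected
  have hdneg : ∀ u z v, fderiv ℝ (fun w => -θ w u) z v = -fderiv ℝ (fun w => θ w u) z v := by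
    intro u z v
    exact congrArg (fun T : ℂ →L[ℝ] M3 => T v) (fderiv_fun_neg (f := fun w => θ w u))
  obtain ⟨K, hK1, hKs, hK⟩ := exists_flat_frame_complex (a := fun z => -θ z 1)
    (b := fun z => -θ z Complex.I) hΩ hsc (hs 1).neg (hs Complex.I).neg (fun z hz => by
      have h := hflat z hz
      rw [Ring.lie_def] at h
      have e : fderiv ℝ (fun w => -θ w Complex.I) z 1 + -θ z Complex.I * -θ z 1 =
          fderiv ℝ (fun w => -θ w 1) z Complex.I + -θ z 1 * -θ z Complex.I := by
        rw [hdneg, hdneg, neg_mul_neg, neg_mul_neg, ← sub_eq_zero, ← neg_eq_zero, ← h]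
        abel
      exact e) hz₀
  have hd : ∀ z ∈ Ω, ∀ v, fderiv ℝ K z v = -(θ z v * K z) := by
    intro z hz v
    have e : fderiv ℝ K z v = (v.re • -θ z 1 + v.im • -θ z Complex.I) * K z := (hK z hz).2 v
    rw [e, hlin z hz v, ← neg_mul, neg_add, smul_neg, smul_neg]
  have h21 : ∀ z ∈ Ω, K z 2 1 = 0 := fun z hz => frame_apply_two_one hΩ hpre hKs hθ hd hz₀ hK1 hz
  have hpos : ∀ z ∈ Ω, 0 < colNorm (K z) := fun z hz => colNorm_pos (hK z hz).1 (h21 z hz)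
  set r : ℂ → ℝ := fun z => (colNorm (K z))⁻¹ with hr
  have hrs : ContDiffOn ℝ ∞ r Ω := contDiffOn_colNorm hKs hpos
  set G : ℂ → M3 := fun z => suMat ((r z • K z) 0 1) ((r z • K z) 1 1) with hGdef
  have hG : IsGauge Ω G := by
    refine ⟨?_, fun z hz => suMat_normalized_mem (hpos z hz)⟩
    refine ContDiffOn.congr (f := fun z => suMatLin (r z • K z) + !![0, 0, 0; 0, 0, 0; 0, 0, 1])
      ?_ fun z _ => suMat_eq_add _
    exact (contDiffOn_linear_comp suMatLin (hrs.smul hKs)).add contDiffOn_const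
  refine ⟨G, hG, ?_, fun z hz v => ?_⟩
  · have : r z₀ = 1 := by simp [hr, hK1, colNorm]
    ext i j
    simp only [hGdef, this, hK1, one_smul]
    fin_cases i <;> fin_cases j <;> simp [suMat]
  have hGz := hG.2 z hz
  have hcol : ∀ w ∈ Ω, ∀ i, G w i 1 = r w • K w i 1 := by
    intro w hw i
    fin_cases i <;> simp [hGdef, suMat, h21 w hw]
  have hdG : ∀ i, fderiv ℝ G z v i 1 = fderiv ℝ r z v • K z i 1 - r z • (θ z v * K z) i 1 := by
    intro i
    rw [← fderiv_entry (differentiableAt_of_smooth hΩ hG.1 hz)]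
    have e : (fun w => G w i 1) =ᶠ[𝓝 z] fun w => r w • K w i 1 := by
      filter_upwards [hΩ.mem_nhds hz] with w hw using hcol w hw i
    have hKd := differentiableAt_of_smooth hΩ hKs hz
    rw [e.fderiv_eq, fderiv_fun_smul (differentiableAt_of_smooth hΩ hrs hz)
      (hasFDerivAt_entry hKd i 1).differentiableAt]
    change r z • fderiv ℝ (fun w => K w i 1) z v + fderiv ℝ r z v • K z i 1 = _
    rw [fderiv_entry hKd, hd z hz v, Matrix.neg_apply, smul_neg]
    abel
  have hr0 : r z ≠ 0 := inv_ne_zero (hpos z hz).ne'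
  -- Because `K` is parallel, the two terms containing `θ` cancel and only the derivative of the
  -- scaling factor is left.
  have hM : ∀ i, (θ z v * G z + fderiv ℝ G z v) i 1 = (fderiv ℝ r z v / r z) • G z i 1 := by
    intro i
    rw [Matrix.add_apply, hdG, Matrix.mul_apply, Matrix.mul_apply, Fin.sum_univ_three,
      Fin.sum_univ_three]
    simp only [hcol z hz, Complex.real_smul]
    push_cast
    have : (r z : ℂ) ≠ 0 := by exact_mod_cast hr0
    field_simp
    ring
  have hMc : ∀ i, ((G z)⁻¹ * (θ z v * G z + fderiv ℝ G z v)) i 1 =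
      (fderiv ℝ r z v / r z) • (1 : M3) i 1 := by
    intro i
    rw [← Matrix.nonsing_inv_mul _ (hG.isUnit_det z hz), Matrix.mul_apply, Matrix.mul_apply,
      Finset.smul_sum]
    exact Finset.sum_congr rfl fun j _ => by rw [hM, mul_smul_comm]
  have hmem : (G z)⁻¹ * (θ z v * G z + fderiv ℝ G z v) ∈ uC 0 := by
    rw [mul_add, ← mul_assoc]
    exact add_mem_uC (conj_mem_uC hGz (hθ z hz v)) (mc_gauge_mem hΩ hG hz v)
  rw [mul_assoc, ← mul_add]
  set M := (G z)⁻¹ * (θ z v * G z + fderiv ℝ G z v)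
  have e := eq_of_mem_uC_zero hmem
  have e01 : M 0 1 = 0 := by simpa using hMc 0
  have e11 : M 1 1 = ((fderiv ℝ r z v / r z : ℝ) : ℂ) := by simpa using hMc 1
  have e00 : M 0 0 = ((-(fderiv ℝ r z v / r z) : ℝ) : ℂ) := by
    have := congrFun (congrFun e 1) 1
    simp only [e11] at this
    rw [Complex.ofReal_neg, this]
    simp
  -- The parameter `t` of `borel` is the `(0, 0)` entry, the negative of the `(1, 1)` entry computed
  -- from the column.
  refine ⟨-(fderiv ℝ r z v / r z), M 1 0, ?_⟩
  conv_lhs => rw [e]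
  rw [e01, e00]

end

section

variable {Ω : Set ℂ} {F : Circle → ℂ → M3} {p : ℕ} {ξ : ℂ → Loop}

/-! ### From quasi-finite type to finite type -/

/-- The connection form `A_0 - ξ̂_{-4p} dz`. -/
def zeroForm (F : Circle → ℂ → M3) (p : ℕ) (ξ : ℂ → Loop) (z v : ℂ) : M3 :=
  tauComp 0 (mc (F 1) z v) - v • (ξ z).coeff (-4 * (p : ℤ))

theorem fderiv_zeroForm (hF : IsFamily Ω F) (hΩ : IsOpen Ω) (hs : SmoothLoop Ω ξ) {z : ℂ}
    (hz : z ∈ Ω) (u v : ℂ) : fderiv ℝ (fun w => zeroForm F p ξ w u) z v =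
      fderiv ℝ (fun w => tauComp 0 (mc (F 1) w u)) z v
        - u • fderiv ℝ (fun w => (ξ w).coeff (-4 * (p : ℤ))) z v := by
  have h1 : DifferentiableAt ℝ (fun w => tauComp 0 (mc (F 1) w u)) z :=
    differentiableAt_of_smooth hΩ (contDiffOn_linear_comp ((tauCompLin 0).restrictScalars ℝ)
      (contDiffOn_mc hΩ (hF.smooth 1) (fun z hz => hF.isUnit_det 1 hz) u)) hz
  have h2 : DifferentiableAt ℝ (fun w => (ξ w).coeff (-4 * (p : ℤ))) z :=
    differentiableAt_of_smooth hΩ (hs _) hz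
  have := (h1.hasFDerivAt.sub (h2.hasFDerivAt.const_smul u)).fderiv
  exact congrArg (fun T : ℂ →L[ℝ] M3 => T v) this

theorem contDiffOn_zeroForm (hF : IsFamily Ω F) (hΩ : IsOpen Ω) (hs : SmoothLoop Ω ξ) (v : ℂ) :
    ContDiffOn ℝ ∞ (fun z => zeroForm F p ξ z v) Ω :=
  (contDiffOn_linear_comp ((tauCompLin 0).restrictScalars ℝ)
    (contDiffOn_mc hΩ (hF.smooth 1) (fun _ hz => hF.isUnit_det 1 hz) v)).sub ((hs _).const_smul v)

/-- In the difference of the two preceding identities the terms `2i [b, b†]` cancel, and the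
remaining brackets are those of `θ`. -/
theorem zeroForm_flat (hF : IsFamily Ω F) (hΩ : IsOpen Ω)
    (hmem : ∀ z ∈ Ω, ξ z ∈ LoopUTau (2 + 4 * p)) (hs : SmoothLoop Ω ξ)
    (hlax : Lax Ω ξ fun l => mc (F l)) (hl : MatchesLeading Ω F p ξ) {z : ℂ} (hz : z ∈ Ω) :
    fderiv ℝ (fun w => zeroForm F p ξ w Complex.I) z 1
      - fderiv ℝ (fun w => zeroForm F p ξ w 1) z Complex.I
      + ⁅zeroForm F p ξ z 1, zeroForm F p ξ z Complex.I⁆ = 0 := by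
  have h1 := structure_eq_zero_part hF hΩ hl hz
  have h2 := fderiv_coeff_zero hF hΩ hmem hs hlax hl hz
  rw [← sub_eq_zero] at h2
  rw [fderiv_zeroForm hF hΩ hs hz, fderiv_zeroForm hF hΩ hs hz, one_smul]
  refine Eq.trans ?_ ((congrArg₂ HSub.hSub h1 h2).trans (sub_zero 0))
  simp only [zeroForm, Ring.lie_def, one_smul, mul_sub, sub_mul, Matrix.smul_mul, Matrix.mul_smul]
  module

theorem Lax.gauge {n : ℕ} {G : ℂ → M3} (hΩ : IsOpen Ω) (hF : ∀ l, ContDiffOn ℝ ∞ (F l) Ω)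
    (hFu : ∀ l, ∀ z ∈ Ω, IsUnit (F l z).det) (hξ : ∀ z ∈ Ω, ξ z ∈ LoopU n) (hs : SmoothLoop Ω ξ)
    (hG : ContDiffOn ℝ ∞ G Ω) (hu : ∀ z ∈ Ω, IsUnit (G z).det) (h : Lax Ω ξ fun l => mc (F l)) :
    Lax Ω (gaugeLoop ξ G) fun l => mc (gaugeF F G l) := by
  intro l z hz v
  refine Eq.trans ?_ (congrArg _ (mc_gaugeF (differentiableAt_of_smooth hΩ (hF l) hz)
    (differentiableAt_of_smooth hΩ hG hz) (hFu l z hz) v).symm)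
  exact lax_gauge_of_lax hΩ hξ hs hG hu h l z hz v

/-- The gauge transform of `A_0 - ξ̂_{-4p} dz` is `A_0^G - ξ̂_{-4p}^G dz`. Once it lies in `𝔟`, the
projection kills it and fixes the skew-Hermitian `A_0^G`. -/
theorem exists_gauge_isAdapted (hF : IsFamily Ω F) (hΩ : IsOpen Ω) (hsc : IsSimplyConnected Ω)
    {z₀ : ℂ} (hz₀ : z₀ ∈ Ω) (h : IsQuasiAdapted Ω F p ξ) :
    ∃ G, IsGauge Ω G ∧ G z₀ = 1 ∧ IsAdapted Ω (gaugeF F G) p (gaugeLoop ξ G) := by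
  have hl := h.matchesLeading hF hΩ
  obtain ⟨G, hG, hG1, hb⟩ := exists_gauge_borel (θ := zeroForm F p ξ) hΩ hsc hz₀
    (fun z hz v => sub_mem_uC (tauComp_mem 0 _) (smul_mem_uC v (mem_uC_zero_of_mem h.mem hz)))
    (fun z hz v => by
      have hc : ∀ (r : ℝ) (M : M3), r • M = (r : ℂ) • M := fun r M => (Complex.coe_smul r M).symm
      simp only [zeroForm]
      rw [tauComp_mc_real_linear, hc, hc, hc, hc]
      conv_lhs => arg 2; rw [← Complex.re_add_im v]
      module)
    (contDiffOn_zeroForm hF hΩ h.smooth)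
    (fun z hz => zeroForm_flat hF hΩ h.mem h.smooth h.lax hl hz)
  refine ⟨G, hG, hG1, ?_⟩
  have hFG := hF.gauge hΩ hG
  refine (hl.gauge hF hΩ hG).isAdapted hFG hΩ (fun z hz => ?_)
    (smoothLoop_gaugeLoop h.smooth hG.1 hG.isUnit_det)
    (h.lax.gauge hΩ hF.smooth (fun l _ hz => hF.isUnit_det l hz) (fun z hz => (h.mem z hz).1) h.smooth
      hG.1 hG.isUnit_det) fun z hz v => ?_
  · exact conj_mem_LoopUTau (h.mem z hz) (hG.2 z hz)
  · set N := tauComp 0 (mc (gaugeF F G 1) z v) with hN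
    have hN' : N = (G z)⁻¹ * tauComp 0 (mc (F 1) z v) * G z + (G z)⁻¹ * fderiv ℝ G z v := by
      rw [hN, hF.mc_gaugeF hΩ hG.1 1 hz v, gaugeA, tauComp_add, tauComp_conj (hG.2 z hz),
        tauComp_of_mem (mc_gauge_mem hΩ hG hz v)]
    have hNs : Nᴴ = -N := by
      rw [hN, tauComp_conjTranspose, hFG.mc_conjTranspose hΩ 1 hz v, tauComp_neg, neg_zero]
    have e : v • (gaugeLoop ξ G z).coeff (-4 * (p : ℤ)) = N
        - ((G z)⁻¹ * zeroForm F p ξ z v * G z + (G z)⁻¹ * fderiv ℝ G z v) := by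
      rw [hN', coeff_gaugeLoop, zeroForm, mul_sub, sub_mul, Matrix.mul_smul, Matrix.smul_mul]
      abel
    rw [e, ← suPartLin_apply, map_sub, suPartLin_apply, suPartLin_apply,
      suPart_of_borel (hb z hz v), suPart_of_su (tauComp_mem 0 _) hNs, sub_zero]

end

/-! ### The equivalence of the three notions of finite type. -/

section

variable {Ω : Set ℂ} {F : Circle → ℂ → M3} {p : ℕ} {ξ : ℂ → Loop}

theorem gaugeLoop_mem_LoopU {n : ℕ} {G : ℂ → M3} {z : ℂ} (h : ξ z ∈ LoopU n)
    (hG : G z ∈ Matrix.unitaryGroup (Fin 3) ℂ) : gaugeLoop ξ G z ∈ LoopU n := by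
  rw [gaugeLoop, unitary_inv hG]
  exact conj_mem_LoopU h _

/-! ### Gauge invariance of quasi-finite type -/

theorem IsAdapted.isQuasiAdapted (h : IsAdapted Ω F p ξ) : IsQuasiAdapted Ω F p ξ := by
  refine ⟨h.mem, h.smooth, h.lax, fun _ => 0, fun z _ v => ?_, fun l z hz v => ?_⟩
  · change tau 0 = _
    simp [tau]
  · rw [h.adapted l z hz v]
    exact (add_zero _).symm

theorem IsQuasiAdapted.gauge (hF : IsFamily Ω F) (hΩ : IsOpen Ω) (h : IsQuasiAdapted Ω F p ξ)
    {G : ℂ → M3} (hG : IsGauge Ω G) : IsQuasiAdapted Ω (gaugeF F G) p (gaugeLoop ξ G) :=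
  ((h.matchesLeading hF hΩ).gauge hF hΩ hG).isQuasiAdapted (hF.gauge hΩ hG) hΩ
    (fun z hz => conj_mem_LoopUTau (h.mem z hz) (hG.2 z hz))
    (smoothLoop_gaugeLoop h.smooth hG.1 hG.isUnit_det)
    (h.lax.gauge hΩ hF.smooth (fun l _ hz => hF.isUnit_det l hz) (fun z hz => (h.mem z hz).1) h.smooth
      hG.1 hG.isUnit_det)

theorem IsQuasiAdapted.congr {F' : Circle → ℂ → M3} (hΩ : IsOpen Ω)
    (hFF : ∀ l, ∀ z ∈ Ω, F' l z = F l z) (h : IsQuasiAdapted Ω F p ξ) :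
    IsQuasiAdapted Ω F' p ξ := by
  have hm : ∀ l, ∀ z ∈ Ω, ∀ v, mc (F' l) z v = mc (F l) z v := fun l z hz v =>
    mc_congr hΩ (hFF l) hz v
  obtain ⟨B, hB, hA⟩ := h.adapted
  exact ⟨h.mem, h.smooth, fun l z hz v => (h.lax l z hz v).trans (congrArg _ (hm l z hz v).symm),
    B, hB, fun l z hz v => by rw [hm l z hz v, hA l z hz v]⟩

theorem IsQuasiAdapted.hasConstLeading (hF : IsFamily Ω F) (hΩ : IsOpen Ω)
    (hsc : IsSimplyConnected Ω) (h : IsQuasiAdapted Ω F p ξ) : HasConstLeading Ω p ξ :=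
  HamStat.hasConstLeading hF hΩ hsc h.mem h.smooth h.lax (h.matchesLeading hF hΩ)

/-- Adaptedness need not survive the inverse gauge `Gᴴ`, but quasi-adaptedness does. -/
theorem isQuasiFiniteType_of_gauge (hF : IsFamily Ω F) (hΩ : IsOpen Ω) (hsc : IsSimplyConnected Ω)
    {G : ℂ → M3} (hG : IsGauge Ω G) (h : IsFiniteType Ω (gaugeF F G)) : IsQuasiFiniteType Ω F := by
  obtain ⟨hFG, p, ξ, -, hξ⟩ := h
  have hG' : IsGauge Ω fun z => (G z)ᴴ :=
    ⟨contDiffOn_linear_comp conjTransposeLin hG.1, fun z hz => U30_conjTranspose_mem (hG.2 z hz)⟩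
  have hq : IsQuasiAdapted Ω F p (gaugeLoop ξ fun z => (G z)ᴴ) :=
    (hξ.isQuasiAdapted.gauge hFG hΩ hG').congr hΩ fun l z hz => by
      simp only [gaugeF]
      rw [mul_assoc, U30_mul_conjTranspose (hG.2 z hz), mul_one]
  exact ⟨hF, p, _, hq.hasConstLeading hF hΩ hsc, hq⟩

theorem IsQuasiFiniteType.exists_gauge (hΩ : IsOpen Ω) (hsc : IsSimplyConnected Ω)
    (h : IsQuasiFiniteType Ω F) : ∃ G, IsGauge Ω G ∧ IsFiniteType Ω (gaugeF F G) := by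
  obtain ⟨z₀, hz₀⟩ := hsc.nonempty
  obtain ⟨hF, p, ξ, -, hξ⟩ := h
  obtain ⟨G, hG, -, hA⟩ := exists_gauge_isAdapted hF hΩ hsc hz₀ hξ
  have hFG := hF.gauge hΩ hG
  exact ⟨G, hG, hFG, p, _, hA.isQuasiAdapted.hasConstLeading hFG hΩ hsc, hA⟩

/-! ### Based loops -/

theorem IsFamily.contDiffOn_inv (hF : IsFamily Ω F) : ContDiffOn ℝ ∞ (fun z => (F 1 z)⁻¹) Ω :=
  contDiffOn_matrix_inv (hF.smooth 1) fun _ hz => hF.isUnit_det 1 hz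

theorem inv_mem_unitary {g : M3} (h : g ∈ Matrix.unitaryGroup (Fin 3) ℂ) :
    g⁻¹ ∈ Matrix.unitaryGroup (Fin 3) ℂ := by
  rw [unitary_inv h]
  exact Unitary.star_mem h

theorem IsFamily.mc_based (hF : IsFamily Ω F) (hΩ : IsOpen Ω) (l : Circle) {z : ℂ} (hz : z ∈ Ω)
    (v : ℂ) : mc (based F l) z v = F 1 z * (mc (F l) z v - mc (F 1) z v) * (F 1 z)⁻¹ := by
  have h : ∀ m, mc (based F m) z v = gaugeA (fun m => mc (F m)) (fun w => (F 1 w)⁻¹) m z v :=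
    fun m => hF.mc_gaugeF hΩ hF.contDiffOn_inv m hz v
  -- `E_λ` is the gauge transform of `F_λ` by `F⁻¹`, whose inhomogeneous term is the same for all
  -- `λ`; subtracting the trivial case `λ = 1` eliminates it.
  have h1 : mc (based F 1) z v = 0 := by
    rw [mc_congr (f := based F 1) (g := fun _ => 1) hΩ
      (fun w hw => Matrix.mul_nonsing_inv _ (hF.isUnit_det 1 hw)) hz, mc]
    simp
  have e := (h l).trans (sub_zero _).symm
  rw [← h1, h 1] at e
  rw [e]
  simp only [gaugeA, Matrix.nonsing_inv_nonsing_inv _ (hF.isUnit_det 1 hz)]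
  noncomm_ring

theorem IsFamily.mc_sub_mc_one (hF : IsFamily Ω F) (hΩ : IsOpen Ω) (l : Circle) {z : ℂ}
    (hz : z ∈ Ω) (v : ℂ) : mc (F l) z v - mc (F 1) z v =
      shortLoop (part10 (fun w => tauComp 2 (mc (F 1) z w)) v) (tauComp (-1) (mc (F 1) z v)) 0 l
      - shortLoop (part10 (fun w => tauComp 2 (mc (F 1) z w)) v) (tauComp (-1) (mc (F 1) z v)) 0 1 :=
  (congrArg₂ HSub.hSub (hF.mc_eq_shortLoop hΩ l hz v) (hF.mc_eq_shortLoop hΩ 1 hz v)).trans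
    (shortLoop_zero_sub _ _ _ l)

/-- Take `η = F ξ F⁻¹`, the gauge transform of `ξ` by `F⁻¹`. The form `B` disappears, since only
differences with the value at `λ = 1` enter. -/
theorem IsQuasiFiniteType.isBasedFiniteType (hΩ : IsOpen Ω) (h : IsQuasiFiniteType Ω F) :
    IsBasedFiniteType Ω (based F) := by
  obtain ⟨hF, p, ξ, -, hξ⟩ := h
  have hU : ∀ z ∈ Ω, ξ z ∈ LoopU (2 + 4 * p) := fun z hz => (hξ.mem z hz).1
  have hiu : ∀ z ∈ Ω, (F 1 z)⁻¹ ∈ Matrix.unitaryGroup (Fin 3) ℂ := fun z hz =>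
    inv_mem_unitary (hF.unitary 1 z hz)
  have hd : ∀ z ∈ Ω, IsUnit (F 1 z)⁻¹.det := fun z hz => unitary_isUnit_det (hiu z hz)
  have hmem : ∀ z ∈ Ω, gaugeLoop ξ (fun w => (F 1 w)⁻¹) z ∈ LoopU (2 + 4 * p) := fun z hz =>
    gaugeLoop_mem_LoopU (G := fun w => (F 1 w)⁻¹) (hU z hz) (hiu z hz)
  refine ⟨p, gaugeLoop ξ fun z => (F 1 z)⁻¹, hmem, smoothLoop_gaugeLoop hξ.smooth hF.contDiffOn_inv hd,
    hξ.lax.gauge hΩ hF.smooth (fun l _ hz => hF.isUnit_det l hz) hU hξ.smooth hF.contDiffOn_inv hd,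
    fun l z hz v => ?_⟩
  have hl := hξ.matchesLeading hF hΩ z hz v
  have e : (F 1 z)⁻¹⁻¹ = ((F 1 z)⁻¹)ᴴ := unitary_inv (hiu z hz)
  have hFz : F 1 z = ((F 1 z)⁻¹)ᴴ := by
    rw [← e, Matrix.nonsing_inv_nonsing_inv _ (hF.isUnit_det 1 hz)]
  rw [hF.mc_based hΩ l hz, evalAt_projBased_shifted (hmem z hz), hF.mc_sub_mc_one hΩ l hz v,
    hl.1, hl.2, coeff_gaugeLoop, coeff_gaugeLoop, e,
    ← Matrix.smul_mul, ← Matrix.mul_smul, ← Matrix.smul_mul, ← Matrix.mul_smul]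
  have h0 : (0 : M3) = ((F 1 z)⁻¹)ᴴ * 0 * (F 1 z)⁻¹ := by simp
  conv_rhs => rw [h0, shortLoop_conj, shortLoop_conj, ← sub_mul, ← mul_sub, ← hFz]

/-! ### Averaging over the twist -/

/-- Bracketing with an element of degree `j` raises degrees by `j`, so it intertwines the
projections with a shift. -/
theorem tauComp_lie_of_mem {j : ℤ} {N : M3} (hN : N ∈ uC j) (k : ℤ) (M : M3) :
    tauComp k ⁅M, N⁆ = ⁅tauComp (k - j) M, N⁆ := by
  have hN : tau N = Complex.I ^ j • N := hN
  have h : ∀ M, tau ⁅M, N⁆ = Complex.I ^ j • ⁅tau M, N⁆ := fun M => by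
    rw [tau_lie, hN, Ring.lie_def, Ring.lie_def, Matrix.mul_smul, Matrix.smul_mul, smul_sub]
  have hI := Complex.I_ne_zero
  have e1 : Complex.I ^ (-(k - j)) = Complex.I ^ (-k) * Complex.I ^ j := by
    rw [← zpow_add₀ hI]; congr 1; ring
  have e2 : Complex.I ^ (-(2 * (k - j))) =
      Complex.I ^ (-(2 * k)) * (Complex.I ^ j * Complex.I ^ j) := by
    rw [← zpow_add₀ hI, ← zpow_add₀ hI]; congr 1; ring
  have e3 : Complex.I ^ (-(3 * (k - j))) =
      Complex.I ^ (-(3 * k)) * (Complex.I ^ j * Complex.I ^ j * Complex.I ^ j) := by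
    rw [← zpow_add₀ hI, ← zpow_add₀ hI, ← zpow_add₀ hI]; congr 1; ring
  rw [tauComp_eq, tauComp_eq, h, tau_smul, h, tau_smul, tau_smul, h, e1, e2, e3]
  simp only [Ring.lie_def, Matrix.smul_mul, Matrix.mul_smul, add_mul, mul_add]
  module

/-- The projection of `Λ^n u(3)` onto the twisted loops. -/
def twistAverage (n : ℕ) (ξ : Loop) : Loop :=
  ∑ k ∈ Finset.Icc (-(n : ℤ)) n, AddMonoidAlgebra.single k (tauComp k (ξ.coeff k))

theorem coeff_twistAverage {n : ℕ} {ξ : Loop} (h : ξ ∈ LoopU n) (k : ℤ) :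
    (twistAverage n ξ).coeff k = tauComp k (ξ.coeff k) := by
  simp only [twistAverage, AddMonoidAlgebra.coeff_sum, Finsupp.finsetSum_apply,
    AddMonoidAlgebra.coeff_single, Finsupp.single_apply]
  rw [Finset.sum_ite_eq']
  split_ifs with hk
  · rfl
  · rw [h.1 k (notMem_Icc_iff_lt_abs.1 hk), ← tauCompLin_apply, map_zero]

theorem twistAverage_mem {n : ℕ} {ξ : Loop} (h : ξ ∈ LoopU n) : twistAverage n ξ ∈ LoopUTau n := by
  have h' := mem_LoopU_iff.1 h
  refine mem_LoopUTau_iff.2 ⟨mem_LoopU_iff.2 ⟨fun k hk => ?_, fun k => ?_⟩, fun k => ?_⟩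
  · rw [coeff_twistAverage h, h.1 k hk, ← tauCompLin_apply, map_zero]
  · rw [coeff_twistAverage h, coeff_twistAverage h, h'.2, tauComp_neg, tauComp_conjTranspose]
  · rw [coeff_twistAverage h]
    exact tauComp_mem k _

theorem part10_mem_uC {A : ℂ → M3} (v : ℂ) : part10 (fun w => tauComp 2 (A w)) v ∈ uC 2 :=
  smul_mem_uC _ (smul_mem_uC _ (sub_mem_uC (tauComp_mem 2 _) (smul_mem_uC _ (tauComp_mem 2 _))))

theorem part01_mem_uC {A : ℂ → M3} (v : ℂ) : part01 (fun w => tauComp 2 (A w)) v ∈ uC 2 :=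
  smul_mem_uC _ (smul_mem_uC _ (add_mem_uC (tauComp_mem 2 _) (smul_mem_uC _ (tauComp_mem 2 _))))

/-- The mode `λ ^ j` of `A_λ` has degree `j` modulo 4, so bracketing with `A_λ` commutes with the
projection onto twisted loops. -/
theorem tauComp_coeff_lie_deformLoop {n : ℕ} {ξ : Loop} (h : ξ ∈ LoopU n) (A : ℂ → M3) (v : ℂ)
    (k : ℤ) : tauComp k ((⁅ξ, deformLoop A v⁆ : Loop).coeff k) =
      (⁅twistAverage n ξ, deformLoop A v⁆ : Loop).coeff k := by
  have h10 : part10 (fun w => tauComp 2 (A w)) v ∈ uC (-2) := by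
    rw [uC_congr (a := 2) (-1) (by norm_num)]
    exact part10_mem_uC v
  simp only [coeff_lie_deformLoop, tauComp_add, coeff_twistAverage h]
  rw [tauComp_lie_of_mem h10, tauComp_lie_of_mem (part01_mem_uC v),
    tauComp_lie_of_mem (tauComp_mem (-1) _), tauComp_lie_of_mem (tauComp_mem 0 _),
    tauComp_lie_of_mem (tauComp_mem 1 _)]
  simp only [sub_neg_eq_add, sub_zero]

theorem smoothLoop_twistAverage {n : ℕ} (h : ∀ z ∈ Ω, ξ z ∈ LoopU n) (hs : SmoothLoop Ω ξ) :
    SmoothLoop Ω fun z => twistAverage n (ξ z) := fun k =>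
  (contDiffOn_linear_comp ((tauCompLin k).restrictScalars ℝ) (hs k)).congr fun z hz =>
    coeff_twistAverage (h z hz) k

/-- The Lax equation follows from the equations for the Fourier coefficients. -/
theorem fderiv_evalAt_eq_of_coeff {n : ℕ} (hΩ : IsOpen Ω) (hξ : ∀ z ∈ Ω, ξ z ∈ LoopU n)
    (hs : SmoothLoop Ω ξ) {z : ℂ} (hz : z ∈ Ω) {v : ℂ} {B : Loop}
    (h : ∀ k, fderiv ℝ (fun w => (ξ w).coeff k) z v = B.coeff k) (l : Circle) :
    fderiv ℝ (fun w => (ξ w).evalAt l) z v = B.evalAt l := by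
  rw [Loop.evalAt_eq_sum l (s := Finset.Icc (-(n : ℤ)) n), (hasFDerivAt_evalAt hΩ hξ hs hz l).fderiv]
  · simp only [← h]
    simp
  · intro k hk
    have : (fun w => (ξ w).coeff k) =ᶠ[𝓝 z] fun _ => 0 := by
      filter_upwards [hΩ.mem_nhds hz] with w hw
      exact (hξ w hw).1 k (notMem_Icc_iff_lt_abs.1 hk)
    rw [← h, this.fderiv_eq]
    simp

theorem lax_twistAverage {n : ℕ} (hF : IsFamily Ω F) (hΩ : IsOpen Ω) (hξ : ∀ z ∈ Ω, ξ z ∈ LoopU n)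
    (hs : SmoothLoop Ω ξ) (h : Lax Ω ξ fun l => mc (F l)) :
    Lax Ω (fun z => twistAverage n (ξ z)) fun l => mc (F l) := by
  intro l z hz v
  have hA : ∀ l, mc (F l) z v = (deformLoop (mc (F 1) z) v).evalAt l := fun l => by
    rw [evalAt_deformLoop, hF.deformation l z hz v]
  refine Eq.trans ?_ (congrArg _ (hA l).symm)
  rw [← Loop.evalAt_lie]
  refine fderiv_evalAt_eq_of_coeff hΩ (fun z hz => (twistAverage_mem (hξ z hz)).1)
    (smoothLoop_twistAverage hξ hs) hz (fun k => ?_) l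
  rw [← tauComp_coeff_lie_deformLoop (hξ z hz), ← fderiv_coeff_eq_of_lax hΩ hξ hs hz (fun l => by
    rw [← hA]; exact h l z hz v) k, ← tauCompLin_apply]
  have e : (fun w => (twistAverage n (ξ w)).coeff k) =ᶠ[𝓝 z] fun w => tauComp k ((ξ w).coeff k) := by
    filter_upwards [hΩ.mem_nhds hz] with w hw using coeff_twistAverage (hξ w hw) k
  rw [e.fderiv_eq]
  exact fderiv_linear_comp ((tauCompLin k).restrictScalars ℝ)
    (differentiableAt_of_smooth hΩ (hs k) hz) v

/-- `F⁻¹ηF` solves the Lax equation and has the right leading modes but need not be twisted; its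
twist average keeps both properties. -/
theorem isQuasiFiniteType_of_based (hF : IsFamily Ω F) (hΩ : IsOpen Ω) (hsc : IsSimplyConnected Ω)
    (h : IsBasedFiniteType Ω (based F)) : IsQuasiFiniteType Ω F := by
  obtain ⟨p, η, hη, hηs, hηl, hηa⟩ := h
  have hFu : ∀ z ∈ Ω, IsUnit (F 1 z).det := fun z hz => hF.isUnit_det 1 hz
  set ζ := gaugeLoop η (F 1) with hζ
  have hmem : ∀ z ∈ Ω, ζ z ∈ LoopU (2 + 4 * p) := fun z hz =>
    gaugeLoop_mem_LoopU (hη z hz) (hF.unitary 1 z hz)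
  have hs : SmoothLoop Ω ζ := smoothLoop_gaugeLoop hηs (hF.smooth 1) hFu
  have hlax : Lax Ω ζ fun l => mc (F l) := by
    have h1 : Lax Ω ζ fun l => mc (gaugeF (based F) (F 1) l) :=
      hηl.gauge hΩ (fun l => (hF.smooth l).mul hF.contDiffOn_inv) (fun l z hz => unitary_isUnit_det
        (mul_mem (hF.unitary l z hz) (inv_mem_unitary (hF.unitary 1 z hz)))) hη hηs (hF.smooth 1) hFu
    intro l z hz v
    refine (h1 l z hz v).trans (congrArg _ (mc_congr hΩ (fun w hw => ?_) hz v))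
    rw [gaugeF, based, mul_assoc, Matrix.nonsing_inv_mul _ (hFu w hw), mul_one]
  have hl : MatchesLeading Ω F p ζ := by
    intro z hz v
    set a := part10 (fun w => tauComp 2 (mc (F 1) z w)) v with ha
    set b := tauComp (-1) (mc (F 1) z v) with hb
    set a' := v • (ζ z).coeff (-4 * (p : ℤ) - 2) with ha'
    set b' := v • (ζ z).coeff (-4 * (p : ℤ) - 1) with hb'
    have key : ∀ l, shortLoop a b 0 l - shortLoop a b 0 1 =
        shortLoop a' b' 0 l - shortLoop a' b' 0 1 := by
      intro l
      have h1 := hηa l z hz v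
      rw [hF.mc_based hΩ l hz, evalAt_projBased_shifted (hη z hz), hF.mc_sub_mc_one hΩ l hz v,
        ← ha, ← hb] at h1
      have h2 := congrArg (fun M => (F 1 z)⁻¹ * M * F 1 z) h1
      have h0 : (0 : M3) = (F 1 z)ᴴ * 0 * F 1 z := by simp
      simp only [mul_assoc, Matrix.nonsing_inv_mul _ (hFu z hz), mul_one] at h2
      rw [← mul_assoc, Matrix.nonsing_inv_mul _ (hFu z hz), one_mul] at h2
      rw [h2, ← mul_assoc, ha', hb', hζ, coeff_gaugeLoop, coeff_gaugeLoop,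
        unitary_inv (hF.unitary 1 z hz), ← Matrix.smul_mul, ← Matrix.mul_smul, ← Matrix.smul_mul,
        ← Matrix.mul_smul]
      conv_rhs => rw [h0, shortLoop_conj, shortLoop_conj, ← sub_mul, ← mul_sub]
    -- The based equation determines the loops only up to a constant, which is placed in the third
    -- slot and ignored afterwards.
    have := shortLoop_inj (a := a) (b := b) (c := 0 - shortLoop a b 0 1) (a' := a') (b' := b')
      (c' := 0 - shortLoop a' b' 0 1) fun l => by
        rw [shortLoop_one_sub, shortLoop_one_sub, key l]
    exact ⟨this.1, this.2.1⟩
  -- The two leading coefficients agree with components of `A`, so they already have the correct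
  -- degree and averaging does not change them.
  have hl' : MatchesLeading Ω F p fun z => twistAverage (2 + 4 * p) (ζ z) := by
    intro z hz v
    have h := hl z hz v
    rw [coeff_twistAverage (hmem z hz), coeff_twistAverage (hmem z hz), ← tauComp_smul, ← tauComp_smul,
      ← h.1, ← h.2, tauComp_congr (a := 2) (b := -4 * (p : ℤ) - 2) (-(p : ℤ) - 1) (by ring),
      tauComp_congr (a := -1) (b := -4 * (p : ℤ) - 1) (-(p : ℤ)) (by ring)]
    exact ⟨(tauComp_of_mem (part10_mem_uC v)).symm, (tauComp_of_mem (tauComp_mem _ _)).symm⟩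
  have hq := hl'.isQuasiAdapted hF hΩ (fun z hz => twistAverage_mem (hmem z hz))
    (smoothLoop_twistAverage hmem hs) (lax_twistAverage hF hΩ hmem hs hlax)
  exact ⟨hF, p, _, hq.hasConstLeading hF hΩ hsc, hq⟩

end

end HamStat

end

theorem theorem3p3 (Ω : Set ℂ) (hΩ : IsOpen Ω) (hsc : IsSimplyConnected Ω)
    (z₀ : ℂ) (hz₀ : z₀ ∈ Ω) (F : Circle → ℂ → M3) (hF : IsFamily Ω F) :
    (∀ (p : ℕ) (ξ : ℂ → Loop), IsQuasiAdapted Ω F p ξ →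
      ∃ G : ℂ → M3, IsGauge Ω G ∧ G z₀ = 1 ∧
        IsFiniteType Ω (gaugeF F G) ∧
        HasConstLeading Ω p (gaugeLoop ξ G) ∧
        IsAdapted Ω (gaugeF F G) p (gaugeLoop ξ G) ∧
        ∀ l, ∀ z ∈ Ω, ∀ v,
          mc (gaugeF F G l) z v
            = gaugeA (fun m => mc (F m)) G l z v ∧
          fderiv ℝ (fun w => (gaugeLoop ξ G w).evalAt l) z v
              + ⁅gaugeA (fun m => mc (F m)) G l z v,
                  (gaugeLoop ξ G z).evalAt l⁆
            = (G z)⁻¹ * (fderiv ℝ (fun w => (ξ w).evalAt l) z v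
                + ⁅mc (F l) z v, (ξ z).evalAt l⁆) * G z ∧
          fderiv ℝ (fun w => (gaugeLoop ξ G w).evalAt l) z v
              + ⁅gaugeA (fun m => mc (F m)) G l z v,
                  (gaugeLoop ξ G z).evalAt l⁆ = 0 ∧
          (shifted p (gaugeLoop ξ G z) v).projSu.evalAt l
            = gaugeA (fun m => mc (F m)) G l z v) ∧
    (IsQuasiFiniteType Ω F ↔
      ∃ G : ℂ → M3, IsGauge Ω G ∧
        IsFiniteType Ω (gaugeF F G)) ∧
    ((∃ G : ℂ → M3, IsGauge Ω G ∧
        IsFiniteType Ω (gaugeF F G)) ↔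
      IsBasedFiniteType Ω (based F)) := by
  refine ⟨fun p ξ hξ => ?_, ⟨fun h => h.exists_gauge hΩ hsc, fun ⟨G, hG, h⟩ =>
    isQuasiFiniteType_of_gauge hF hΩ hsc hG h⟩, fun ⟨G, hG, h⟩ =>
    (isQuasiFiniteType_of_gauge hF hΩ hsc hG h).isBasedFiniteType hΩ,
    fun h => (isQuasiFiniteType_of_based hF hΩ hsc h).exists_gauge hΩ hsc⟩
  obtain ⟨G, hG, hG1, hA⟩ := exists_gauge_isAdapted hF hΩ hsc hz₀ hξ
  have hFG := hF.gauge hΩ hG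
  have hl := hA.isQuasiAdapted.hasConstLeading hFG hΩ hsc
  refine ⟨G, hG, hG1, ⟨hFG, p, _, hl, hA⟩, hl, hA, fun l z hz v => ?_⟩
  have hmc := hF.mc_gaugeF hΩ hG.1 l hz v
  refine ⟨hmc, lax_gauge hΩ (fun z hz => (hξ.mem z hz).1) hξ.smooth hG.1 hG.isUnit_det l hz v, ?_,
    (hA.adapted l z hz v).trans hmc⟩
  rw [hA.lax l z hz v, ← ring_lie_skew, ← hmc, neg_add_cancel]
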